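/- Let $\mathbb K$ be a field of characteristic zero. All props are linear; $(21)$ is the transposition of two inputs. Let $\mathrm{Alg}$ (resp. $\mathrm{Poisson}$) be the prop over $\mathbb K$ of unital associative algebras, generated by $\eta\in\mathrm{Alg}(0,1)$, $m\in\mathrm{Alg}(2,1)$ (resp. of Poisson algebras, generated by $\eta$, $m$ and a bracket $P$ of bidegree $(2,1)$). Let $\mathrm{Alg}_{\mathrm{qcom}}$ be the prop over $\mathbb K[[\hbar]]$ which is the quotient of $\mathrm{Alg}[[\hbar]]\langle \tilde P\rangle/(m-m\circ(21)=\hbar\tilde P)$ by its torsion ideal, where $\tilde P$ has bidegree $(2,1)$ and props over $\mathbb K[[\hbar]]$ are understood $\hbar$-adically completed. Let $\mathcal{FL}_N$ be the free Lie algebra on generators $x_1,\dots,x_N$ with $x_i$ of degree $\delta_i\in\mathbb Z_{\ge0}^N$, let $\mathfrak g=\mathcal{FL}_N^{\oplus n}$, let $U(\mathfrak g)^{\le k}$ be the span of the products of at most $k$ elements of $\mathfrak g$, and let $(U(\mathcal{FL}_N)^{\otimes n})^{\le k}$ be its image under the identification $U(\mathfrak g)=U(\mathcal{FL}_N)^{\otimes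 n}$. The subscript $\sum_i\delta_i$ denotes the homogeneous component of degree $\delta_1+\dots+\delta_N$. Then: 1. For all $N,n\ge 0$, evaluation of operations at $x_1\otimes\cdots\otimes x_N$ identifies $\mathrm{Alg}(N,n)$ with $(U(\mathcal{FL}_N)^{\otimes n})_{\sum_i\delta_i}$. There is a unique prop morphism $\mathrm{Alg}_{\mathrm{qcom}}\to\mathrm{Alg}((\hbar))$ over $\mathbb K[[\hbar]]$ with $\eta\mapsto\eta$, $m\mapsto m$. It maps $\tilde P$ to $\hbar^{-1}(m-m\circ(21))$, it is injective, and under the above identification its image in bidegree $(N,n)$ is, for all $N,n\geq 0$, $$\sum_{k\ge 0}\hbar^{k-N}\bigl(U(\mathcal{FL}_N)^{\otimes n}\bigr)^{\le k}_{\sum_i\delta_i}[[\hbar]]\ \subset\ \mathrm{Alg}(N,n)((\hbar)).$$ 2. There is a unique prop morphism $\mathrm{Poisson}\to\mathrm{Alg}_{\mathrm{qcom}}/(\hbar)$ over $\mathbb K$ taking $\eta,m,P$ to the classes of $\eta,m,\tilde P$. It is an isomorphism; in particular $\mathrm{Alg}_{\mathrm{qcom}}(N,n)/(\hbar)\simeq\mathrm{Poisson}(N,n)$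 for all $N,n\ge0$. 3. $\mathrm{Alg}_{\mathrm{qcom}}$ is a flat deformation of $\mathrm{Poisson}$: every $\mathrm{Alg}_{\mathrm{qcom}}(N,n)$ is a topologically free $\mathbb K[[\hbar]]$-module (isomorphic to $V[[\hbar]]$ for a $\mathbb K$-vector space $V$), and the reduction of $\mathrm{Alg}_{\mathrm{qcom}}$ modulo $\hbar$ is isomorphic to the prop $\mathrm{Poisson}$. -/

import Mathlib

open scoped TensorProduct PowerSeries LaurentSeries DirectSum

universe u v

noncomputable section

/-- The permutation `σ * τ` acting blockwise on `{1, …, n + n'}`. -/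
def blockPerm {n m n' m' : ℕ} (e : Fin n ≃ Fin m) (f : Fin n' ≃ Fin m') :
    Fin (n + n') ≃ Fin (m + m') :=
  finSumFinEquiv.symm.trans ((Equiv.sumCongr e f).trans finSumFinEquiv)

/-- An `R`-linear prop. `Hom n m` is the module of operations with `n` inputs and `m` outputs,
`comp f g` is `g ∘ f`, `tens f g` is `f ⊗ g`, and `perm σ` is the operation that moves the `i`-th
input to the output with number `σ i`. Permutations are given as bijections `Fin n ≃ Fin m`, so
`n = m` holds automatically and `perm (finCongr h)` is the transport along `h : n = m`. -/
structure LinProp (R : Type u) [CommRing R] where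
  Hom : ℕ → ℕ → Type v
  [instAdd : ∀ n m, AddCommGroup (Hom n m)]
  [instMod : ∀ n m, Module R (Hom n m)]
  comp : ∀ {n m p : ℕ}, Hom n m →ₗ[R] Hom m p →ₗ[R] Hom n p
  tens : ∀ {n m n' m' : ℕ}, Hom n m →ₗ[R] Hom n' m' →ₗ[R] Hom (n + n') (m + m')
  perm : ∀ {n m : ℕ}, (Fin n ≃ Fin m) → Hom n m
  comp_assoc : ∀ {n m p q : ℕ} (x : Hom n m) (y : Hom m p) (z : Hom p q),
    comp (comp x y) z = comp x (comp y z)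
  id_comp : ∀ {n m : ℕ} (x : Hom n m), comp (perm (Equiv.refl (Fin n))) x = x
  comp_id : ∀ {n m : ℕ} (x : Hom n m), comp x (perm (Equiv.refl (Fin m))) = x
  perm_trans : ∀ {n m p : ℕ} (e : Fin n ≃ Fin m) (f : Fin m ≃ Fin p),
    perm (e.trans f) = comp (perm e) (perm f)
  tens_comp : ∀ {n m p n' m' p' : ℕ} (x : Hom n m) (y : Hom m p) (x' : Hom n' m')
    (y' : Hom m' p'), tens (comp x y) (comp x' y') = comp (tens x x') (tens y y')
  tens_assoc : ∀ {n m n' m' n'' m'' : ℕ} (x : Hom n m) (y : Hom n' m') (z : Hom n'' m''),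
    comp (tens (tens x y) z) (perm (finCongr (Nat.add_assoc m m' m''))) =
      comp (perm (finCongr (Nat.add_assoc n n' n''))) (tens x (tens y z))
  id_tens : ∀ {n m : ℕ} (x : Hom n m),
    comp (tens (perm (Equiv.refl (Fin 0))) x) (perm (finCongr (Nat.zero_add m))) =
      comp (perm (finCongr (Nat.zero_add n))) x
  perm_tens : ∀ {n m n' m' : ℕ} (e : Fin n ≃ Fin m) (f : Fin n' ≃ Fin m'),
    perm (blockPerm e f) = tens (perm e) (perm f)
  tens_symm : ∀ {n m n' m' : ℕ} (x : Hom n m) (y : Hom n' m'),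
    comp (tens x y) (perm finAddFlip) = comp (perm finAddFlip) (tens y x)

attribute [instance] LinProp.instAdd LinProp.instMod

/-- A morphism of props, semilinear along a ring homomorphism of the base rings. -/
structure PropHom {R : Type u} {S : Type v} [CommRing R] [CommRing S] (σ : R →+* S)
    (P : LinProp.{u, u} R) (Q : LinProp.{v, v} S) where
  app : ∀ n m : ℕ, P.Hom n m →ₛₗ[σ] Q.Hom n m
  map_comp : ∀ {n m p : ℕ} (x : P.Hom n m) (y : P.Hom m p),
    app n p (P.comp x y) = Q.comp (app n m x) (app m p y)
  map_tens : ∀ {n m n' m' : ℕ} (x : P.Hom n m) (y : P.Hom n' m'),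
    app (n + n') (m + m') (P.tens x y) = Q.tens (app n m x) (app n' m' y)
  map_perm : ∀ {n m : ℕ} (e : Fin n ≃ Fin m), app n m (P.perm e) = Q.perm e

/-! ### Ideals and quotients -/

/-- An ideal of a prop. -/
structure PropIdeal {R : Type u} [CommRing R] (P : LinProp.{u, v} R) where
  carrier : ∀ n m : ℕ, Submodule R (P.Hom n m)
  comp_left : ∀ {n m p : ℕ} {x : P.Hom n m} (y : P.Hom m p),
    x ∈ carrier n m → P.comp x y ∈ carrier n p
  comp_right : ∀ {n m p : ℕ} (x : P.Hom n m) {y : P.Hom m p},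
    y ∈ carrier m p → P.comp x y ∈ carrier n p
  tens_left : ∀ {n m n' m' : ℕ} {x : P.Hom n m} (y : P.Hom n' m'),
    x ∈ carrier n m → P.tens x y ∈ carrier (n + n') (m + m')
  tens_right : ∀ {n m n' m' : ℕ} (x : P.Hom n m) {y : P.Hom n' m'},
    y ∈ carrier n' m' → P.tens x y ∈ carrier (n + n') (m + m')

/-- A bilinear map descends to quotients by compatible submodules. -/
def quotBilin {R : Type u} [CommRing R] {X Y Z : Type v} [AddCommGroup X] [AddCommGroup Y]
    [AddCommGroup Z] [Module R X] [Module R Y] [Module R Z] (f : X →ₗ[R] Y →ₗ[R] Z)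
    (A : Submodule R X) (B : Submodule R Y) (C : Submodule R Z)
    (hA : ∀ x ∈ A, ∀ y, f x y ∈ C) (hB : ∀ x, ∀ y ∈ B, f x y ∈ C) :
    (X ⧸ A) →ₗ[R] (Y ⧸ B) →ₗ[R] (Z ⧸ C) :=
  A.liftQ
    { toFun := fun x => B.mapQ C (f x) (hB x)
      map_add' := by
        intro x x'
        ext y
        simp
      map_smul' := by
        intro r x
        ext y
        simp }
    (by
      intro x hx
      rw [LinearMap.mem_ker]
      ext y
      simpa using hA x hx y)

@[simp] theorem quotBilin_mk {R : Type u} [CommRing R] {X Y Z : Type v} [AddCommGroup X]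
    [AddCommGroup Y] [AddCommGroup Z] [Module R X] [Module R Y] [Module R Z]
    (f : X →ₗ[R] Y →ₗ[R] Z) (A : Submodule R X) (B : Submodule R Y) (C : Submodule R Z)
    (hA : ∀ x ∈ A, ∀ y, f x y ∈ C) (hB : ∀ x, ∀ y ∈ B, f x y ∈ C) (x : X) (y : Y) :
    quotBilin f A B C hA hB (Submodule.Quotient.mk x) (Submodule.Quotient.mk y) =
      Submodule.Quotient.mk (f x y) := rfl

/-- The quotient of a prop by an ideal. -/
def LinProp.quot {R : Type u} [CommRing R] (P : LinProp.{u, v} R) (I : PropIdeal P) :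
    LinProp.{u, v} R where
  Hom n m := P.Hom n m ⧸ I.carrier n m
  comp {n m p} := quotBilin P.comp (I.carrier n m) (I.carrier m p) (I.carrier n p)
    (fun _ hx y => I.comp_left y hx) (fun x _ hy => I.comp_right x hy)
  tens {n m n' m'} := quotBilin P.tens (I.carrier n m) (I.carrier n' m')
    (I.carrier (n + n') (m + m'))
    (fun _ hx y => I.tens_left y hx) (fun x _ hy => I.tens_right x hy)
  perm e := Submodule.Quotient.mk (P.perm e)
  comp_assoc x y z := by
    obtain ⟨x, rfl⟩ := Submodule.Quotient.mk_surjective _ x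
    obtain ⟨y, rfl⟩ := Submodule.Quotient.mk_surjective _ y
    obtain ⟨z, rfl⟩ := Submodule.Quotient.mk_surjective _ z
    simp only [quotBilin_mk, P.comp_assoc]
  id_comp x := by
    obtain ⟨x, rfl⟩ := Submodule.Quotient.mk_surjective _ x
    simp only [quotBilin_mk, P.id_comp]
  comp_id x := by
    obtain ⟨x, rfl⟩ := Submodule.Quotient.mk_surjective _ x
    simp only [quotBilin_mk, P.comp_id]
  perm_trans e f := by simp only [quotBilin_mk, P.perm_trans]
  tens_comp x y x' y' := by
    obtain ⟨x, rfl⟩ := Submodule.Quotient.mk_surjective _ x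
    obtain ⟨y, rfl⟩ := Submodule.Quotient.mk_surjective _ y
    obtain ⟨x', rfl⟩ := Submodule.Quotient.mk_surjective _ x'
    obtain ⟨y', rfl⟩ := Submodule.Quotient.mk_surjective _ y'
    simp only [quotBilin_mk, P.tens_comp]
  tens_assoc x y z := by
    obtain ⟨x, rfl⟩ := Submodule.Quotient.mk_surjective _ x
    obtain ⟨y, rfl⟩ := Submodule.Quotient.mk_surjective _ y
    obtain ⟨z, rfl⟩ := Submodule.Quotient.mk_surjective _ z
    simp only [quotBilin_mk, P.tens_assoc]
  id_tens x := by
    obtain ⟨x, rfl⟩ := Submodule.Quotient.mk_surjective _ x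
    simp only [quotBilin_mk, P.id_tens]
  perm_tens e f := by simp only [quotBilin_mk, P.perm_tens]
  tens_symm x y := by
    obtain ⟨x, rfl⟩ := Submodule.Quotient.mk_surjective _ x
    obtain ⟨y, rfl⟩ := Submodule.Quotient.mk_surjective _ y
    simp only [quotBilin_mk, P.tens_symm]

theorem apply_mem_smul_top {R : Type u} [CommRing R] {X Y : Type v} [AddCommGroup X]
    [AddCommGroup Y] [Module R X] [Module R Y] (f : X →ₗ[R] Y) (J : Ideal R) {x : X}
    (hx : x ∈ (J • ⊤ : Submodule R X)) : f x ∈ (J • ⊤ : Submodule R Y) := by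
  have h : f x ∈ Submodule.map f (J • ⊤ : Submodule R X) := ⟨x, hx, rfl⟩
  rw [Submodule.map_smul''] at h
  exact Submodule.smul_mono le_rfl le_top h

/-- The ideal `J P` of a prop `P` given by an ideal `J` of the base ring. -/
def LinProp.smulIdeal {R : Type u} [CommRing R] (P : LinProp.{u, v} R) (J : Ideal R) :
    PropIdeal P where
  carrier _ _ := J • ⊤
  comp_left y hx := apply_mem_smul_top (P.comp.flip y) J hx
  comp_right x _ hy := apply_mem_smul_top (P.comp x) J hy
  tens_left y hx := apply_mem_smul_top (P.tens.flip y) J hx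
  tens_right x _ hy := apply_mem_smul_top (P.tens x) J hy

theorem apply_mem_torsion {R : Type u} [CommRing R] {X Y : Type v} [AddCommGroup X]
    [AddCommGroup Y] [Module R X] [Module R Y] (f : X →ₗ[R] Y) {x : X}
    (hx : x ∈ Submodule.torsion R X) : f x ∈ Submodule.torsion R Y := by
  rw [Submodule.mem_torsion_iff] at hx ⊢
  obtain ⟨a, ha⟩ := hx
  refine ⟨a, ?_⟩
  have h := congrArg f ha
  rw [map_zero] at h
  rw [← h, Submonoid.smul_def, Submonoid.smul_def, map_smul]

/-- The torsion ideal of a prop. -/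
def LinProp.torsionIdeal {R : Type u} [CommRing R] (P : LinProp.{u, v} R) : PropIdeal P where
  carrier n m := Submodule.torsion R (P.Hom n m)
  comp_left y hx := apply_mem_torsion (P.comp.flip y) hx
  comp_right x _ hy := apply_mem_torsion (P.comp x) hy
  tens_left y hx := apply_mem_torsion (P.tens.flip y) hx
  tens_right x _ hy := apply_mem_torsion (P.tens x) hy

/-! ### Adic completion -/

/-- The extension of a bilinear map to adic completions. -/
def adicBilin {R : Type u} [CommRing R] (J : Ideal R) {X Y Z : Type v} [AddCommGroup X]
    [AddCommGroup Y] [AddCommGroup Z] [Module R X] [Module R Y] [Module R Z]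
    (f : X →ₗ[R] Y →ₗ[R] Z) :
    AdicCompletion J X →ₗ[R] AdicCompletion J Y →ₗ[R] AdicCompletion J Z :=
  LinearMap.mk₂ R
    (fun x y => ⟨fun k => quotBilin f (J ^ k • ⊤) (J ^ k • ⊤) (J ^ k • ⊤)
        (fun x hx y => show f x y ∈ _ from apply_mem_smul_top (f.flip y) _ hx)
        (fun x _ hy => apply_mem_smul_top (f x) _ hy) (x.1 k) (y.1 k), by
      intro m n hmn
      obtain ⟨a, ha⟩ := Submodule.Quotient.mk_surjective _ (x.1 n)
      obtain ⟨b, hb⟩ := Submodule.Quotient.mk_surjective _ (y.1 n)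
      beta_reduce
      have hx := x.2 hmn
      have hy := y.2 hmn
      rw [← ha] at hx
      rw [← hb] at hy
      rw [← hx, ← hy, ← ha, ← hb]
      rfl⟩)
    (fun x x' y => by
      apply Subtype.ext
      funext k
      change quotBilin f _ _ _ _ _ (x.1 k + x'.1 k) (y.1 k) = _
      rw [map_add]
      rfl)
    (fun r x y => by
      apply Subtype.ext
      funext k
      change quotBilin f _ _ _ _ _ (r • x.1 k) (y.1 k) = _
      rw [map_smul]
      rfl)
    (fun x y y' => by
      apply Subtype.ext
      funext k
      change quotBilin f _ _ _ _ _ (x.1 k) (y.1 k + y'.1 k) = _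
      rw [map_add]
      rfl)
    (fun r x y => by
      apply Subtype.ext
      funext k
      change quotBilin f _ _ _ _ _ (x.1 k) (r • y.1 k) = _
      rw [map_smul]
      rfl)

theorem adicCompletion_ext {R : Type u} [CommRing R] {J : Ideal R} {X : Type v} [AddCommGroup X]
    [Module R X] {x y : AdicCompletion J X} (h : ∀ k, x.1 k = y.1 k) : x = y :=
  Subtype.ext (funext h)

/-- The `J`-adic completion of a prop: all modules of operations are completed. -/
def LinProp.completion {R : Type u} [CommRing R] (P : LinProp.{u, v} R) (J : Ideal R) :
    LinProp.{u, v} R where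
  Hom n m := AdicCompletion J (P.Hom n m)
  comp := adicBilin J P.comp
  tens := adicBilin J P.tens
  perm e := AdicCompletion.of J _ (P.perm e)
  comp_assoc x y z := adicCompletion_ext fun k =>
    (P.quot (P.smulIdeal (J ^ k))).comp_assoc (x.1 k) (y.1 k) (z.1 k)
  id_comp x := adicCompletion_ext fun k => (P.quot (P.smulIdeal (J ^ k))).id_comp (x.1 k)
  comp_id x := adicCompletion_ext fun k => (P.quot (P.smulIdeal (J ^ k))).comp_id (x.1 k)
  perm_trans e f := adicCompletion_ext fun k => (P.quot (P.smulIdeal (J ^ k))).perm_trans e f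
  tens_comp x y x' y' := adicCompletion_ext fun k =>
    (P.quot (P.smulIdeal (J ^ k))).tens_comp (x.1 k) (y.1 k) (x'.1 k) (y'.1 k)
  tens_assoc x y z := adicCompletion_ext fun k =>
    (P.quot (P.smulIdeal (J ^ k))).tens_assoc (x.1 k) (y.1 k) (z.1 k)
  id_tens x := adicCompletion_ext fun k => (P.quot (P.smulIdeal (J ^ k))).id_tens (x.1 k)
  perm_tens e f := adicCompletion_ext fun k => (P.quot (P.smulIdeal (J ^ k))).perm_tens e f
  tens_symm x y := adicCompletion_ext fun k =>
    (P.quot (P.smulIdeal (J ^ k))).tens_symm (x.1 k) (y.1 k)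

/-! ### Extension of scalars -/

/-- The extension of scalars of a bilinear map. -/
def bilinBaseChange {R : Type u} [CommRing R] (S : Type u) [CommRing S] [Algebra R S]
    {X Y Z : Type u} [AddCommGroup X] [AddCommGroup Y] [AddCommGroup Z] [Module R X] [Module R Y]
    [Module R Z] (f : X →ₗ[R] Y →ₗ[R] Z) :
    (S ⊗[R] X) →ₗ[S] (S ⊗[R] Y) →ₗ[S] (S ⊗[R] Z) :=
  (TensorProduct.AlgebraTensorModule.homTensorHomMap R S S S Y S Z).comp
    (TensorProduct.AlgebraTensorModule.map (LinearMap.mul S S) f)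

@[simp] theorem bilinBaseChange_tmul {R : Type u} [CommRing R] (S : Type u) [CommRing S]
    [Algebra R S] {X Y Z : Type u} [AddCommGroup X] [AddCommGroup Y] [AddCommGroup Z] [Module R X]
    [Module R Y] [Module R Z] (f : X →ₗ[R] Y →ₗ[R] Z) (a b : S) (x : X) (y : Y) :
    bilinBaseChange S f (a ⊗ₜ x) (b ⊗ₜ y) = (a * b) ⊗ₜ f x y := rfl

/-- The prop `S ⊗ P` over `S` obtained from a prop `P` over `R` by extension of scalars. -/
def LinProp.baseChange {R : Type u} [CommRing R] (P : LinProp.{u, u} R) (S : Type u) [CommRing S]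
    [Algebra R S] : LinProp.{u, u} S where
  Hom n m := S ⊗[R] P.Hom n m
  comp := bilinBaseChange S P.comp
  tens := bilinBaseChange S P.tens
  perm e := 1 ⊗ₜ P.perm e
  comp_assoc x y z := by
    induction x with
    | zero => simp
    | add x x' hx hx' => simp only [map_add, LinearMap.add_apply, hx, hx']
    | tmul a x =>
    induction y with
    | zero => simp
    | add y y' hy hy' => simp only [map_add, LinearMap.add_apply, hy, hy']
    | tmul b y =>
    induction z with
    | zero => simp
    | add z z' hz hz' => simp only [map_add, hz, hz']
    | tmul c z => simp [P.comp_assoc, mul_assoc]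
  id_comp x := by
    induction x with
    | zero => simp
    | add x x' hx hx' => simp only [map_add, hx, hx']
    | tmul a x => simp [P.id_comp]
  comp_id x := by
    induction x with
    | zero => simp
    | add x x' hx hx' => simp only [map_add, LinearMap.add_apply, hx, hx']
    | tmul a x => simp [P.comp_id]
  perm_trans e f := by simp [P.perm_trans]
  tens_comp x y x' y' := by
    induction x with
    | zero => simp
    | add x₁ x₂ h₁ h₂ => simp only [map_add, LinearMap.add_apply, h₁, h₂]
    | tmul a x =>
    induction y with
    | zero => simp
    | add y₁ y₂ h₁ h₂ => simp only [map_add, LinearMap.add_apply, h₁, h₂]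
    | tmul b y =>
    induction x' with
    | zero => simp
    | add x₁ x₂ h₁ h₂ => simp only [map_add, LinearMap.add_apply, h₁, h₂]
    | tmul a' x' =>
    induction y' with
    | zero => simp
    | add y₁ y₂ h₁ h₂ => simp only [map_add, h₁, h₂]
    | tmul b' y' => simp [P.tens_comp, mul_mul_mul_comm]
  tens_assoc x y z := by
    induction x with
    | zero => simp
    | add x x' hx hx' => simp only [map_add, LinearMap.add_apply, hx, hx']
    | tmul a x =>
    induction y with
    | zero => simp
    | add y y' hy hy' => simp only [map_add, LinearMap.add_apply, hy, hy']
    | tmul b y =>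
    induction z with
    | zero => simp
    | add z z' hz hz' => simp only [map_add, LinearMap.add_apply, hz, hz']
    | tmul c z => simp [P.tens_assoc, mul_assoc]
  id_tens x := by
    induction x with
    | zero => simp
    | add x x' hx hx' => simp only [map_add, LinearMap.add_apply, hx, hx']
    | tmul a x => simp [P.id_tens]
  perm_tens e f := by simp [P.perm_tens]
  tens_symm x y := by
    induction x with
    | zero => simp
    | add x x' hx hx' => simp only [map_add, LinearMap.add_apply, hx, hx']
    | tmul a x =>
    induction y with
    | zero => simp
    | add y y' hy hy' => simp only [map_add, LinearMap.add_apply, hy, hy']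
    | tmul b y => simp [P.tens_symm, mul_comm a b]

/-! ### Props presented by generators and relations -/

/-- Formal expressions in generators `G n m` of bidegree `(n, m)`. -/
inductive PTerm (R : Type u) (G : ℕ → ℕ → Type) : ℕ → ℕ → Type u
  | gen {n m : ℕ} (g : G n m) : PTerm R G n m
  | perm {n m : ℕ} (e : Fin n ≃ Fin m) : PTerm R G n m
  | comp {n m p : ℕ} (x : PTerm R G n m) (y : PTerm R G m p) : PTerm R G n p
  | tens {n m n' m' : ℕ} (x : PTerm R G n m) (y : PTerm R G n' m') :
      PTerm R G (n + n') (m + m')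
  | zero {n m : ℕ} : PTerm R G n m
  | add {n m : ℕ} (x y : PTerm R G n m) : PTerm R G n m
  | smul {n m : ℕ} (r : R) (x : PTerm R G n m) : PTerm R G n m

/-- The congruence on formal expressions generated by the axioms of an `R`-linear prop and by the
relations `E`. -/
inductive PTerm.Rel {R : Type u} [CommRing R] {G : ℕ → ℕ → Type}
    (E : ∀ {n m : ℕ}, PTerm R G n m → PTerm R G n m → Prop) :
    ∀ {n m : ℕ}, PTerm R G n m → PTerm R G n m → Prop
  | of {n m : ℕ} {x y : PTerm R G n m} : E x y → Rel E x y
  | refl {n m : ℕ} (x : PTerm R G n m) : Rel E x x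
  | symm {n m : ℕ} {x y : PTerm R G n m} : Rel E x y → Rel E y x
  | trans {n m : ℕ} {x y z : PTerm R G n m} : Rel E x y → Rel E y z → Rel E x z
  | comp_congr {n m p : ℕ} {x x' : PTerm R G n m} {y y' : PTerm R G m p} :
      Rel E x x' → Rel E y y' → Rel E (.comp x y) (.comp x' y')
  | tens_congr {n m n' m' : ℕ} {x x' : PTerm R G n m} {y y' : PTerm R G n' m'} :
      Rel E x x' → Rel E y y' → Rel E (.tens x y) (.tens x' y')
  | add_congr {n m : ℕ} {x x' y y' : PTerm R G n m} :
      Rel E x x' → Rel E y y' → Rel E (.add x y) (.add x' y')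
  | smul_congr {n m : ℕ} (r : R) {x x' : PTerm R G n m} :
      Rel E x x' → Rel E (.smul r x) (.smul r x')
  | add_assoc {n m : ℕ} (x y z : PTerm R G n m) :
      Rel E (.add (.add x y) z) (.add x (.add y z))
  | add_comm {n m : ℕ} (x y : PTerm R G n m) : Rel E (.add x y) (.add y x)
  | zero_add {n m : ℕ} (x : PTerm R G n m) : Rel E (.add .zero x) x
  | neg_add {n m : ℕ} (x : PTerm R G n m) : Rel E (.add (.smul (-1) x) x) .zero
  | smul_add {n m : ℕ} (r : R) (x y : PTerm R G n m) :
      Rel E (.smul r (.add x y)) (.add (.smul r x) (.smul r y))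
  | add_smul {n m : ℕ} (r s : R) (x : PTerm R G n m) :
      Rel E (.smul (r + s) x) (.add (.smul r x) (.smul s x))
  | mul_smul {n m : ℕ} (r s : R) (x : PTerm R G n m) :
      Rel E (.smul (r * s) x) (.smul r (.smul s x))
  | one_smul {n m : ℕ} (x : PTerm R G n m) : Rel E (.smul 1 x) x
  | add_comp {n m p : ℕ} (x x' : PTerm R G n m) (y : PTerm R G m p) :
      Rel E (.comp (.add x x') y) (.add (.comp x y) (.comp x' y))
  | comp_add {n m p : ℕ} (x : PTerm R G n m) (y y' : PTerm R G m p) :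
      Rel E (.comp x (.add y y')) (.add (.comp x y) (.comp x y'))
  | smul_comp {n m p : ℕ} (r : R) (x : PTerm R G n m) (y : PTerm R G m p) :
      Rel E (.comp (.smul r x) y) (.smul r (.comp x y))
  | comp_smul {n m p : ℕ} (r : R) (x : PTerm R G n m) (y : PTerm R G m p) :
      Rel E (.comp x (.smul r y)) (.smul r (.comp x y))
  | add_tens {n m n' m' : ℕ} (x x' : PTerm R G n m) (y : PTerm R G n' m') :
      Rel E (.tens (.add x x') y) (.add (.tens x y) (.tens x' y))
  | tens_add {n m n' m' : ℕ} (x : PTerm R G n m) (y y' : PTerm R G n' m') :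
      Rel E (.tens x (.add y y')) (.add (.tens x y) (.tens x y'))
  | smul_tens {n m n' m' : ℕ} (r : R) (x : PTerm R G n m) (y : PTerm R G n' m') :
      Rel E (.tens (.smul r x) y) (.smul r (.tens x y))
  | tens_smul {n m n' m' : ℕ} (r : R) (x : PTerm R G n m) (y : PTerm R G n' m') :
      Rel E (.tens x (.smul r y)) (.smul r (.tens x y))
  | comp_assoc {n m p q : ℕ} (x : PTerm R G n m) (y : PTerm R G m p) (z : PTerm R G p q) :
      Rel E (.comp (.comp x y) z) (.comp x (.comp y z))
  | id_comp {n m : ℕ} (x : PTerm R G n m) : Rel E (.comp (.perm (Equiv.refl (Fin n))) x) x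
  | comp_id {n m : ℕ} (x : PTerm R G n m) : Rel E (.comp x (.perm (Equiv.refl (Fin m)))) x
  | perm_trans {n m p : ℕ} (e : Fin n ≃ Fin m) (f : Fin m ≃ Fin p) :
      Rel E (.perm (e.trans f)) (.comp (.perm e) (.perm f))
  | tens_comp {n m p n' m' p' : ℕ} (x : PTerm R G n m) (y : PTerm R G m p)
      (x' : PTerm R G n' m') (y' : PTerm R G m' p') :
      Rel E (.tens (.comp x y) (.comp x' y')) (.comp (.tens x x') (.tens y y'))
  | tens_assoc {n m n' m' n'' m'' : ℕ} (x : PTerm R G n m) (y : PTerm R G n' m')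
      (z : PTerm R G n'' m'') :
      Rel E (.comp (.tens (.tens x y) z) (.perm (finCongr (Nat.add_assoc m m' m''))))
        (.comp (.perm (finCongr (Nat.add_assoc n n' n''))) (.tens x (.tens y z)))
  | id_tens {n m : ℕ} (x : PTerm R G n m) :
      Rel E (.comp (.tens (.perm (Equiv.refl (Fin 0))) x) (.perm (finCongr (Nat.zero_add m))))
        (.comp (.perm (finCongr (Nat.zero_add n))) x)
  | perm_tens {n m n' m' : ℕ} (e : Fin n ≃ Fin m) (f : Fin n' ≃ Fin m') :
      Rel E (.perm (blockPerm e f)) (.tens (.perm e) (.perm f))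
  | tens_symm {n m n' m' : ℕ} (x : PTerm R G n m) (y : PTerm R G n' m') :
      Rel E (.comp (.tens x y) (.perm finAddFlip)) (.comp (.perm finAddFlip) (.tens y x))

section Presented

variable {R : Type u} [CommRing R] {G : ℕ → ℕ → Type}
  (E : ∀ {n m : ℕ}, PTerm R G n m → PTerm R G n m → Prop)

/-- The congruence `PTerm.Rel E` as a setoid. -/
def PTerm.setoid (n m : ℕ) : Setoid (PTerm R G n m) where
  r := PTerm.Rel E
  iseqv := ⟨PTerm.Rel.refl, PTerm.Rel.symm, PTerm.Rel.trans⟩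

/-- The operations of bidegree `(n, m)` of the prop with generators `G` and relations `E`. -/
def PresHom (n m : ℕ) : Type u := Quotient (PTerm.setoid E n m)

/-- The class of a formal expression. -/
def PresHom.mk {n m : ℕ} (x : PTerm R G n m) : PresHom E n m := Quotient.mk (PTerm.setoid E n m) x

theorem PresHom.sound {n m : ℕ} {x y : PTerm R G n m} (h : PTerm.Rel E x y) :
    PresHom.mk E x = PresHom.mk E y := Quotient.sound (s := PTerm.setoid E n m) h

theorem PresHom.mk_surjective {n m : ℕ} (x : PresHom E n m) : ∃ t, PresHom.mk E t = x :=
  Quotient.exists_rep x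

instance PresHom.instAdd (n m : ℕ) : Add (PresHom E n m) :=
  ⟨Quotient.map₂ PTerm.add fun _ _ h _ _ h' => PTerm.Rel.add_congr h h'⟩

instance PresHom.instZero (n m : ℕ) : Zero (PresHom E n m) := ⟨PresHom.mk E PTerm.zero⟩

instance PresHom.instSMul (n m : ℕ) : SMul R (PresHom E n m) :=
  ⟨fun r => Quotient.map (PTerm.smul r) fun _ _ h => PTerm.Rel.smul_congr r h⟩

instance PresHom.instNeg (n m : ℕ) : Neg (PresHom E n m) := ⟨fun x => (-1 : R) • x⟩

instance PresHom.instAddCommGroup (n m : ℕ) : AddCommGroup (PresHom E n m) where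
  add_assoc x y z := by
    obtain ⟨x, rfl⟩ := PresHom.mk_surjective E x
    obtain ⟨y, rfl⟩ := PresHom.mk_surjective E y
    obtain ⟨z, rfl⟩ := PresHom.mk_surjective E z
    exact PresHom.sound E (.add_assoc x y z)
  zero_add x := by
    obtain ⟨x, rfl⟩ := PresHom.mk_surjective E x
    exact PresHom.sound E (.zero_add x)
  add_zero x := by
    obtain ⟨x, rfl⟩ := PresHom.mk_surjective E x
    exact PresHom.sound E (.trans (.add_comm _ _) (.zero_add x))
  add_comm x y := by
    obtain ⟨x, rfl⟩ := PresHom.mk_surjective E x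
    obtain ⟨y, rfl⟩ := PresHom.mk_surjective E y
    exact PresHom.sound E (.add_comm x y)
  neg_add_cancel x := by
    obtain ⟨x, rfl⟩ := PresHom.mk_surjective E x
    exact PresHom.sound E (.neg_add x)
  nsmul := nsmulRec
  zsmul := zsmulRec

theorem PresHom.add_smul' {n m : ℕ} (r s : R) (x : PresHom E n m) :
    (r + s) • x = r • x + s • x := by
  obtain ⟨x, rfl⟩ := PresHom.mk_surjective E x
  exact PresHom.sound E (.add_smul r s x)

theorem PresHom.smul_add' {n m : ℕ} (r : R) (x y : PresHom E n m) :
    r • (x + y) = r • x + r • y := by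
  obtain ⟨x, rfl⟩ := PresHom.mk_surjective E x
  obtain ⟨y, rfl⟩ := PresHom.mk_surjective E y
  exact PresHom.sound E (.smul_add r x y)

instance PresHom.instModule (n m : ℕ) : Module R (PresHom E n m) where
  one_smul x := by
    obtain ⟨x, rfl⟩ := PresHom.mk_surjective E x
    exact PresHom.sound E (.one_smul x)
  mul_smul r s x := by
    obtain ⟨x, rfl⟩ := PresHom.mk_surjective E x
    exact PresHom.sound E (.mul_smul r s x)
  smul_add := PresHom.smul_add' E
  smul_zero r := by
    have h := PresHom.smul_add' E r (0 : PresHom E n m) 0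
    rw [add_zero] at h
    exact left_eq_add.mp h
  add_smul := PresHom.add_smul' E
  zero_smul x := by
    have h := PresHom.add_smul' E (0 : R) 0 x
    rw [add_zero] at h
    exact left_eq_add.mp h

/-- Composition in the presented prop. -/
def PresHom.comp {n m p : ℕ} : PresHom E n m →ₗ[R] PresHom E m p →ₗ[R] PresHom E n p :=
  LinearMap.mk₂ R (Quotient.map₂ PTerm.comp fun _ _ h _ _ h' => PTerm.Rel.comp_congr h h')
    (fun x x' y => by
      obtain ⟨x, rfl⟩ := PresHom.mk_surjective E x
      obtain ⟨x', rfl⟩ := PresHom.mk_surjective E x'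
      obtain ⟨y, rfl⟩ := PresHom.mk_surjective E y
      exact PresHom.sound E (.add_comp x x' y))
    (fun r x y => by
      obtain ⟨x, rfl⟩ := PresHom.mk_surjective E x
      obtain ⟨y, rfl⟩ := PresHom.mk_surjective E y
      exact PresHom.sound E (.smul_comp r x y))
    (fun x y y' => by
      obtain ⟨x, rfl⟩ := PresHom.mk_surjective E x
      obtain ⟨y, rfl⟩ := PresHom.mk_surjective E y
      obtain ⟨y', rfl⟩ := PresHom.mk_surjective E y'
      exact PresHom.sound E (.comp_add x y y'))
    (fun r x y => by
      obtain ⟨x, rfl⟩ := PresHom.mk_surjective E x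
      obtain ⟨y, rfl⟩ := PresHom.mk_surjective E y
      exact PresHom.sound E (.comp_smul r x y))

/-- The tensor product in the presented prop. -/
def PresHom.tens {n m n' m' : ℕ} :
    PresHom E n m →ₗ[R] PresHom E n' m' →ₗ[R] PresHom E (n + n') (m + m') :=
  LinearMap.mk₂ R (Quotient.map₂ PTerm.tens fun _ _ h _ _ h' => PTerm.Rel.tens_congr h h')
    (fun x x' y => by
      obtain ⟨x, rfl⟩ := PresHom.mk_surjective E x
      obtain ⟨x', rfl⟩ := PresHom.mk_surjective E x'
      obtain ⟨y, rfl⟩ := PresHom.mk_surjective E y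
      exact PresHom.sound E (.add_tens x x' y))
    (fun r x y => by
      obtain ⟨x, rfl⟩ := PresHom.mk_surjective E x
      obtain ⟨y, rfl⟩ := PresHom.mk_surjective E y
      exact PresHom.sound E (.smul_tens r x y))
    (fun x y y' => by
      obtain ⟨x, rfl⟩ := PresHom.mk_surjective E x
      obtain ⟨y, rfl⟩ := PresHom.mk_surjective E y
      obtain ⟨y', rfl⟩ := PresHom.mk_surjective E y'
      exact PresHom.sound E (.tens_add x y y'))
    (fun r x y => by
      obtain ⟨x, rfl⟩ := PresHom.mk_surjective E x
      obtain ⟨y, rfl⟩ := PresHom.mk_surjective E y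
      exact PresHom.sound E (.tens_smul r x y))

/-- The prop with generators `G` and relations `E`. -/
def presentedProp : LinProp.{u, u} R where
  Hom := PresHom E
  comp := PresHom.comp E
  tens := PresHom.tens E
  perm e := PresHom.mk E (PTerm.perm e)
  comp_assoc x y z := by
    obtain ⟨x, rfl⟩ := PresHom.mk_surjective E x
    obtain ⟨y, rfl⟩ := PresHom.mk_surjective E y
    obtain ⟨z, rfl⟩ := PresHom.mk_surjective E z
    exact PresHom.sound E (.comp_assoc x y z)
  id_comp x := by
    obtain ⟨x, rfl⟩ := PresHom.mk_surjective E x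
    exact PresHom.sound E (.id_comp x)
  comp_id x := by
    obtain ⟨x, rfl⟩ := PresHom.mk_surjective E x
    exact PresHom.sound E (.comp_id x)
  perm_trans e f := PresHom.sound E (.perm_trans e f)
  tens_comp x y x' y' := by
    obtain ⟨x, rfl⟩ := PresHom.mk_surjective E x
    obtain ⟨y, rfl⟩ := PresHom.mk_surjective E y
    obtain ⟨x', rfl⟩ := PresHom.mk_surjective E x'
    obtain ⟨y', rfl⟩ := PresHom.mk_surjective E y'
    exact PresHom.sound E (.tens_comp x y x' y')
  tens_assoc x y z := by
    obtain ⟨x, rfl⟩ := PresHom.mk_surjective E x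
    obtain ⟨y, rfl⟩ := PresHom.mk_surjective E y
    obtain ⟨z, rfl⟩ := PresHom.mk_surjective E z
    exact PresHom.sound E (.tens_assoc x y z)
  id_tens x := by
    obtain ⟨x, rfl⟩ := PresHom.mk_surjective E x
    exact PresHom.sound E (.id_tens x)
  perm_tens e f := PresHom.sound E (.perm_tens e f)
  tens_symm x y := by
    obtain ⟨x, rfl⟩ := PresHom.mk_surjective E x
    obtain ⟨y, rfl⟩ := PresHom.mk_surjective E y
    exact PresHom.sound E (.tens_symm x y)

end Presented

/-- The value of a formal expression in a prop in which the generators are given values. -/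
def PTerm.eval {R : Type u} [CommRing R] {G : ℕ → ℕ → Type} (Q : LinProp.{u, u} R)
    (g : ∀ {n m : ℕ}, G n m → Q.Hom n m) : ∀ {n m : ℕ}, PTerm R G n m → Q.Hom n m
  | _, _, .gen a => g a
  | _, _, .perm e => Q.perm e
  | _, _, .comp x y => Q.comp (PTerm.eval Q g x) (PTerm.eval Q g y)
  | _, _, .tens x y => Q.tens (PTerm.eval Q g x) (PTerm.eval Q g y)
  | _, _, .zero => 0
  | _, _, .add x y => PTerm.eval Q g x + PTerm.eval Q g y
  | _, _, .smul r x => r • PTerm.eval Q g x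

theorem PTerm.eval_eq {R : Type u} [CommRing R] {G : ℕ → ℕ → Type}
    {E : ∀ {n m : ℕ}, PTerm R G n m → PTerm R G n m → Prop} (Q : LinProp.{u, u} R)
    (g : ∀ {n m : ℕ}, G n m → Q.Hom n m)
    (hg : ∀ {n m : ℕ} {x y : PTerm R G n m}, E x y → PTerm.eval Q g x = PTerm.eval Q g y)
    {n m : ℕ} {x y : PTerm R G n m} (h : PTerm.Rel E x y) :
    PTerm.eval Q g x = PTerm.eval Q g y := by
  induction h with
  | of h => exact hg h
  | refl => rfl
  | symm _ h => exact h.symm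
  | trans _ _ h h' => exact h.trans h'
  | comp_congr _ _ h h' => simp only [PTerm.eval, h, h']
  | tens_congr _ _ h h' => simp only [PTerm.eval, h, h']
  | add_congr _ _ h h' => simp only [PTerm.eval, h, h']
  | smul_congr r _ h => simp only [PTerm.eval, h]
  | add_assoc => exact _root_.add_assoc _ _ _
  | add_comm => exact _root_.add_comm _ _
  | zero_add => exact _root_.zero_add _
  | neg_add => simp [PTerm.eval]
  | smul_add => exact _root_.smul_add _ _ _
  | add_smul => exact _root_.add_smul _ _ _
  | mul_smul => exact SemigroupAction.mul_smul _ _ _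
  | one_smul => exact _root_.one_smul _ _
  | add_comp => simp [PTerm.eval]
  | comp_add => simp [PTerm.eval]
  | smul_comp => simp [PTerm.eval]
  | comp_smul => simp [PTerm.eval]
  | add_tens => simp [PTerm.eval]
  | tens_add => simp [PTerm.eval]
  | smul_tens => simp [PTerm.eval]
  | tens_smul => simp [PTerm.eval]
  | comp_assoc => exact Q.comp_assoc _ _ _
  | id_comp => exact Q.id_comp _
  | comp_id => exact Q.comp_id _
  | perm_trans => exact Q.perm_trans _ _
  | tens_comp => exact Q.tens_comp _ _ _ _
  | tens_assoc => exact Q.tens_assoc _ _ _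
  | id_tens => exact Q.id_tens _
  | perm_tens => exact Q.perm_tens _ _
  | tens_symm => exact Q.tens_symm _ _

/-- The prop morphism out of a presented prop given by values of the generators that satisfy the
relations. -/
def presentedLift {R : Type u} [CommRing R] {G : ℕ → ℕ → Type}
    (E : ∀ {n m : ℕ}, PTerm R G n m → PTerm R G n m → Prop) (Q : LinProp.{u, u} R)
    (g : ∀ {n m : ℕ}, G n m → Q.Hom n m)
    (hg : ∀ {n m : ℕ} {x y : PTerm R G n m}, E x y → PTerm.eval Q g x = PTerm.eval Q g y) :
    PropHom (RingHom.id R) (presentedProp E) Q where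
  app n m :=
    { toFun := Quotient.lift (PTerm.eval Q g) fun _ _ h => PTerm.eval_eq Q g hg h
      map_add' := by
        intro x y
        obtain ⟨x, rfl⟩ := PresHom.mk_surjective E x
        obtain ⟨y, rfl⟩ := PresHom.mk_surjective E y
        rfl
      map_smul' := by
        intro r x
        obtain ⟨x, rfl⟩ := PresHom.mk_surjective E x
        rfl }
  map_comp x y := by
    obtain ⟨x, rfl⟩ := PresHom.mk_surjective E x
    obtain ⟨y, rfl⟩ := PresHom.mk_surjective E y
    rfl
  map_tens x y := by
    obtain ⟨x, rfl⟩ := PresHom.mk_surjective E x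
    obtain ⟨y, rfl⟩ := PresHom.mk_surjective E y
    rfl
  map_perm e := rfl

/-! ### Endomorphism props and the action on algebras -/

section EndProp

variable (R : Type u) [CommRing R] (A : Type u) [AddCommGroup A] [Module R A]

/-- The tensor power `A^{⊗ n}`. -/
abbrev TPow (n : ℕ) : Type u := ⨂[R] _ : Fin n, A

/-- The canonical isomorphism `A^{⊗ n} ⊗ A^{⊗ m} ≃ A^{⊗ (n + m)}`. -/
def TPow.join (n m : ℕ) : (TPow R A n ⊗[R] TPow R A m) ≃ₗ[R] TPow R A (n + m) :=
  (PiTensorProduct.tmulEquiv R A).trans (PiTensorProduct.reindex R (fun _ => A) finSumFinEquiv)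

/-- The action of a bijection on tensor powers: the `i`-th factor is moved to position `e i`. -/
def TPow.perm {n m : ℕ} (e : Fin n ≃ Fin m) : TPow R A n ≃ₗ[R] TPow R A m :=
  PiTensorProduct.reindex R (fun _ => A) e

theorem TPow.join_tprod {n m : ℕ} (a : Fin n → A) (b : Fin m → A) :
    TPow.join R A n m (PiTensorProduct.tprod R a ⊗ₜ PiTensorProduct.tprod R b) =
      PiTensorProduct.tprod R (Fin.append a b) := by
  unfold TPow.join
  rw [LinearEquiv.trans_apply, PiTensorProduct.tmulEquiv_apply]
  erw [PiTensorProduct.reindex_tprod]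
  congr 1
  funext i
  refine Fin.addCases (fun i => ?_) (fun i => ?_) i <;> simp

theorem TPow.perm_tprod {n m : ℕ} (e : Fin n ≃ Fin m) (a : Fin n → A) :
    TPow.perm R A e (PiTensorProduct.tprod R a) = PiTensorProduct.tprod R (a ∘ e.symm) :=
  PiTensorProduct.reindex_tprod e a

/-- The tensor product of two maps between tensor powers. -/
def TPow.tens {n m n' m' : ℕ} (f : TPow R A n →ₗ[R] TPow R A m)
    (g : TPow R A n' →ₗ[R] TPow R A m') : TPow R A (n + n') →ₗ[R] TPow R A (m + m') :=
  (TPow.join R A m m').toLinearMap ∘ₗ TensorProduct.map f g ∘ₗ (TPow.join R A n n').symm.toLinearMap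

theorem TPow.tens_join {n m n' m' : ℕ} (f : TPow R A n →ₗ[R] TPow R A m)
    (g : TPow R A n' →ₗ[R] TPow R A m') (u : TPow R A n) (v : TPow R A n') :
    TPow.tens R A f g (TPow.join R A n n' (u ⊗ₜ v)) = TPow.join R A m m' (f u ⊗ₜ g v) := by
  simp [TPow.tens]

variable {R A} in
theorem TPow.ext_join {n m : ℕ} {Z : Type u} [AddCommGroup Z] [Module R Z]
    {f g : TPow R A (n + m) →ₗ[R] Z}
    (h : ∀ u v, f (TPow.join R A n m (u ⊗ₜ v)) = g (TPow.join R A n m (u ⊗ₜ v))) : f = g := by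
  have h' : f ∘ₗ (TPow.join R A n m).toLinearMap = g ∘ₗ (TPow.join R A n m).toLinearMap :=
    TensorProduct.ext' h
  ext1
  ext a
  have h2 := LinearMap.congr_fun h' ((TPow.join R A n m).symm (PiTensorProduct.tprod R a))
  simpa using h2

variable {R A} in
theorem TPow.ext_tprod {n : ℕ} {Z : Type u} [AddCommGroup Z] [Module R Z]
    {f g : TPow R A n →ₗ[R] Z}
    (h : ∀ a, f (PiTensorProduct.tprod R a) = g (PiTensorProduct.tprod R a)) : f = g :=
  PiTensorProduct.ext (MultilinearMap.ext h)

variable {R A} in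
theorem TPow.ext_tprod₂ {n m : ℕ} {Z : Type u} [AddCommGroup Z] [Module R Z]
    {f g : TPow R A n ⊗[R] TPow R A m →ₗ[R] Z}
    (h : ∀ a b, f (PiTensorProduct.tprod R a ⊗ₜ PiTensorProduct.tprod R b) =
      g (PiTensorProduct.tprod R a ⊗ₜ PiTensorProduct.tprod R b)) : f = g := by
  apply TensorProduct.ext'
  intro u v
  have h1 : ∀ a, f ∘ₗ TensorProduct.mk R _ _ (PiTensorProduct.tprod R a) =
      g ∘ₗ TensorProduct.mk R _ _ (PiTensorProduct.tprod R a) := fun a => TPow.ext_tprod (h a)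
  have h2 : f ∘ₗ (TensorProduct.mk R (TPow R A n) (TPow R A m)).flip v =
      g ∘ₗ (TensorProduct.mk R (TPow R A n) (TPow R A m)).flip v :=
    TPow.ext_tprod fun a => LinearMap.congr_fun (h1 a) v
  exact LinearMap.congr_fun h2 u

variable {R A} in
theorem TPow.ext_tprod₃ {n m p : ℕ} {Z : Type u} [AddCommGroup Z] [Module R Z]
    {f g : (TPow R A n ⊗[R] TPow R A m) ⊗[R] TPow R A p →ₗ[R] Z}
    (h : ∀ a b c,
      f ((PiTensorProduct.tprod R a ⊗ₜ PiTensorProduct.tprod R b) ⊗ₜ PiTensorProduct.tprod R c) =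
      g ((PiTensorProduct.tprod R a ⊗ₜ PiTensorProduct.tprod R b) ⊗ₜ
        PiTensorProduct.tprod R c)) : f = g := by
  apply TensorProduct.ext'
  intro u w
  have h1 : ∀ a b,
      f ∘ₗ TensorProduct.mk R _ _ (PiTensorProduct.tprod R a ⊗ₜ PiTensorProduct.tprod R b) =
      g ∘ₗ TensorProduct.mk R _ _ (PiTensorProduct.tprod R a ⊗ₜ PiTensorProduct.tprod R b) :=
    fun a b => TPow.ext_tprod (h a b)
  have h2 : f ∘ₗ (TensorProduct.mk R (TPow R A n ⊗[R] TPow R A m) (TPow R A p)).flip w =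
      g ∘ₗ (TensorProduct.mk R (TPow R A n ⊗[R] TPow R A m) (TPow R A p)).flip w :=
    TPow.ext_tprod₂ fun a b => LinearMap.congr_fun (h1 a b) w
  exact LinearMap.congr_fun h2 u

theorem TPow.perm_join {n m n' m' : ℕ} (e : Fin n ≃ Fin m) (f : Fin n' ≃ Fin m')
    (u : TPow R A n) (v : TPow R A n') :
    TPow.perm R A (blockPerm e f) (TPow.join R A n n' (u ⊗ₜ v)) =
      TPow.join R A m m' (TPow.perm R A e u ⊗ₜ TPow.perm R A f v) := by
  have h : (TPow.perm R A (blockPerm e f)).toLinearMap ∘ₗ (TPow.join R A n n').toLinearMap =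
      (TPow.join R A m m').toLinearMap ∘ₗ
        TensorProduct.map (TPow.perm R A e).toLinearMap (TPow.perm R A f).toLinearMap := by
    apply TPow.ext_tprod₂
    intro a b
    simp only [LinearMap.comp_apply,
      LinearEquiv.coe_coe, TensorProduct.map_tmul, TPow.join_tprod, TPow.perm_tprod]
    congr 1
    funext i
    refine Fin.addCases (fun i => ?_) (fun i => ?_) i <;> simp [blockPerm]
  exact LinearMap.congr_fun h (u ⊗ₜ v)

theorem TPow.flip_join {n m : ℕ} (u : TPow R A n) (v : TPow R A m) :
    TPow.perm R A finAddFlip (TPow.join R A n m (u ⊗ₜ v)) = TPow.join R A m n (v ⊗ₜ u) := by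
  have h : (TPow.perm R A finAddFlip).toLinearMap ∘ₗ (TPow.join R A n m).toLinearMap =
      (TPow.join R A m n).toLinearMap ∘ₗ (TensorProduct.comm R _ _).toLinearMap := by
    apply TPow.ext_tprod₂
    intro a b
    simp only [LinearMap.comp_apply,
      LinearEquiv.coe_coe, TensorProduct.comm_tmul, TPow.join_tprod, TPow.perm_tprod]
    congr 1
    funext i
    refine Fin.addCases (fun i => ?_) (fun i => ?_) i <;> simp [finAddFlip]
  exact LinearMap.congr_fun h (u ⊗ₜ v)

theorem TPow.assoc_join {n m p : ℕ} (u : TPow R A n) (v : TPow R A m) (w : TPow R A p) :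
    TPow.perm R A (finCongr (Nat.add_assoc n m p))
        (TPow.join R A (n + m) p (TPow.join R A n m (u ⊗ₜ v) ⊗ₜ w)) =
      TPow.join R A n (m + p) (u ⊗ₜ TPow.join R A m p (v ⊗ₜ w)) := by
  have h : (TPow.perm R A (finCongr (Nat.add_assoc n m p))).toLinearMap ∘ₗ
        (TPow.join R A (n + m) p).toLinearMap ∘ₗ
          TensorProduct.map (TPow.join R A n m).toLinearMap LinearMap.id =
      (TPow.join R A n (m + p)).toLinearMap ∘ₗ
        TensorProduct.map LinearMap.id (TPow.join R A m p).toLinearMap ∘ₗ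
          (TensorProduct.assoc R _ _ _).toLinearMap := by
    apply TPow.ext_tprod₃
    intro a b c
    simp only [LinearMap.comp_apply,
      LinearEquiv.coe_coe, TensorProduct.map_tmul, TensorProduct.assoc_tmul, LinearMap.id_apply,
      TPow.join_tprod, TPow.perm_tprod]
    congr 1
    rw [Fin.append_assoc]
    funext i
    simp
  exact LinearMap.congr_fun h ((u ⊗ₜ v) ⊗ₜ w)

theorem TPow.zero_join {n : ℕ} (u : TPow R A 0) (v : TPow R A n) :
    TPow.perm R A (finCongr (Nat.zero_add n)) (TPow.join R A 0 n (u ⊗ₜ v)) =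
      PiTensorProduct.isEmptyEquiv (Fin 0) u • v := by
  have h : (TPow.perm R A (finCongr (Nat.zero_add n))).toLinearMap ∘ₗ
        (TPow.join R A 0 n).toLinearMap =
      (TensorProduct.lid R _).toLinearMap ∘ₗ
        TensorProduct.map (PiTensorProduct.isEmptyEquiv (Fin 0)).toLinearMap LinearMap.id := by
    apply TPow.ext_tprod₂
    intro a b
    simp only [LinearMap.comp_apply,
      LinearEquiv.coe_coe, TensorProduct.map_tmul, LinearMap.id_apply, TensorProduct.lid_tmul,
      TPow.join_tprod, TPow.perm_tprod, PiTensorProduct.isEmptyEquiv_apply_tprod, one_smul]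
    congr 1
    funext i
    have hi : (finCongr (Nat.zero_add n)).symm i = Fin.natAdd 0 i := by
      ext
      simp
    rw [Function.comp_apply, hi, Fin.append_right]
  exact LinearMap.congr_fun h (u ⊗ₜ v)

/-- The endomorphism prop of a module `A`, with operations `Hom (A^{⊗ n}, A^{⊗ m})`. -/
def endProp : LinProp.{u, u} R where
  Hom n m := TPow R A n →ₗ[R] TPow R A m
  comp := LinearMap.mk₂ R (fun f g => g ∘ₗ f)
    (fun _ _ _ => LinearMap.comp_add _ _ _) (fun _ _ _ => LinearMap.comp_smul _ _ _)
    (fun _ _ _ => LinearMap.add_comp _ _ _) (fun _ _ _ => LinearMap.smul_comp _ _ _)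
  tens := LinearMap.mk₂ R (TPow.tens R A)
    (fun f f' g => TPow.ext_join fun u v => by
      simp only [LinearMap.add_apply, TPow.tens_join, TensorProduct.add_tmul, map_add])
    (fun r f g => TPow.ext_join fun u v => by
      simp only [LinearMap.smul_apply, TPow.tens_join, ← TensorProduct.smul_tmul', map_smul])
    (fun f g g' => TPow.ext_join fun u v => by
      simp only [LinearMap.add_apply, TPow.tens_join, TensorProduct.tmul_add, map_add])
    (fun r f g => TPow.ext_join fun u v => by
      simp only [LinearMap.smul_apply, TPow.tens_join, TensorProduct.tmul_smul, map_smul])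
  perm e := (TPow.perm R A e).toLinearMap
  comp_assoc _ _ _ := rfl
  id_comp f := by
    apply TPow.ext_tprod
    intro a
    simp [TPow.perm_tprod]
  comp_id f := by
    apply LinearMap.ext
    intro a
    simp [TPow.perm]
  perm_trans e f := by
    apply TPow.ext_tprod
    intro a
    simp [TPow.perm_tprod, Function.comp_assoc]
  tens_comp f g f' g' := by
    apply TPow.ext_join
    intro u v
    simp [TPow.tens_join]
  tens_assoc f g h := by
    apply TPow.ext_join
    intro uv w
    obtain ⟨uv, rfl⟩ := (TPow.join R A _ _).surjective uv
    induction uv with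
    | zero => simp
    | add x y hx hy => simp only [map_add, TensorProduct.add_tmul, hx, hy]
    | tmul u v => simp [TPow.tens_join, TPow.assoc_join]
  id_tens f := by
    apply TPow.ext_join
    intro u v
    have h0 : TPow.perm R A (Equiv.refl (Fin 0)) u = u := by simp [TPow.perm]
    simp only [LinearMap.mk₂_apply, LinearMap.comp_apply, LinearEquiv.coe_coe, TPow.tens_join,
      TPow.zero_join, h0, map_smul]
  perm_tens e f := by
    apply TPow.ext_join
    intro u v
    simp [TPow.tens_join, TPow.perm_join]
  tens_symm f g := by
    apply TPow.ext_join
    intro u v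
    simp [TPow.tens_join, TPow.flip_join]

end EndProp

/-! ### The props of associative and Poisson algebras -/

/-- The generators `η` and `m` of the prop of algebras. -/
inductive AlgGen : ℕ → ℕ → Type
  | unit : AlgGen 0 1
  | mul : AlgGen 2 1

/-- The generators `η`, `m` and a bracket. -/
inductive BracketGen : ℕ → ℕ → Type
  | unit : BracketGen 0 1
  | mul : BracketGen 2 1
  | bracket : BracketGen 2 1

namespace PTerm

/-- The identity of the generating object. -/
def one {R : Type u} {G : ℕ → ℕ → Type} : PTerm R G 1 1 := perm (Equiv.refl (Fin 1))

/-- An operation with two inputs, with the inputs exchanged: `x ∘ (21)`. -/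
def op {R : Type u} {G : ℕ → ℕ → Type} (x : PTerm R G 2 1) : PTerm R G 2 1 :=
  comp (perm (Equiv.swap (0 : Fin 2) 1)) x

/-- The operation `(a, b, c) ↦ y (x (a, b), c)`. -/
def nestLeft {R : Type u} {G : ℕ → ℕ → Type} (x y : PTerm R G 2 1) : PTerm R G 3 1 :=
  comp (tens x one : PTerm R G (2 + 1) (1 + 1)) y

/-- The operation `(a, b, c) ↦ y (a, x (b, c))`. -/
def nestRight {R : Type u} {G : ℕ → ℕ → Type} (x y : PTerm R G 2 1) : PTerm R G 3 1 :=
  comp (tens one x : PTerm R G (1 + 2) (1 + 1)) y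

/-- The operation `a ↦ y (e, a)`. -/
def unitLeft {R : Type u} {G : ℕ → ℕ → Type} (e : PTerm R G 0 1) (y : PTerm R G 2 1) :
    PTerm R G 1 1 :=
  comp (tens e one : PTerm R G (0 + 1) (1 + 1)) y

/-- The operation `a ↦ y (a, e)`. -/
def unitRight {R : Type u} {G : ℕ → ℕ → Type} (e : PTerm R G 0 1) (y : PTerm R G 2 1) :
    PTerm R G 1 1 :=
  comp (tens one e : PTerm R G (1 + 0) (1 + 1)) y

end PTerm

/-- The relations of associative algebras with unit. -/
inductive AlgRel (R : Type u) : ∀ {n m : ℕ}, PTerm R AlgGen n m → PTerm R AlgGen n m → Prop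
  | assoc : AlgRel R (PTerm.nestLeft (.gen .mul) (.gen .mul))
      (PTerm.nestRight (.gen .mul) (.gen .mul))
  | one_mul : AlgRel R (PTerm.unitLeft (.gen .unit) (.gen .mul)) PTerm.one
  | mul_one : AlgRel R (PTerm.unitRight (.gen .unit) (.gen .mul)) PTerm.one

/-- The prop of associative algebras with unit. -/
def algProp (R : Type u) [CommRing R] : LinProp.{u, u} R := presentedProp (AlgRel R)

/-- The relations of Poisson algebras: the product is associative, commutative and has a unit,
the bracket is a Lie bracket, and it satisfies the Leibniz rule `{a b, c} = a {b, c} + {a, c} b`. -/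
inductive PoissonRel (R : Type u) [CommRing R] :
    ∀ {n m : ℕ}, PTerm R BracketGen n m → PTerm R BracketGen n m → Prop
  | assoc : PoissonRel R (PTerm.nestLeft (.gen .mul) (.gen .mul))
      (PTerm.nestRight (.gen .mul) (.gen .mul))
  | one_mul : PoissonRel R (PTerm.unitLeft (.gen .unit) (.gen .mul)) PTerm.one
  | mul_one : PoissonRel R (PTerm.unitRight (.gen .unit) (.gen .mul)) PTerm.one
  | mul_comm : PoissonRel R (.gen .mul) (PTerm.op (.gen .mul))
  | skew : PoissonRel R (.add (.gen .bracket) (PTerm.op (.gen .bracket))) .zero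
  | jacobi : PoissonRel R
      (.add (PTerm.nestLeft (.gen .bracket) (.gen .bracket))
        (.add
          (.comp (.perm (finRotate 3)) (PTerm.nestLeft (.gen .bracket) (.gen .bracket)))
          (.comp (.perm ((finRotate 3).trans (finRotate 3)))
            (PTerm.nestLeft (.gen .bracket) (.gen .bracket)))))
      .zero
  | leibniz : PoissonRel R (PTerm.nestLeft (.gen .mul) (.gen .bracket))
      (.add (PTerm.nestRight (.gen .bracket) (.gen .mul))
        (.comp (.perm (Equiv.swap (1 : Fin 3) 2)) (PTerm.nestLeft (.gen .bracket) (.gen .mul))))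

/-- The prop of Poisson algebras. -/
def poissonProp (R : Type u) [CommRing R] : LinProp.{u, u} R := presentedProp (PoissonRel R)

/-! ### The prop of quasi-commutative algebras -/

/-- The relations of `Alg[[ħ]]⟨P⟩ / (m - m ∘ (21) = ħ P)`, where `ħ` is the variable of the ring
of formal power series. -/
inductive QCommRel (K : Type u) [CommRing K] :
    ∀ {n m : ℕ}, PTerm K⟦X⟧ BracketGen n m → PTerm K⟦X⟧ BracketGen n m → Prop
  | assoc : QCommRel K (PTerm.nestLeft (.gen .mul) (.gen .mul))
      (PTerm.nestRight (.gen .mul) (.gen .mul))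
  | one_mul : QCommRel K (PTerm.unitLeft (.gen .unit) (.gen .mul)) PTerm.one
  | mul_one : QCommRel K (PTerm.unitRight (.gen .unit) (.gen .mul)) PTerm.one
  | quasi_comm : QCommRel K (.add (.gen .mul) (.smul (-1) (PTerm.op (.gen .mul))))
      (.smul PowerSeries.X (.gen .bracket))

/-- The ideal `(ħ)` of `K[[ħ]]`. -/
def hIdeal (K : Type u) [CommRing K] : Ideal K⟦X⟧ := Ideal.span {PowerSeries.X}

/-- The prop `Alg[[ħ]]⟨P⟩ / (m - m ∘ (21) = ħ P)` in the category of complete `K[[ħ]]`-modules,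
that is, the `ħ`-adic completion of the `K[[ħ]]`-linear prop with this presentation. -/
def qcommFull (K : Type u) [CommRing K] : LinProp.{u, u} K⟦X⟧ :=
  (presentedProp (QCommRel K)).completion (hIdeal K)

/-- The prop of quasi-commutative algebras: the quotient of `qcommFull` by its torsion ideal. -/
def qcommProp (K : Type u) [CommRing K] : LinProp.{u, u} K⟦X⟧ :=
  (qcommFull K).quot (qcommFull K).torsionIdeal

/-- The reduction modulo `ħ` of a prop over `K[[ħ]]`. -/
def LinProp.modH {K : Type u} [CommRing K] (Q : LinProp.{u, u} K⟦X⟧) : LinProp.{u, u} K⟦X⟧ :=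
  Q.quot (Q.smulIdeal (hIdeal K))

/-- The class of an operation modulo `ħ`. -/
def LinProp.toModH {K : Type u} [CommRing K] (Q : LinProp.{u, u} K⟦X⟧) {n m : ℕ} (x : Q.Hom n m) :
    Q.modH.Hom n m :=
  (Submodule.Quotient.mk x : Q.Hom n m ⧸ (hIdeal K • ⊤ : Submodule K⟦X⟧ (Q.Hom n m)))

/-- A generator of the prop of algebras. -/
def algGen (R : Type u) [CommRing R] {n m : ℕ} (g : AlgGen n m) : (algProp R).Hom n m :=
  PresHom.mk (AlgRel R) (.gen g)

/-- A generator of the prop of Poisson algebras. -/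
def poissonGen (R : Type u) [CommRing R] {n m : ℕ} (g : BracketGen n m) :
    (poissonProp R).Hom n m :=
  PresHom.mk (PoissonRel R) (.gen g)

/-- A generator of the prop of quasi-commutative algebras. -/
def qcommGen (K : Type u) [CommRing K] {n m : ℕ} (g : BracketGen n m) : (qcommProp K).Hom n m :=
  (Submodule.Quotient.mk
    (AdicCompletion.of (hIdeal K) (PresHom (QCommRel K) n m) (PresHom.mk (QCommRel K) (.gen g))) :
    (qcommFull K).Hom n m ⧸ (qcommFull K).torsionIdeal.carrier n m)

/-! ### Free associative algebras as enveloping algebras of free Lie algebras -/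

section Action

variable (R : Type u) [CommRing R] (A : Type u) [Ring A] [Algebra R A]

variable {R A} in
/-- An operation of the endomorphism prop of `A`, regarded as a linear map. -/
def endFun {n m : ℕ} (f : (endProp R A).Hom n m) : TPow R A n →ₗ[R] TPow R A m := f

/-- The values of the generators of the prop of algebras in the endomorphism prop of an algebra:
the unit and the product. -/
def algGenAct : ∀ {n m : ℕ}, AlgGen n m → (endProp R A).Hom n m
  | _, _, .unit => PiTensorProduct.lift
      (MultilinearMap.constOfIsEmpty R (fun _ : Fin 0 => A)
        (PiTensorProduct.tprod R (fun _ : Fin 1 => (1 : A))))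
  | _, _, .mul =>
      (PiTensorProduct.subsingletonEquiv (R := R) (s := fun _ : Fin 1 => A) 0).symm.toLinearMap ∘ₗ
        PiTensorProduct.lift (MultilinearMap.mkPiAlgebraFin R 2 A)

theorem endFun_algGenAct_unit (a : Fin 0 → A) :
    endFun (algGenAct R A AlgGen.unit) (PiTensorProduct.tprod R a) =
      PiTensorProduct.tprod R (fun _ : Fin 1 => (1 : A)) := by
  simp [algGenAct, endFun]

theorem endFun_algGenAct_mul (a : Fin 2 → A) :
    endFun (algGenAct R A AlgGen.mul) (PiTensorProduct.tprod R a) =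
      PiTensorProduct.tprod R (fun _ : Fin 1 => a 0 * a 1) := by
  simp [algGenAct, endFun]

theorem TPow.tprod_eq_join {n m : ℕ} (a : Fin (n + m) → A) :
    PiTensorProduct.tprod R a = TPow.join R A n m
      (PiTensorProduct.tprod R (fun i => a (Fin.castAdd m i)) ⊗ₜ
        PiTensorProduct.tprod R (fun i => a (Fin.natAdd n i))) := by
  rw [TPow.join_tprod, Fin.append_castAdd_natAdd]

theorem endFun_tens_tprod {n m n' m' : ℕ} (f : (endProp R A).Hom n m)
    (g : (endProp R A).Hom n' m') (a : Fin (n + n') → A) (b : Fin m → A) (c : Fin m' → A)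
    (hb : endFun f (PiTensorProduct.tprod R fun i => a (Fin.castAdd n' i)) =
      PiTensorProduct.tprod R b)
    (hc : endFun g (PiTensorProduct.tprod R fun i => a (Fin.natAdd n i)) =
      PiTensorProduct.tprod R c) :
    endFun ((endProp R A).tens f g) (PiTensorProduct.tprod R a) =
      PiTensorProduct.tprod R (Fin.append b c) := by
  rw [TPow.tprod_eq_join, ← TPow.join_tprod, ← hb, ← hc]
  exact TPow.tens_join R A f g _ _

theorem endFun_id {n : ℕ} (x : TPow R A n) :
    endFun ((endProp R A).perm (Equiv.refl (Fin n))) x = x := by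
  change TPow.perm R A (Equiv.refl (Fin n)) x = x
  simp [TPow.perm]

theorem algGenAct_rel {n m : ℕ} {x y : PTerm R AlgGen n m} (h : AlgRel R x y) :
    PTerm.eval (endProp R A) (algGenAct R A) x = PTerm.eval (endProp R A) (algGenAct R A) y := by
  cases h with
  | assoc =>
    apply TPow.ext_tprod
    intro a
    change endFun (algGenAct R A AlgGen.mul) (endFun ((endProp R A).tens
        (algGenAct R A AlgGen.mul) ((endProp R A).perm (Equiv.refl (Fin 1))))
          (PiTensorProduct.tprod R a)) =
      endFun (algGenAct R A AlgGen.mul) (endFun ((endProp R A).tens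
        ((endProp R A).perm (Equiv.refl (Fin 1))) (algGenAct R A AlgGen.mul))
          (PiTensorProduct.tprod R a))
    rw [endFun_tens_tprod (n := 2) (n' := 1) R A _ _ _ _ _ (endFun_algGenAct_mul R A _)
        (endFun_id R A _),
      endFun_tens_tprod (n := 1) (n' := 2) R A _ _ _ _ _ (endFun_id R A _)
        (endFun_algGenAct_mul R A _),
      endFun_algGenAct_mul, endFun_algGenAct_mul]
    congr 1
    funext i
    exact mul_assoc (a 0) (a 1) (a 2)
  | one_mul =>
    apply TPow.ext_tprod
    intro a
    change endFun (algGenAct R A AlgGen.mul) (endFun ((endProp R A).tens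
        (algGenAct R A AlgGen.unit) ((endProp R A).perm (Equiv.refl (Fin 1))))
          (PiTensorProduct.tprod R a)) =
      endFun ((endProp R A).perm (Equiv.refl (Fin 1))) (PiTensorProduct.tprod R a)
    rw [endFun_tens_tprod (n := 0) (n' := 1) R A _ _ _ _ _ (endFun_algGenAct_unit R A _)
        (endFun_id R A _), endFun_algGenAct_mul, endFun_id]
    congr 1
    funext i
    rw [Subsingleton.elim i 0]
    exact one_mul (a 0)
  | mul_one =>
    apply TPow.ext_tprod
    intro a
    change endFun (algGenAct R A AlgGen.mul) (endFun ((endProp R A).tens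
        ((endProp R A).perm (Equiv.refl (Fin 1))) (algGenAct R A AlgGen.unit))
          (PiTensorProduct.tprod R a)) =
      endFun ((endProp R A).perm (Equiv.refl (Fin 1))) (PiTensorProduct.tprod R a)
    rw [endFun_tens_tprod (n := 1) (n' := 0) R A _ _ _ _ _ (endFun_id R A _)
        (endFun_algGenAct_unit R A _), endFun_algGenAct_mul, endFun_id]
    congr 1
    funext i
    rw [Subsingleton.elim i 0]
    exact mul_one (a 0)

/-- The action of the prop of algebras on an algebra `A`: the generators `η` and `m` act by the
unit and the product of `A`. -/
def algAct : PropHom (RingHom.id R) (algProp R) (endProp R A) :=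
  presentedLift (AlgRel R) (endProp R A) (algGenAct R A) (algGenAct_rel R A)

end Action

section Free

variable (K : Type u) [Field K]

/-- The enveloping algebra `U(FL_N)` of the free Lie algebra in `N` generators. -/
abbrev UFree (N : ℕ) : Type u := UniversalEnvelopingAlgebra K (FreeLieAlgebra K (Fin N))

/-- The generators of `U(FL_N)`. -/
def uGen (N : ℕ) (i : Fin N) : UFree K N :=
  UniversalEnvelopingAlgebra.ι K (FreeLieAlgebra.of K i)

/-- The value of an operation of the prop of algebras on the generators `x₁ ⊗ ⋯ ⊗ x_N` of the free
algebra `U(FL_N)`. -/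
def algEval (N n : ℕ) : (algProp K).Hom N n →ₗ[K] TPow K (UFree K N) n where
  toFun x := endFun ((algAct K (UFree K N)).app N n x) (PiTensorProduct.tprod K (uGen K N))
  map_add' x y := by
    rw [map_add]
    rfl
  map_smul' r x := by
    rw [LinearMap.map_smulₛₗ]
    rfl

/-- The homogeneous component of multidegree `d` of `U(FL_N)^{⊗ n}`, where the generator `x_i` has
degree `δ_i`: it is spanned by the tensor products of words in which every generator `x_i` occurs
`d i` times altogether. -/
def multidegreePart (N n : ℕ) (d : Fin N → ℕ) : Submodule K (TPow K (UFree K N) n) :=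
  Submodule.span K
    {z | ∃ w : Fin n → List (Fin N), (∀ i, ∑ j, (w j).count i = d i) ∧
      z = PiTensorProduct.tprod K (fun j => ((w j).map (uGen K N)).prod)}

attribute [local instance 100] LieRing.ofAssociativeRing

/-- The Lie algebra `FL_N^{⊕ n}`. -/
abbrev LieSum (N n : ℕ) : Type u := ⨁ _ : Fin n, FreeLieAlgebra K (Fin N)

/-- The canonical Lie algebra morphism `FL_N^{⊕ n} → U(FL_N)^{⊗ n}`, with value
`1 ⊗ ⋯ ⊗ x ⊗ ⋯ ⊗ 1` (`x` in position `j`) on an element `x` of the `j`-th summand. -/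
def lieSumMap (N n : ℕ) : LieSum K N n →ₗ⁅K⁆ TPow K (UFree K N) n :=
  DirectSum.toLieAlgebra (TPow K (UFree K N) n)
    (fun j => (AlgHom.toLieHom
      (PiTensorProduct.singleAlgHom (R := K) (A := fun _ : Fin n => UFree K N) j)).comp
        (UniversalEnvelopingAlgebra.ι K))
    (by
      intro i j hij x y
      rw [LieRing.of_associative_ring_bracket, sub_eq_zero]
      exact Commute.tprod (Pi.mulSingle_commute hij _ _))

/-- The identification `U(FL_N^{⊕ n}) → U(FL_N)^{⊗ n}`. -/
def envToTPow (N n : ℕ) :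
    UniversalEnvelopingAlgebra K (LieSum K N n) →ₐ[K] TPow K (UFree K N) n :=
  UniversalEnvelopingAlgebra.lift K (lieSumMap K N n)

/-- The subspace `U(g)^{≤ k}` of an enveloping algebra spanned by the products of at most `k`
elements of `g`. -/
def envFilt (L : Type u) [LieRing L] [LieAlgebra K L] (k : ℕ) :
    Submodule K (UniversalEnvelopingAlgebra K L) :=
  ⨆ i : ℕ, ⨆ _ : i ≤ k,
    LinearMap.range (UniversalEnvelopingAlgebra.ι K : L →ₗ⁅K⁆ _).toLinearMap ^ i

/-- The subspace `(U(FL_N)^{⊗ n})^{≤ k}`, the image of `U(FL_N^{⊕ n})^{≤ k}`. -/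
def tpowFilt (N n k : ℕ) : Submodule K (TPow K (UFree K N) n) :=
  (envFilt K (LieSum K N n) k).map (envToTPow K N n).toLinearMap

end Free

section Laurent

variable (K : Type u) [Field K]

-- The coefficientwise action of `K` on Laurent series.
attribute [local instance 2000] HahnSeries.instAlgebra

theorem laurentSMulComm : SMulCommClass K⟦X⟧ K K⸨X⸩ where
  smul_comm f a x := by
    rw [Algebra.smul_def f, Algebra.smul_def f, mul_smul_comm]

attribute [local instance] laurentSMulComm

/-- The prop `Alg((ħ))` over the field `K((ħ))` of Laurent series. As all `Alg(N, n)` are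
finite-dimensional, `Alg(N, n)((ħ))` is `K((ħ)) ⊗ Alg(N, n)`. -/
def algLaurent : LinProp.{u, u} K⸨X⸩ := (algProp K).baseChange K⸨X⸩

/-- The element `f x` of `Alg(N, n)((ħ))` for a Laurent series `f` and `x` in `Alg(N, n)`. -/
def algLaurentMk {N n : ℕ} (f : K⸨X⸩) (x : (algProp K).Hom N n) : (algLaurent K).Hom N n :=
  (f ⊗ₜ[K] x : K⸨X⸩ ⊗[K] (algProp K).Hom N n)

/-- The space `K((ħ)) ⊗ U(FL_N)^{⊗ n}`. -/
abbrev LaurentTPow (N n : ℕ) : Type u := K⸨X⸩ ⊗[K] TPow K (UFree K N) n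

/-- The `K((ħ))`-linear extension of `algEval`. -/
def algLaurentEval (N n : ℕ) : (algLaurent K).Hom N n →ₗ[K⸨X⸩] LaurentTPow K N n :=
  LinearMap.baseChange K⸨X⸩ (algEval K N n)

/-- The `K[[ħ]]`-submodule `∑_{k ≥ 0} ħ^{k - N} W_k[[ħ]]` of `U(FL_N)^{⊗ n}((ħ))`, where `W_k` is the
(finite-dimensional) component of `(U(FL_N)^{⊗ n})^{≤ k}` of multidegree `δ₁ + ⋯ + δ_N`. -/
def qcommLattice (N n : ℕ) : Submodule K⟦X⟧ (LaurentTPow K N n) :=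
  ⨆ k : ℕ, Submodule.span K⟦X⟧
    {z | ∃ w ∈ tpowFilt K N n k ⊓ multidegreePart K N n (fun _ => 1),
      z = HahnSeries.single ((k : ℤ) - (N : ℤ)) (1 : K) ⊗ₜ[K] w}

end Laurent

/-! ### Flat deformations -/

/-- A `K[[ħ]]`-module is topologically free if it is isomorphic to `V[[ħ]]`, the `ħ`-adic completion
of `K[[ħ]] ⊗ V`, for a vector space `V`. -/
def TopFree (K : Type u) [Field K] (M : Type u) [AddCommGroup M] [Module K⟦X⟧ M] : Prop :=
  ∃ (V : Type u) (_ : AddCommGroup V) (_ : Module K V),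
    Nonempty (M ≃ₗ[K⟦X⟧] AdicCompletion (hIdeal K) (K⟦X⟧ ⊗[K] V))

/-- A prop `Q` over `K[[ħ]]` is a flat deformation of the prop `P` over `K` if its modules of
operations are topologically free and its reduction modulo `ħ` is isomorphic to `P`. -/
def IsFlatDeformation {K : Type u} [Field K] (Q : LinProp.{u, u} K⟦X⟧) (P : LinProp.{u, u} K) :
    Prop :=
  (∀ n m, TopFree K (Q.Hom n m)) ∧
    ∃ F : PropHom (PowerSeries.C (R := K)) P Q.modH, ∀ n m, Function.Bijective (F.app n m)

end

/-! One explicit family of operations serves as a basis everywhere. A family `V` assigns to each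
output a list of pairs `(i, l)`, read as the left-normed bracket of `x_i` with the letters of `l`,
and `lieOp` multiplies these brackets in each output. `StandardIdx N n` keeps the families in which
each of the `N` letters occurs once, each bracket starts with its smallest letter, and the starting
letters decrease along each output.

Spanning. Poisson algebras (`h = 0`), quasi-commutative algebras (`h = ħ`) and commutators (`h = 1`)
are handled together: a Lie bracket with the Leibniz rule and `ab - ba = h {a, b}`. Jacobi and skew
symmetry reduce all Lie expressions to left-normed brackets with minimal first letter, the Leibniz
rule moves brackets inside products, and exchanging two factors costs `h` times a product with one
factor fewer, as in the easy half of Poincaré–Birkhoff–Witt. Such computations with elements take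
place in `FreePow`, the tensor powers of the free algebra over a prop; `ret` recovers an operation
from its value on `x₁ ⊗ ⋯ ⊗ x_N`. The outcome is `LinProp.IsQuasiPoisson.span_lieOp`.

Independence. In `U(FL_N)^{⊗ n}` a standard product equals the word obtained by erasing the brackets
plus lexicographically larger words, and that word determines the standard family
(`linearIndependent_lieTensor`). The evaluation of `Alg` has a left inverse (`algRet_algEval`), so
the same independence holds in `Alg(N, n)`.

Torsion and completion. In the uncompleted presented prop, `ħ` times the bracket is a commutator, so
skew symmetry and the Leibniz rule hold after multiplication by `ħ` and Jacobi after multiplication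
by `ħ²`. Hence the quotient `qcommFree` by the `ħ²`-torsion is spanned by the standard products. In
`Alg((ħ))` these become powers of `ħ` times independent elements, so they form a basis and
`qcommFree` embeds. A finite free module over `K[[ħ]]` is complete and torsion-free, so completing
first and then killing all torsion gives nothing new (`qcommFreeToProp_bijective`).

Consequences. A multilinear product of `k` brackets contains `N - k` brackets with a letter, each
worth `ħ⁻¹`, which explains the exponent `k - N`; `tpowFilt_le_span` and `lieTensor_mem_tpowFilt`
identify the filtration with products of at most `k` brackets. Modulo `ħ` the axioms become those of
Poisson algebras. The spanning family of `Poisson(N, n)` is carried to the reduction of a basis, so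
the comparison map is injective, and it is surjective because it hits the generators. -/

noncomputable section

/-! ### Tensor powers of the free algebra over a prop -/

section FreePow

variable {R : Type u} [CommRing R] (P : LinProp.{u, u} R) (ι : Type)

open scoped Classical in
/-- The relations identifying words that differ by a permutation of the letters. -/
def FreePow.relations (n : ℕ) : Submodule R (⨁ s : Σ k, Fin k → ι, P.Hom s.1 n) :=
  Submodule.span R {z | ∃ (k l : ℕ) (e : Fin k ≃ Fin l) (w : Fin l → ι) (x : P.Hom l n),
    z = DirectSum.lof R (Σ k, Fin k → ι) (fun s => P.Hom s.1 n) ⟨k, w ∘ e⟩ (P.comp (P.perm e) x) -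
      DirectSum.lof R (Σ k, Fin k → ι) (fun s => P.Hom s.1 n) ⟨l, w⟩ x}

/-- The `n`-th tensor power of the free `P`-algebra on `ι`: it is spanned by the values of the
operations of `P` with `n` outputs on words in `ι`. -/
def FreePow (n : ℕ) : Type u := (⨁ s : Σ k, Fin k → ι, P.Hom s.1 n) ⧸ FreePow.relations P ι n

instance (n : ℕ) : AddCommGroup (FreePow P ι n) :=
  inferInstanceAs (AddCommGroup (_ ⧸ FreePow.relations P ι n))

instance (n : ℕ) : Module R (FreePow P ι n) :=
  inferInstanceAs (Module R (_ ⧸ FreePow.relations P ι n))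

namespace FreePow

variable {P ι}

open scoped Classical in
/-- The value of an operation on a word. -/
def mk {k n : ℕ} (w : Fin k → ι) : P.Hom k n →ₗ[R] FreePow P ι n :=
  (relations P ι n).mkQ ∘ₗ
    DirectSum.lof R (Σ k, Fin k → ι) (fun s => P.Hom s.1 n) ⟨k, w⟩

theorem mk_perm {k l n : ℕ} (e : Fin k ≃ Fin l) (w : Fin l → ι) (x : P.Hom l n) :
    mk (w ∘ e) (P.comp (P.perm e) x) = mk w x :=
  (Submodule.Quotient.eq _).2 (Submodule.subset_span ⟨k, l, e, w, x, rfl⟩)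

theorem mk_perm' {k l n : ℕ} (e : Fin k ≃ Fin l) (w : Fin k → ι) (x : P.Hom l n) :
    mk w (P.comp (P.perm e) x) = mk (w ∘ e.symm) x := by
  rw [← mk_perm e (w ∘ e.symm), Function.comp_assoc, Equiv.symm_comp_self, Function.comp_id]

@[elab_as_elim]
theorem induction {n : ℕ} {p : FreePow P ι n → Prop} (z : FreePow P ι n) (zero : p 0)
    (mk : ∀ {k : ℕ} (w : Fin k → ι) (x : P.Hom k n), p (mk w x))
    (add : ∀ y z, p y → p z → p (y + z)) : p z := by
  classical
  obtain ⟨z, rfl⟩ := (relations P ι n).mkQ_surjective z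
  induction z using DirectSum.induction_on with
  | zero => rw [map_zero]; exact zero
  | of i x => exact mk i.2 x
  | add y z hy hz => rw [map_add]; exact add _ _ hy hz

open scoped Classical in
/-- The universal property of tensor powers of the free algebra. -/
def lift {Z : Type u} [AddCommGroup Z] [Module R Z] {n : ℕ}
    (φ : ∀ k : ℕ, (Fin k → ι) → P.Hom k n →ₗ[R] Z)
    (hφ : ∀ (k l : ℕ) (e : Fin k ≃ Fin l) (w : Fin l → ι) (x : P.Hom l n),
      φ k (w ∘ e) (P.comp (P.perm e) x) = φ l w x) : FreePow P ι n →ₗ[R] Z :=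
  (relations P ι n).liftQ (DirectSum.toModule R _ Z fun s => φ s.1 s.2) (by
    rw [relations, Submodule.span_le]
    rintro _ ⟨k, l, e, w, x, rfl⟩
    rw [SetLike.mem_coe, LinearMap.mem_ker, map_sub, DirectSum.toModule_lof,
      DirectSum.toModule_lof, hφ, sub_self])

@[simp] theorem lift_mk {Z : Type u} [AddCommGroup Z] [Module R Z] {n : ℕ}
    (φ : ∀ k : ℕ, (Fin k → ι) → P.Hom k n →ₗ[R] Z)
    (hφ : ∀ (k l : ℕ) (e : Fin k ≃ Fin l) (w : Fin l → ι) (x : P.Hom l n),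
      φ k (w ∘ e) (P.comp (P.perm e) x) = φ l w x) {k : ℕ} (w : Fin k → ι) (x : P.Hom k n) :
    lift φ hφ (mk w x) = φ k w x := by
  classical
  exact DirectSum.toModule_lof R (φ := fun s : Σ k, Fin k → ι => φ s.1 s.2) ⟨k, w⟩ x

theorem hom_ext {Z : Type*} [AddCommGroup Z] [Module R Z] {n : ℕ} {f g : FreePow P ι n →ₗ[R] Z}
    (h : ∀ {k : ℕ} (w : Fin k → ι) (x : P.Hom k n), f (mk w x) = g (mk w x)) : f = g := by
  apply LinearMap.ext
  intro z
  induction z using FreePow.induction with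
  | zero => rw [map_zero, map_zero]
  | mk w x => exact h w x
  | add y z hy hz => rw [map_add, map_add, hy, hz]

/-- The action of the operations of `P` on the tensor powers. -/
def act {n m : ℕ} : FreePow P ι n →ₗ[R] P.Hom n m →ₗ[R] FreePow P ι m :=
  lift (fun _ w => P.comp.compr₂ (mk w)) (fun _ _ e w x => by
    ext y
    simp only [LinearMap.compr₂_apply]
    rw [P.comp_assoc, mk_perm])

@[simp] theorem act_mk {k n m : ℕ} (w : Fin k → ι) (x : P.Hom k n) (y : P.Hom n m) :
    act (mk w x) y = mk w (P.comp x y) := by simp [act]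

theorem act_act {n m p : ℕ} (z : FreePow P ι n) (x : P.Hom n m) (y : P.Hom m p) :
    act (act z x) y = act z (P.comp x y) := by
  induction z using FreePow.induction with
  | zero => simp
  | mk w x => simp [P.comp_assoc]
  | add y z hy hz => simp [hy, hz]

@[simp] theorem act_id {n : ℕ} (z : FreePow P ι n) :
    act z (P.perm (Equiv.refl (Fin n))) = z := by
  induction z using FreePow.induction with
  | zero => simp
  | mk w x => simp [P.comp_id]
  | add y z hy hz => simp [hy, hz]

theorem _root_.append_comp_blockPerm {ι : Type*} {n m n' m' : ℕ} (e : Fin n ≃ Fin m)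
    (f : Fin n' ≃ Fin m') (a : Fin m → ι) (b : Fin m' → ι) :
    Fin.append a b ∘ blockPerm e f = Fin.append (a ∘ e) (b ∘ f) := by
  funext i
  refine Fin.addCases (fun i => ?_) (fun i => ?_) i <;> simp [blockPerm]

theorem tens_perm_comp {n m k n' m' k' : ℕ} (e : Fin n ≃ Fin m) (f : Fin n' ≃ Fin m')
    (x : P.Hom m k) (y : P.Hom m' k') :
    P.tens (P.comp (P.perm e) x) (P.comp (P.perm f) y) =
      P.comp (P.perm (blockPerm e f)) (P.tens x y) := by
  rw [P.tens_comp, P.perm_tens]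

theorem mk_append_left {k l k' n m : ℕ} (e : Fin k ≃ Fin l) (w : Fin l → ι) (w' : Fin k' → ι)
    (x : P.Hom l n) (y : P.Hom k' m) :
    mk (Fin.append (w ∘ e) w') (P.tens (P.comp (P.perm e) x) y) =
      mk (Fin.append w w') (P.tens x y) := by
  have h := tens_perm_comp (P := P) e (Equiv.refl (Fin k')) x y
  rw [P.id_comp] at h
  rw [h, ← mk_perm (blockPerm e (Equiv.refl (Fin k'))) (Fin.append w w'),
    append_comp_blockPerm]
  rfl

theorem mk_append_right {k l k' n m : ℕ} (e : Fin k ≃ Fin l) (w : Fin l → ι) (w' : Fin k' → ι)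
    (x : P.Hom l n) (y : P.Hom k' m) :
    mk (Fin.append w' (w ∘ e)) (P.tens y (P.comp (P.perm e) x)) =
      mk (Fin.append w' w) (P.tens y x) := by
  have h := tens_perm_comp (P := P) (Equiv.refl (Fin k')) e y x
  rw [P.id_comp] at h
  rw [h, ← mk_perm (blockPerm (Equiv.refl (Fin k')) e) (Fin.append w' w),
    append_comp_blockPerm]
  rfl

/-- The product of the tensor powers. -/
def tens {n m : ℕ} : FreePow P ι n →ₗ[R] FreePow P ι m →ₗ[R] FreePow P ι (n + m) :=
  lift (fun k w =>
    { toFun := fun x => lift (fun _ w' => mk (Fin.append w w') ∘ₗ P.tens x)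
        (fun _ _ e w' y => mk_append_right e w' w y x)
      map_add' := fun x x' => hom_ext fun w' y => by simp
      map_smul' := fun r x => hom_ext fun w' y => by simp })
    (fun _ _ e w x => hom_ext fun w' y => by simpa using mk_append_left e w w' x y)

@[simp] theorem tens_mk {k l n m : ℕ} (w : Fin k → ι) (x : P.Hom k n) (w' : Fin l → ι)
    (y : P.Hom l m) : tens (mk w x) (mk w' y) = mk (Fin.append w w') (P.tens x y) := by
  simp [tens]

theorem act_tens {n m n' m' : ℕ} (y : FreePow P ι n) (z : FreePow P ι n') (a : P.Hom n m)
    (b : P.Hom n' m') : act (tens y z) (P.tens a b) = tens (act y a) (act z b) := by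
  induction y using FreePow.induction with
  | zero => simp
  | add y z hy hz => simp only [map_add, LinearMap.add_apply, hy, hz]
  | mk w x =>
  induction z using FreePow.induction with
  | zero => simp
  | add y z hy hz => simp only [map_add, LinearMap.add_apply, hy, hz]
  | mk w' x' => simp [P.tens_comp]

theorem act_tens_flip {n m : ℕ} (y : FreePow P ι n) (z : FreePow P ι m) :
    act (tens y z) (P.perm finAddFlip) = tens z y := by
  induction y using FreePow.induction with
  | zero => simp
  | add y z hy hz => simp only [map_add, LinearMap.add_apply, hy, hz]
  | mk w x =>
  induction z using FreePow.induction with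
  | zero => simp
  | add y z hy hz => simp only [map_add, LinearMap.add_apply, hy, hz]
  | mk w' x' =>
    simp only [tens_mk, act_mk, P.tens_symm]
    rw [mk_perm']
    congr 2
    funext i
    refine Fin.addCases (fun i => ?_) (fun i => ?_) i <;> simp [finAddFlip]

theorem act_tens_assoc {n m p : ℕ} (x : FreePow P ι n) (y : FreePow P ι m) (z : FreePow P ι p) :
    act (tens (tens x y) z) (P.perm (finCongr (Nat.add_assoc n m p))) = tens x (tens y z) := by
  induction x using FreePow.induction with
  | zero => simp
  | add y z hy hz => simp only [map_add, LinearMap.add_apply, hy, hz]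
  | mk w x =>
  induction y using FreePow.induction with
  | zero => simp
  | add y z hy hz => simp only [map_add, LinearMap.add_apply, hy, hz]
  | mk w' x' =>
  induction z using FreePow.induction with
  | zero => simp
  | add y z hy hz => simp only [map_add, LinearMap.add_apply, hy, hz]
  | mk w'' x'' =>
    simp only [tens_mk, act_mk, P.tens_assoc]
    rw [mk_perm']
    congr 2
    rw [Fin.append_assoc]
    funext i
    simp

variable (P ι) in
/-- The empty word. -/
def nil : FreePow P ι 0 := mk (k := 0) Fin.elim0 (P.perm (Equiv.refl _))

theorem act_nil_tens {n : ℕ} (z : FreePow P ι n) :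
    act (tens (nil P ι) z) (P.perm (finCongr (Nat.zero_add n))) = z := by
  induction z using FreePow.induction with
  | zero => simp
  | add y z hy hz => simp only [map_add, LinearMap.add_apply, hy, hz]
  | mk w x =>
    simp only [nil, tens_mk, act_mk, P.id_tens]
    rw [mk_perm']
    congr 2
    funext i
    have hi : (finCongr (Nat.zero_add _)).symm i = Fin.natAdd 0 i := by ext; simp
    rw [Function.comp_apply, hi, Fin.append_right]

/-- `0 + 1` reduces to `1`, so the cast permutation in `act_nil_tens` is the identity here. -/
theorem nil_tens_one (z : FreePow P ι 1) : (tens (nil P ι) z : FreePow P ι (0 + 1)) = z := by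
  conv_rhs => rw [← act_nil_tens z]
  exact (act_id _).symm

variable (P) in
/-- A letter. -/
def var (i : ι) : FreePow P ι 1 := mk (fun _ => i) (P.perm (Equiv.refl (Fin 1)))

/-! ### Products of several factors -/

/-- The product `z₁ ⊗ ⋯ ⊗ z_n`. -/
def tensN : ∀ {n : ℕ}, (Fin n → FreePow P ι 1) → FreePow P ι n
  | 0, _ => nil P ι
  | _ + 1, f => tens (tensN (Fin.init f)) (f (Fin.last _))

theorem tensN_succ {n : ℕ} (f : Fin (n + 1) → FreePow P ι 1) :
    tensN f = tens (tensN (Fin.init f)) (f (Fin.last _)) := rfl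

theorem tensN_one (f : Fin 1 → FreePow P ι 1) : tensN f = f 0 := nil_tens_one _

theorem tensN_two (f : Fin 2 → FreePow P ι 1) : tensN f = tens (f 0) (f 1) := by
  rw [tensN_succ, tensN_one]
  rfl

theorem tensN_three (f : Fin 3 → FreePow P ι 1) :
    tensN f = tens (tens (f 0) (f 1) : FreePow P ι (1 + 1)) (f 2) := by
  rw [tensN_succ, tensN_two]
  rfl

theorem tensN_update_add {n : ℕ} (f : Fin n → FreePow P ι 1) (i : Fin n) (x y : FreePow P ι 1) :
    tensN (Function.update f i (x + y)) =
      tensN (Function.update f i x) + tensN (Function.update f i y) := by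
  induction n with
  | zero => exact i.elim0
  | succ n ih =>
    induction i using Fin.lastCases with
    | last => simp [tensN_succ]
    | cast i => simp [tensN_succ, ih, Fin.init_update_castSucc, (Fin.castSucc_lt_last i).ne']

theorem tensN_update_smul {n : ℕ} (f : Fin n → FreePow P ι 1) (i : Fin n) (r : R)
    (x : FreePow P ι 1) :
    tensN (Function.update f i (r • x)) = r • tensN (Function.update f i x) := by
  induction n with
  | zero => exact i.elim0
  | succ n ih =>
    induction i using Fin.lastCases with
    | last => simp [tensN_succ]
    | cast i => simp [tensN_succ, ih, Fin.init_update_castSucc, (Fin.castSucc_lt_last i).ne']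

variable (P ι) in
/-- `tensN` as a multilinear map. -/
def tensNHom (n : ℕ) : MultilinearMap R (fun _ : Fin n => FreePow P ι 1) (FreePow P ι n) where
  toFun := tensN
  map_update_add' f i x y := by
    convert tensN_update_add f i x y
  map_update_smul' f i r x := by
    convert tensN_update_smul f i r x

theorem tensN_append {n m : ℕ} (f : Fin n → FreePow P ι 1) (g : Fin m → FreePow P ι 1) :
    tensN (Fin.append f g) = tens (tensN f) (tensN g) := by
  induction m with
  | zero =>
    -- The prop axioms contain the left unit law only; the right one is obtained by exchanging the
    -- two factors.
    have h := act_tens_flip (nil P ι) (tensN f)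
    have h0 := act_nil_tens (tensN f)
    have e : tens (tensN f) (tensN g) = tens (tensN f) (nil P ι) := rfl
    rw [e, ← h]
    have h1 : (finAddFlip : Fin (0 + n) ≃ Fin (n + 0)) = finCongr (Nat.zero_add n) := by
      ext i
      refine Fin.addCases (fun i => i.elim0) (fun i => ?_) i
      simp only [finAddFlip, Equiv.trans_apply, finSumFinEquiv_symm_apply_natAdd,
        Equiv.sumComm_apply, Sum.swap_inr, finSumFinEquiv_apply_left, finCongr_apply]
      simp
    rw [h1]
    refine Eq.trans ?_ h0.symm
    congr 1
    funext i
    exact Fin.append_left f g i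
  | succ m ih =>
    have h1 : Fin.init (n := n + m) (Fin.append (n := m + 1) f g) = Fin.append f (Fin.init g) := by
      funext i
      refine Fin.addCases (fun i => ?_) (fun i => ?_) i
      · rw [Fin.append_left]
        exact Fin.append_left f g i
      · rw [Fin.append_right]
        exact Fin.append_right f g i.castSucc
    have h2 : Fin.append (n := m + 1) f g (Fin.last (n + m)) = g (Fin.last _) :=
      Fin.append_right f g (Fin.last m)
    -- Since `n + (m + 1)` reduces to `(n + m) + 1`, the associativity cast is the identity.
    have h3 := act_tens_assoc (tensN f) (tensN (Fin.init g)) (g (Fin.last m))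
    have h4 : finCongr (Nat.add_assoc n m 1) = Equiv.refl _ := rfl
    rw [h4, act_id] at h3
    exact (tensN_succ (n := n + m) _).trans (by rw [h1, h2, ih]; exact h3)

theorem tensN_eq_tens {n m : ℕ} (f : Fin (n + m) → FreePow P ι 1) :
    tensN f = tens (tensN fun i => f (Fin.castAdd m i)) (tensN fun i => f (Fin.natAdd n i)) := by
  rw [← tensN_append, Fin.append_castAdd_natAdd]

/-- Acting by `x` on this product of letters yields `mk w x`; for `w = id` this is the form from
which `ret` reads off `x`. -/
theorem tensN_var {n : ℕ} (w : Fin n → ι) :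
    tensN (fun i => var P (w i)) = mk w (P.perm (Equiv.refl _)) := by
  induction n with
  | zero =>
    rw [Subsingleton.elim w Fin.elim0]
    rfl
  | succ n ih =>
    have h := ih (Fin.init w)
    rw [tensN_succ]
    change tens (tensN fun i => var P (Fin.init w i)) _ = _
    rw [h, var, tens_mk, ← P.perm_tens]
    congr 1
    · congr 1
      funext i
      refine Fin.lastCases ?_ (fun i => ?_) i
      · exact Fin.append_right (Fin.init w) (fun _ : Fin 1 => w (Fin.last n)) 0
      · exact Fin.append_left (Fin.init w) (fun _ : Fin 1 => w (Fin.last n)) i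
    · congr 1
      ext i
      refine Fin.addCases (fun i => ?_) (fun i => ?_) i <;> simp [blockPerm]

end FreePow

end FreePow

/-! ### Permutation of tensor factors, and submodules stable under operations. -/

section FreePow

variable {R : Type u} [CommRing R] {P : LinProp.{u, u} R} {ι : Type}

theorem blockPerm_castAdd {n m n' m' : ℕ} (e : Fin n ≃ Fin m) (f : Fin n' ≃ Fin m') (i : Fin n) :
    blockPerm e f (Fin.castAdd n' i) = Fin.castAdd m' (e i) := by simp [blockPerm]

theorem blockPerm_natAdd {n m n' m' : ℕ} (e : Fin n ≃ Fin m) (f : Fin n' ≃ Fin m') (i : Fin n') :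
    blockPerm e f (Fin.natAdd n i) = Fin.natAdd m (f i) := by simp [blockPerm]

namespace FreePow

theorem act_tensN_blockPerm {n m n' m' : ℕ} {e : Fin n ≃ Fin m} {e' : Fin n' ≃ Fin m'}
    (he : ∀ f : Fin n → FreePow P ι 1, act (tensN f) (P.perm e) = tensN (f ∘ e.symm))
    (he' : ∀ f : Fin n' → FreePow P ι 1, act (tensN f) (P.perm e') = tensN (f ∘ e'.symm))
    (f : Fin (n + n') → FreePow P ι 1) :
    act (tensN f) (P.perm (blockPerm e e')) = tensN (f ∘ (blockPerm e e').symm) := by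
  rw [tensN_eq_tens, P.perm_tens, act_tens, he, he', tensN_eq_tens]
  congr 2
  · congr 1
    funext i
    simp [blockPerm]
  · funext i
    simp [blockPerm]

theorem act_tensN_refl {n : ℕ} (f : Fin n → FreePow P ι 1) :
    act (tensN f) (P.perm (Equiv.refl _)) = tensN (f ∘ (Equiv.refl _).symm) := by
  rw [act_id]
  rfl

theorem act_tensN_flip (f : Fin (1 + 1) → FreePow P ι 1) :
    act (tensN f) (P.perm (finAddFlip : Fin (1 + 1) ≃ Fin (1 + 1))) =
      tensN (f ∘ (finAddFlip : Fin (1 + 1) ≃ Fin (1 + 1)).symm) := by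
  have h := act_tens_flip (f 0) (f 1)
  rw [tensN_two, tensN_two]
  exact h

/-- An adjacent transposition is a block permutation: either it is the flip of the last two factors,
or it fixes the last factor and induction applies to the others. -/
theorem act_tensN_swap {n : ℕ} (i : Fin n) (f : Fin (n + 1) → FreePow P ι 1) :
    act (tensN f) (P.perm (Equiv.swap i.castSucc i.succ)) =
      tensN (f ∘ (Equiv.swap i.castSucc i.succ).symm) := by
  induction n with
  | zero => exact i.elim0
  | succ n ih =>
    induction i using Fin.lastCases with
    | last =>
      have h : (Equiv.swap (Fin.last n).castSucc (Fin.last n).succ : Equiv.Perm (Fin (n + 1 + 1))) =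
          blockPerm (n := n) (n' := 1 + 1) (Equiv.refl (Fin n))
            (finAddFlip : Fin (1 + 1) ≃ Fin (1 + 1)) := by
        ext j
        refine Fin.addCases (m := n) (n := 2) (fun j => ?_) (fun j => ?_) j
        · rw [Equiv.swap_apply_of_ne_of_ne]
          · simp [blockPerm]
          · rw [Ne, Fin.ext_iff]
            simpa using j.isLt.ne
          · rw [Ne, Fin.ext_iff]
            simpa using (j.isLt.trans (Nat.lt_succ_self n)).ne
        · have h0 : (Fin.natAdd n (0 : Fin 2) : Fin (n + 1 + 1)) = (Fin.last n).castSucc := by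
            ext
            simp
          have h1 : (Fin.natAdd n (1 : Fin 2) : Fin (n + 1 + 1)) = (Fin.last n).succ := by
            ext
            simp
          fin_cases j
          · change ((Equiv.swap _ _ (Fin.natAdd n (0 : Fin 2) : Fin (n + 1 + 1)) :
              Fin (n + 1 + 1)) : ℕ) = _
            rw [h0, Equiv.swap_apply_left]
            simp only [blockPerm, Equiv.trans_apply]
            erw [finSumFinEquiv_symm_apply_natAdd]
            rfl
          · change ((Equiv.swap _ _ (Fin.natAdd n (1 : Fin 2) : Fin (n + 1 + 1)) :
              Fin (n + 1 + 1)) : ℕ) = _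
            rw [h1, Equiv.swap_apply_right]
            simp only [blockPerm, Equiv.trans_apply]
            erw [finSumFinEquiv_symm_apply_natAdd]
            rfl
      rw [h]
      exact act_tensN_blockPerm act_tensN_refl act_tensN_flip f
    | cast i =>
      have h : (Equiv.swap i.castSucc.castSucc i.castSucc.succ : Equiv.Perm (Fin (n + 1 + 1))) =
          blockPerm (n := n + 1) (n' := 1) (Equiv.swap i.castSucc i.succ) (Equiv.refl (Fin 1)) := by
        ext j
        refine Fin.addCases (m := n + 1) (n := 1) (fun j => ?_) (fun j => ?_) j
        · have h' : Equiv.swap i.castSucc.castSucc i.castSucc.succ (Fin.castAdd 1 j) =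
              Fin.castAdd 1 (Equiv.swap i.castSucc i.succ j) := by
            have h2 : i.castSucc.castSucc = Fin.castAdd 1 i.castSucc := rfl
            have h3 : i.castSucc.succ = Fin.castAdd 1 i.succ := rfl
            rw [h2, h3]
            exact Function.Injective.swap_apply (Fin.castAdd_injective _ _) _ _ _
          rw [h', blockPerm_castAdd]
        · rw [Equiv.swap_apply_of_ne_of_ne]
          · rw [blockPerm_natAdd]
            rfl
          · rw [Ne, Fin.ext_iff]
            have := i.isLt
            simp
            omega
          · rw [Ne, Fin.ext_iff]
            have := i.isLt
            simp
            omega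
      rw [h]
      exact act_tensN_blockPerm (ih i) act_tensN_refl f

/-- The claim is multiplicative in `e`, and adjacent transpositions generate the symmetric group. -/
theorem act_tensN_perm {n m : ℕ} (e : Fin n ≃ Fin m) (f : Fin n → FreePow P ι 1) :
    act (tensN f) (P.perm e) = tensN (f ∘ e.symm) := by
  obtain rfl : n = m := by simpa using Fintype.card_congr e
  cases n with
  | zero =>
    rw [Subsingleton.elim e (Equiv.refl _)]
    exact act_tensN_refl f
  | succ n =>
    have he : e ∈ Submonoid.closure
        (Set.range fun i : Fin n => Equiv.swap i.castSucc i.succ) := by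
      rw [Equiv.Perm.mclosure_swap_castSucc_succ]
      trivial
    induction he using Submonoid.closure_induction generalizing f with
    | mem e he =>
      obtain ⟨i, rfl⟩ := he
      exact act_tensN_swap i f
    | one => exact act_tensN_refl f
    | mul e e' _ _ h h' =>
      rw [Equiv.Perm.mul_def, P.perm_trans, ← act_act, h', h]
      rfl

/-- The span of the products of elements of a submodule. -/
def tensSpan (O : Submodule R (FreePow P ι 1)) (n : ℕ) : Submodule R (FreePow P ι n) :=
  Submodule.span R {z | ∃ f : Fin n → FreePow P ι 1, (∀ i, f i ∈ O) ∧ z = tensN f}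

theorem tensN_mem_tensSpan {O : Submodule R (FreePow P ι 1)} {n : ℕ}
    {f : Fin n → FreePow P ι 1} (hf : ∀ i, f i ∈ O) : tensN f ∈ tensSpan O n :=
  Submodule.subset_span ⟨f, hf, rfl⟩

theorem mem_tensSpan_one {O : Submodule R (FreePow P ι 1)} {z : FreePow P ι 1} (hz : z ∈ O) :
    z ∈ tensSpan O 1 := by
  have h := tensN_mem_tensSpan (O := O) (f := fun _ : Fin 1 => z) (fun _ => hz)
  rwa [tensN_one] at h

theorem tens_mem_tensSpan {O : Submodule R (FreePow P ι 1)} {n m : ℕ} {y : FreePow P ι n}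
    {z : FreePow P ι m} (hy : y ∈ tensSpan O n) (hz : z ∈ tensSpan O m) :
    tens y z ∈ tensSpan O (n + m) := by
  have h := Submodule.apply_mem_map₂ tens hy hz
  rw [tensSpan, tensSpan, Submodule.map₂_span_span] at h
  refine Submodule.span_mono ?_ h
  rintro _ ⟨_, ⟨f, hf, rfl⟩, _, ⟨g, hg, rfl⟩, rfl⟩
  refine ⟨Fin.append f g, fun i => ?_, (tensN_append f g).symm⟩
  refine Fin.addCases (fun i => ?_) (fun i => ?_) i
  · simpa using hf i
  · simpa using hg i

/-- Multilinearity of `tensN`. It replaces the elements of a submodule by a spanning set, here the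
standard products. -/
theorem tensSpan_span (S : Set (FreePow P ι 1)) (n : ℕ) :
    tensSpan (Submodule.span R S) n =
      Submodule.span R {z | ∃ f : Fin n → FreePow P ι 1, (∀ i, f i ∈ S) ∧ z = tensN f} := by
  apply le_antisymm
  · rw [tensSpan, Submodule.span_le]
    rintro _ ⟨f, hf, rfl⟩
    induction n with
    | zero => exact Submodule.subset_span ⟨f, fun i => i.elim0, rfl⟩
    | succ n ih =>
      have h := Submodule.apply_mem_map₂ tens (ih (Fin.init f) fun i => hf i.castSucc)
        (hf (Fin.last n))
      rw [Submodule.map₂_span_span] at h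
      refine Submodule.span_mono ?_ h
      rintro _ ⟨_, ⟨g, hg, rfl⟩, x, hx, rfl⟩
      refine ⟨Fin.snoc g x, fun i => ?_, ?_⟩
      · refine Fin.lastCases ?_ (fun i => ?_) i
        · simpa using hx
        · simpa using hg i
      · simp [tensN_succ]
  · apply Submodule.span_mono
    rintro _ ⟨f, hf, rfl⟩
    exact ⟨f, fun i => Submodule.subset_span (hf i), rfl⟩

/-- If a submodule is stable under the generators, then the span of the products of its elements is
stable under all operations. -/
theorem act_eval_mem_tensSpan {G : ℕ → ℕ → Type} (g : ∀ {n m : ℕ}, G n m → P.Hom n m)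
    {O : Submodule R (FreePow P ι 1)}
    (hO : ∀ {n m : ℕ} (a : G n m) (f : Fin n → FreePow P ι 1), (∀ i, f i ∈ O) →
      act (tensN f) (g a) ∈ tensSpan O m)
    {n m : ℕ} (t : PTerm R G n m) {z : FreePow P ι n} (hz : z ∈ tensSpan O n) :
    act z (PTerm.eval P g t) ∈ tensSpan O m := by
  induction t with
  | @gen n m a =>
    have h : tensSpan O n ≤ (tensSpan O m).comap (act.flip (g a)) := by
      rw [tensSpan, Submodule.span_le]
      rintro _ ⟨f, hf, rfl⟩
      exact hO a f hf
    exact h hz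
  | @perm n m e =>
    have h : tensSpan O n ≤ (tensSpan O m).comap (act.flip (P.perm e)) := by
      rw [tensSpan, Submodule.span_le]
      rintro _ ⟨f, hf, rfl⟩
      rw [SetLike.mem_coe, Submodule.mem_comap, LinearMap.flip_apply, act_tensN_perm]
      exact tensN_mem_tensSpan fun i => hf _
    exact h hz
  | comp x y hx hy =>
    rw [PTerm.eval, ← act_act]
    exact hy (hx hz)
  | @tens n m n' m' x y hx hy =>
    have h : tensSpan O (n + n') ≤
        (tensSpan O (m + m')).comap (act.flip (PTerm.eval P g (x.tens y))) := by
      rw [tensSpan, Submodule.span_le]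
      rintro _ ⟨f, hf, rfl⟩
      rw [SetLike.mem_coe, Submodule.mem_comap, LinearMap.flip_apply, tensN_eq_tens, PTerm.eval,
        act_tens]
      exact tens_mem_tensSpan (hx (tensN_mem_tensSpan fun i => hf _))
        (hy (tensN_mem_tensSpan fun i => hf _))
    exact h hz
  | zero => simp [PTerm.eval]
  | add x y hx hy =>
    rw [PTerm.eval, map_add]
    exact add_mem (hx hz) (hy hz)
  | smul r x hx =>
    rw [PTerm.eval, map_smul]
    exact Submodule.smul_mem _ _ (hx hz)

/-! ### Contents -/

/-- The span of the values of operations on words with given content. -/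
def contentPart (P : LinProp.{u, u} R) (d : Multiset ι) (n : ℕ) : Submodule R (FreePow P ι n) :=
  Submodule.span R {z | ∃ (k : ℕ) (w : Fin k → ι) (x : P.Hom k n),
    (List.ofFn w : Multiset ι) = d ∧ z = mk w x}

theorem mk_mem_contentPart {k n : ℕ} (w : Fin k → ι) (x : P.Hom k n) :
    mk w x ∈ contentPart P (List.ofFn w : Multiset ι) n :=
  Submodule.subset_span ⟨k, w, x, rfl, rfl⟩

theorem nil_mem_contentPart : nil P ι ∈ contentPart P 0 0 :=
  Submodule.subset_span ⟨0, _, _, by simp, rfl⟩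

theorem var_mem_contentPart (i : ι) : var P i ∈ contentPart P {i} 1 :=
  Submodule.subset_span ⟨1, _, _, by simp, rfl⟩

theorem act_mem_contentPart {d : Multiset ι} {n m : ℕ} {z : FreePow P ι n}
    (hz : z ∈ contentPart P d n) (y : P.Hom n m) : act z y ∈ contentPart P d m := by
  have h : contentPart P d n ≤ (contentPart P d m).comap (act.flip y) := by
    rw [contentPart, Submodule.span_le]
    rintro _ ⟨k, w, x, rfl, rfl⟩
    rw [SetLike.mem_coe, Submodule.mem_comap, LinearMap.flip_apply, act_mk]
    exact mk_mem_contentPart _ _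
  exact h hz

theorem tens_mem_contentPart {d d' : Multiset ι} {n m : ℕ} {y : FreePow P ι n}
    {z : FreePow P ι m} (hy : y ∈ contentPart P d n) (hz : z ∈ contentPart P d' m) :
    tens y z ∈ contentPart P (d + d') (n + m) := by
  have h := Submodule.apply_mem_map₂ tens hy hz
  rw [contentPart, contentPart, Submodule.map₂_span_span] at h
  refine Submodule.span_mono ?_ h
  rintro _ ⟨_, ⟨k, w, x, rfl, rfl⟩, _, ⟨k', w', x', rfl, rfl⟩, rfl⟩
  exact ⟨_, Fin.append w w', P.tens x x', by simp [List.ofFn_fin_append], tens_mk _ _ _ _⟩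

theorem tensN_mem_contentPart {n : ℕ} {f : Fin n → FreePow P ι 1} {d : Fin n → Multiset ι}
    (hf : ∀ i, f i ∈ contentPart P (d i) 1) : tensN f ∈ contentPart P (∑ i, d i) n := by
  induction n with
  | zero => exact nil_mem_contentPart
  | succ n ih =>
    rw [Fin.sum_univ_castSucc]
    exact tens_mem_contentPart (ih fun i => hf i.castSucc) (hf _)

/-- The multilinear words, which are the ones that `ret` retains, are thereby singled out by their
content. -/
theorem coe_ofFn_eq_univ_iff {N k : ℕ} {w : Fin k → Fin N} :
    (List.ofFn w : Multiset (Fin N)) = Finset.univ.val ↔ Function.Bijective w := by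
  have hu : (Finset.univ.val : Multiset (Fin N)) = (List.finRange N : Multiset (Fin N)) := rfl
  rw [hu, Multiset.coe_eq_coe]
  constructor
  · intro h
    refine ⟨List.nodup_ofFn.1 (h.nodup_iff.2 (List.nodup_finRange N)), fun i => ?_⟩
    exact (List.mem_ofFn' w i).1 (h.mem_iff.2 (List.mem_finRange i))
  · intro h
    refine (List.perm_ext_iff_of_nodup (List.nodup_ofFn.2 h.1) (List.nodup_finRange N)).2 ?_
    intro i
    simpa [List.mem_ofFn] using h.2 i

open scoped Classical in
/-- The operation with given value on the word `x₁ ⋯ x_N`. -/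
def ret {N n : ℕ} : FreePow P (Fin N) n →ₗ[R] P.Hom N n :=
  lift (fun _ w => if h : Function.Bijective w then
      P.comp (P.perm (Equiv.ofBijective w h).symm) else 0)
    (fun k l e w x => by
      -- Bijectivity of a word is unaffected by permuting its positions, so discarding the other
      -- words respects the relations.
      by_cases h : Function.Bijective w
      · have h' : Function.Bijective (w ∘ e) := h.comp e.bijective
        rw [dif_pos h, dif_pos h', ← P.comp_assoc, ← P.perm_trans]
        congr 3
        ext i
        have hw := (Equiv.ofBijective (w ∘ e) h').apply_symm_apply i
        have hw' := (Equiv.ofBijective w h).apply_symm_apply i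
        exact congrArg Fin.val (h.1 (hw.trans hw'.symm))
      · have h' : ¬ Function.Bijective (w ∘ e) := fun h' =>
          h (by simpa [Function.comp_assoc] using h'.comp e.symm.bijective)
        rw [dif_neg h, dif_neg h']
        rfl)

theorem ret_mk_of_bijective {N n k : ℕ} {w : Fin k → Fin N} (h : Function.Bijective w)
    (x : P.Hom k n) :
    ret (mk w x) = P.comp (P.perm (Equiv.ofBijective w h).symm) x := by
  rw [ret, lift_mk, dif_pos h]

theorem ret_mk_of_not_bijective {N n k : ℕ} {w : Fin k → Fin N} (h : ¬ Function.Bijective w)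
    (x : P.Hom k n) : ret (mk w x) = 0 := by
  rw [ret, lift_mk, dif_neg h]
  rfl

/-- An operation is determined by its value on the generic word, so identities between operations
may be checked on elements of the free algebra. -/
theorem ret_mk_id {N n : ℕ} (x : P.Hom N n) : ret (mk id x) = x := by
  rw [ret_mk_of_bijective Function.bijective_id]
  convert P.id_comp x using 4
  exact Equiv.ext fun i => (Equiv.symm_apply_eq _).2 rfl

theorem ret_eq_zero {N n : ℕ} {d : Multiset (Fin N)} (hd : d ≠ Finset.univ.val)
    {z : FreePow P (Fin N) n} (hz : z ∈ contentPart P d n) : ret z = 0 := by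
  have h : contentPart P d n ≤ LinearMap.ker (ret (P := P) (n := n) (N := N)) := by
    rw [contentPart, Submodule.span_le]
    rintro _ ⟨k, w, x, hw, rfl⟩
    exact ret_mk_of_not_bijective (fun h => hd (hw ▸ coe_ofFn_eq_univ_iff.2 h)) x
  exact h hz

/-! ### Functoriality -/

section Map

variable {S : Type u} [CommRing S] {σ : R →+* S} {Q : LinProp.{u, u} S}

/-- The map of tensor powers induced by a morphism of props. -/
def map (θ : PropHom σ P Q) (n : ℕ) : FreePow P ι n →+ FreePow Q ι n :=
  -- With the target viewed as an `R`-module along `σ`, the linear universal property produces the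
  -- semilinear map.
  letI : Module R (FreePow Q ι n) := Module.compHom _ σ
  (lift (Z := FreePow Q ι n) (fun k w =>
    { toFun := fun x => mk w (θ.app k n x)
      map_add' := fun x y => by rw [map_add, map_add]
      map_smul' := fun r x => by
        rw [LinearMap.map_smulₛₗ, map_smul]
        rfl })
    (fun k l e w x => by
      change mk (w ∘ e) (θ.app k n _) = mk w (θ.app l n x)
      rw [θ.map_comp, θ.map_perm, mk_perm])).toAddMonoidHom

@[simp] theorem map_mk (θ : PropHom σ P Q) {k n : ℕ} (w : Fin k → ι) (x : P.Hom k n) :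
    map θ n (mk w x) = mk w (θ.app k n x) := by
  let _ : Module R (FreePow Q ι n) := Module.compHom _ σ
  simp only [map, LinearMap.toAddMonoidHom_coe]
  rw [lift_mk]
  rfl

theorem map_act (θ : PropHom σ P Q) {n m : ℕ} (z : FreePow P ι n) (y : P.Hom n m) :
    map θ m (act z y) = act (map θ n z) (θ.app n m y) := by
  induction z using FreePow.induction with
  | zero => simp
  | add y z hy hz => simp only [map_add, LinearMap.add_apply, hy, hz]
  | mk w x => simp [θ.map_comp]

theorem map_tens (θ : PropHom σ P Q) {n m : ℕ} (y : FreePow P ι n) (z : FreePow P ι m) :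
    map θ (n + m) (tens y z) = tens (map θ n y) (map θ m z) := by
  induction y using FreePow.induction with
  | zero => simp
  | add y z hy hz => simp only [map_add, LinearMap.add_apply, hy, hz]
  | mk w x =>
  induction z using FreePow.induction with
  | zero => simp
  | add y z hy hz => simp only [map_add, hy, hz]
  | mk w' x' => simp [θ.map_tens]

theorem map_nil (θ : PropHom σ P Q) : map θ 0 (nil P ι) = nil Q ι := by
  rw [nil, map_mk, θ.map_perm]
  rfl

theorem map_var (θ : PropHom σ P Q) (i : ι) : map θ 1 (var P i) = var Q i := by
  rw [var, map_mk, θ.map_perm]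
  rfl

theorem map_tensN (θ : PropHom σ P Q) {n : ℕ} (f : Fin n → FreePow P ι 1) :
    map θ n (tensN f) = tensN (fun i => map θ 1 (f i)) := by
  induction n with
  | zero => exact map_nil θ
  | succ n ih =>
    rw [tensN_succ, tensN_succ, map_tens, ih]
    rfl

theorem ret_map (θ : PropHom σ P Q) {N n : ℕ} (z : FreePow P (Fin N) n) :
    ret (map θ n z) = θ.app N n (ret z) := by
  induction z using FreePow.induction with
  | zero => simp
  | add y z hy hz => simp only [map_add, hy, hz]
  | mk w x =>
    by_cases h : Function.Bijective w
    · rw [map_mk, ret_mk_of_bijective h, ret_mk_of_bijective h, θ.map_comp, θ.map_perm]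
    · rw [map_mk, ret_mk_of_not_bijective h, ret_mk_of_not_bijective h, map_zero]

end Map

end FreePow

end FreePow

/-! ### Products of iterated brackets -/

section LieComb

variable {R : Type*} [CommRing R] {A : Type*} {ι : Type*}

section Module

variable [AddCommGroup A] [Module R A]

/-- The iterated bracket `[⋯[[x_i, x_{j₁}], x_{j₂}], ⋯, x_{j_r}]`, for `v = (i, [j₁, …, j_r])`. -/
def lieComb (br : A →ₗ[R] A →ₗ[R] A) (x : ι → A) (v : ι × List ι) : A :=
  v.2.foldl (fun z j => br z (x j)) (x v.1)

@[simp] theorem lieComb_nil (br : A →ₗ[R] A →ₗ[R] A) (x : ι → A) (i : ι) :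
    lieComb br x (i, []) = x i := rfl

@[simp] theorem lieComb_concat (br : A →ₗ[R] A →ₗ[R] A) (x : ι → A) (i j : ι) (l : List ι) :
    lieComb br x (i, l ++ [j]) = br (lieComb br x (i, l)) (x j) := by
  simp [lieComb]

/-- The product of iterated brackets. -/
def combProd (mu br : A →ₗ[R] A →ₗ[R] A) (e : A) (x : ι → A) (V : List (ι × List ι)) : A :=
  V.foldr (fun v z => mu (lieComb br x v) z) e

/-- Each nested bracket contributes one factor `c`. With `c = ħ⁻¹` this is the origin of the
negative powers of `ħ` in the image. -/
theorem lieComb_smul (c : R) (br : A →ₗ[R] A →ₗ[R] A) (x : ι → A) (v : ι × List ι) :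
    lieComb (c • br) x v = c ^ v.2.length • lieComb br x v := by
  obtain ⟨i, l⟩ := v
  induction l using List.reverseRecOn with
  | nil => simp
  | append_singleton l j ih => simp [ih, smul_smul, pow_succ, mul_comm]

/-- The number of brackets in a product of iterated brackets. -/
def bracketCount (V : List (ι × List ι)) : ℕ := (V.map fun v => v.2.length).sum

theorem combProd_smul (c : R) (mu br : A →ₗ[R] A →ₗ[R] A) (e : A) (x : ι → A)
    (V : List (ι × List ι)) :
    combProd mu (c • br) e x V = c ^ bracketCount V • combProd mu br e x V := by
  induction V with
  | nil => simp [combProd, bracketCount]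
  | cons v V ih =>
    simp only [combProd, bracketCount, List.foldr_cons, List.map_cons, List.sum_cons] at ih ⊢
    rw [ih, lieComb_smul]
    simp [smul_smul, pow_add, mul_comm]

/-- The word underlying a product of iterated brackets. -/
def blockWord (V : List (ι × List ι)) : List ι := V.flatMap fun v => v.1 :: v.2

/-- Each block contributes its first letter and one further letter per bracket. In the multilinear
case this count becomes the exponent `k - N`. -/
theorem length_blockWord (V : List (ι × List ι)) :
    (blockWord V).length = V.length + bracketCount V := by
  induction V with
  | nil => rfl
  | cons v V ih =>
    simp only [blockWord, bracketCount, List.flatMap_cons, List.length_append, List.length_cons,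
      List.map_cons, List.sum_cons] at ih ⊢
    omega

/-- A product of iterated brackets is standard if the first letter of every bracket is minimal in
it and these letters decrease. -/
def IsStandard [LinearOrder ι] (V : List (ι × List ι)) : Prop :=
  (∀ v ∈ V, ∀ j ∈ v.2, v.1 ≤ j) ∧ V.Pairwise fun v v' => v'.1 ≤ v.1

end Module

variable [Ring A] [Algebra R A]

theorem combProd_mul (br : A →ₗ[R] A →ₗ[R] A) (x : ι → A) (V : List (ι × List ι)) :
    combProd (LinearMap.mul R A) br 1 x V = (V.map (lieComb br x)).prod := by
  induction V with
  | nil => rfl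
  | cons v V ih => simpa [combProd] using congrArg (lieComb br x v * ·) ih

/-- A Lie bracket satisfying the Leibniz rule and proportional to the commutator, up to the
factor `h`. -/
structure IsQuasiPoisson (h : R) (br : A →ₗ[R] A →ₗ[R] A) : Prop where
  skew : ∀ a b, br a b = -br b a
  jacobi : ∀ a b c, br (br a b) c + br (br b c) a + br (br c a) b = 0
  leibniz : ∀ a b c, br (a * b) c = a * br b c + br a c * b
  comm : ∀ a b, a * b - b * a = h • br a b

namespace IsQuasiPoisson

variable {h : R} {br : A →ₗ[R] A →ₗ[R] A} (H : IsQuasiPoisson h br) (x : ι → A)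
include H

/-- Jacobi in the form that trades a bracket nested on the right for brackets nested on the left. -/
theorem br_br (a b c : A) : br a (br b c) = br (br a b) c - br (br a c) b := by
  have h1 := H.jacobi a b c
  rw [H.skew (br b c) a, H.skew c a, map_neg, LinearMap.neg_apply] at h1
  have h2 : br (br a b) c - br (br a c) b - br a (br b c) = 0 := by rw [← h1]; abel
  exact (sub_eq_zero.1 h2).symm

theorem br_mul (a b c : A) : br a (b * c) = b * br a c + br a b * c := by
  rw [H.skew, H.leibniz, H.skew c a, H.skew b a]
  simp [add_comm]

/-- A submodule stable under brackets with some letters is stable under brackets with all iterated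
brackets of these letters. -/
theorem br_lieComb_mem (E : Submodule R A) (p : ι → Prop)
    (hE : ∀ a ∈ E, ∀ j, p j → br a (x j) ∈ E) {v : ι × List ι} (hv : p v.1)
    (hv' : ∀ j ∈ v.2, p j) {a : A} (ha : a ∈ E) : br a (lieComb br x v) ∈ E := by
  obtain ⟨i, l⟩ := v
  induction l using List.reverseRecOn generalizing a with
  | nil => exact hE a ha i hv
  | append_singleton l j ih =>
    have hj : p j := hv' j (by simp)
    have hl : ∀ k ∈ l, p k := fun k hk => hv' k (by simp [hk])
    -- `[a, [z, x_j]] = [[a, z], x_j] - [[a, x_j], z]`: both terms are covered by the induction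
    -- hypothesis for the shorter bracket `z`, which is why `a` is generalized.
    rw [lieComb_concat, H.br_br]
    exact E.sub_mem (hE _ (ih ha hv hl) j hj) (ih (hE a ha j hj) hv hl)

variable (br) in
omit H in
/-- The span of the iterated brackets of the letters. -/
def combSpan : Submodule R A := Submodule.span R (Set.range (lieComb br x))

omit H in
theorem br_letter_mem_combSpan {a : A} (ha : a ∈ combSpan br x) (j : ι) :
    br a (x j) ∈ combSpan br x := by
  have h : combSpan br x ≤ (combSpan br x).comap (br.flip (x j)) := by
    rw [combSpan, Submodule.span_le]
    rintro _ ⟨⟨i, l⟩, rfl⟩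
    exact Submodule.subset_span ⟨(i, l ++ [j]), by simp⟩
  exact h ha

/-- Left-normed brackets span a Lie subalgebra: their span is stable under brackets with letters,
and `br_lieComb_mem` extends this to brackets with all left-normed brackets. -/
theorem br_mem_combSpan {a b : A} (ha : a ∈ combSpan br x) (hb : b ∈ combSpan br x) :
    br a b ∈ combSpan br x := by
  have h : combSpan br x ≤ (combSpan br x).comap (br a) := by
    conv_lhs => rw [combSpan]
    rw [Submodule.span_le]
    rintro _ ⟨v, rfl⟩
    exact H.br_lieComb_mem x (combSpan br x) (fun _ => True)
      (fun a ha j _ => br_letter_mem_combSpan x ha j) trivial (fun _ _ => trivial) ha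
  exact h hb

/-- It suffices that the right-hand span be stable under bracketing with a letter `x_j`. If `j` is
at least the first letter, `j` is appended; if it is smaller, skew symmetry brings `x_j` to the
front and the old bracket is unfolded behind it. -/
theorem combSpan_le_span_min [LinearOrder ι] :
    combSpan br x ≤ Submodule.span R (lieComb br x '' {v | ∀ j ∈ v.2, v.1 ≤ j}) := by
  set L := Submodule.span R (lieComb br x '' {v : ι × List ι | ∀ j ∈ v.2, v.1 ≤ j}) with hL
  have key : ∀ a ∈ L, ∀ j, br a (x j) ∈ L := by
    intro a ha j
    have h : L ≤ L.comap (br.flip (x j)) := by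
      conv_lhs => rw [hL]
      rw [Submodule.span_le]
      rintro _ ⟨⟨i, l⟩, hv, rfl⟩
      rw [SetLike.mem_coe, Submodule.mem_comap, LinearMap.flip_apply]
      rcases le_or_gt i j with hij | hij
      · refine Submodule.subset_span ⟨(i, l ++ [j]), ?_, by simp⟩
        intro k hk
        rcases List.mem_append.1 hk with hk | hk
        · exact hv k hk
        · rw [List.mem_singleton.1 hk]
          exact hij
      -- Here `j` lies below every letter of the bracket. `E` collects the brackets that start with
      -- `x_j` and continue with letters at least `j`; it contains `x_j` and is stable under
      -- bracketing with those letters.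
      · set E := Submodule.span R (lieComb br x '' {v : ι × List ι | v.1 = j ∧ ∀ k ∈ v.2, j ≤ k})
          with hE
        have hEL : E ≤ L := by
          apply Submodule.span_mono
          apply Set.image_mono
          rintro v ⟨rfl, hv⟩
          exact hv
        rw [H.skew]
        refine L.neg_mem (hEL ?_)
        refine H.br_lieComb_mem x E (fun k => j ≤ k) ?_ hij.le (fun k hk => hij.le.trans (hv k hk))
          (Submodule.subset_span ⟨(j, []), by simp, rfl⟩)
        intro a ha k hk
        have h' : E ≤ E.comap (br.flip (x k)) := by
          conv_lhs => rw [hE]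
          rw [Submodule.span_le]
          rintro _ ⟨⟨i', l'⟩, ⟨rfl, hv'⟩, rfl⟩
          refine Submodule.subset_span ⟨(i', l' ++ [k]), ⟨rfl, ?_⟩, by simp⟩
          intro m hm
          rcases List.mem_append.1 hm with hm | hm
          · exact hv' m hm
          · rw [List.mem_singleton.1 hm]
            exact hk
        exact h' ha
    exact h ha
  rw [combSpan, Submodule.span_le]
  rintro _ ⟨⟨i, l⟩, rfl⟩
  induction l using List.reverseRecOn with
  | nil => exact Submodule.subset_span ⟨(i, []), by simp, rfl⟩
  | append_singleton l j ih =>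
    rw [lieComb_concat]
    exact key _ ih j

variable (br) in
omit H in
/-- The span of the products of at most `k` iterated brackets with minimal first letter. -/
def prodSpan [LinearOrder ι] (k : ℕ) : Submodule R A :=
  Submodule.span R {a | ∃ V : List (ι × List ι), (∀ v ∈ V, ∀ j ∈ v.2, v.1 ≤ j) ∧ V.length ≤ k ∧
    a = (V.map (lieComb br x)).prod}

omit H in
theorem comb_mul_mem_prodSpan [LinearOrder ι] {k : ℕ} {v : ι × List ι} (hv : ∀ j ∈ v.2, v.1 ≤ j)
    {a : A} (ha : a ∈ prodSpan br x k) : lieComb br x v * a ∈ prodSpan br x (k + 1) := by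
  have h : prodSpan br x k ≤
      (prodSpan br x (k + 1)).comap (LinearMap.mulLeft R (lieComb br x v)) := by
    rw [prodSpan, Submodule.span_le]
    rintro _ ⟨V, hV, hk, rfl⟩
    refine Submodule.subset_span ⟨v :: V, ?_, by simpa using hk, by simp⟩
    exact List.forall_mem_cons.2 ⟨hv, hV⟩
  exact h ha

theorem combSpan_mul_mem_prodSpan [LinearOrder ι] {k : ℕ} {a b : A} (ha : a ∈ combSpan br x)
    (hb : b ∈ prodSpan br x k) : a * b ∈ prodSpan br x (k + 1) := by
  have h : combSpan br x ≤ (prodSpan br x (k + 1)).comap (LinearMap.mulRight R b) := by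
    refine (H.combSpan_le_span_min x).trans ?_
    rw [Submodule.span_le]
    rintro _ ⟨v, hv, rfl⟩
    exact comb_mul_mem_prodSpan x hv hb
  exact h ha

omit H in
theorem lieComb_mem_combSpan (v : ι × List ι) : lieComb br x v ∈ combSpan br x :=
  Submodule.subset_span ⟨v, rfl⟩

/-- An adjacent exchange changes the product by `h` times a product in which two factors have been
merged into one Lie element. A general permutation is a chain of such exchanges. -/
theorem prod_sub_prod_mem [LinearOrder ι] {V V' : List (ι × List ι)} (hp : V.Perm V')
    (hV : ∀ v ∈ V, ∀ j ∈ v.2, v.1 ≤ j) :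
    (V.map (lieComb br x)).prod - (V'.map (lieComb br x)).prod ∈
      prodSpan br x (V.length - 1) := by
  induction hp with
  | nil => simp
  | @cons v V V' hp ih =>
    -- The singleton is separated because the truncated `V.length - 1` would not grow by one when a
    -- factor is put in front of the empty list.
    rcases V with _ | ⟨w, V⟩
    · rw [List.nil_perm.1 hp]
      simp
    · have h1 := ih fun v hv => hV v (List.mem_cons_of_mem _ hv)
      have h2 := comb_mul_mem_prodSpan x (hV v (by simp)) h1
      rw [List.map_cons, List.prod_cons, List.map_cons (l := V'), List.prod_cons, ← mul_sub]
      simpa using h2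
  | swap v w V =>
    simp only [List.map_cons, List.prod_cons, List.length_cons, Nat.add_sub_cancel]
    -- The commutator of the two exchanged factors is `h` times their bracket, which lies in the
    -- span of left-normed brackets.
    rw [← mul_assoc, ← mul_assoc, ← sub_mul, H.comm, smul_mul_assoc]
    refine Submodule.smul_mem _ _ ?_
    refine H.combSpan_mul_mem_prodSpan x (H.br_mem_combSpan x (lieComb_mem_combSpan x w)
      (lieComb_mem_combSpan x v)) (Submodule.subset_span ⟨V, ?_, le_rfl, rfl⟩)
    exact fun u hu => hV u (by simp [hu])
  | @trans V V' V'' hp hp' ih ih' =>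
    rw [← sub_add_sub_cancel _ (V'.map (lieComb br x)).prod]
    refine add_mem (ih hV) ?_
    rw [hp.length_eq]
    exact ih' fun v hv => hV v (hp.mem_iff.2 hv)

variable (br) in
omit H in
/-- The span of the standard products of iterated brackets. -/
def standardSpan [LinearOrder ι] : Submodule R A :=
  Submodule.span R {a | ∃ V : List (ι × List ι), IsStandard V ∧ a = (V.map (lieComb br x)).prod}

/-- Sorting the factors by decreasing first letter changes a product only by products with fewer
factors, which induction handles. -/
theorem prodSpan_le_standardSpan [LinearOrder ι] (k : ℕ) :
    prodSpan br x k ≤ standardSpan br x := by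
  induction k with
  | zero =>
    rw [prodSpan, Submodule.span_le]
    rintro _ ⟨V, hV, hk, rfl⟩
    obtain rfl : V = [] := by simpa using hk
    exact Submodule.subset_span ⟨[], ⟨by simp, by simp⟩, rfl⟩
  | succ k ih =>
    rw [prodSpan, Submodule.span_le]
    rintro _ ⟨V, hV, hk, rfl⟩
    set r : ι × List ι → ι × List ι → Prop := fun v v' => v'.1 ≤ v.1
    have hp := List.perm_insertionSort r V
    have h1 := H.prod_sub_prod_mem x hp.symm hV
    have h2 : prodSpan br x (V.length - 1) ≤ prodSpan br x k := by
      apply Submodule.span_mono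
      rintro _ ⟨V', h, h', rfl⟩
      exact ⟨V', h, by omega, rfl⟩
    rw [← sub_add_cancel (V.map (lieComb br x)).prod
      ((V.insertionSort r).map (lieComb br x)).prod]
    refine add_mem (ih (h2 h1)) (Submodule.subset_span ⟨_, ⟨?_, ?_⟩, rfl⟩)
    · exact fun v hv => hV v (hp.mem_iff.1 hv)
    · have : Std.Total r := ⟨fun v v' => le_total _ _⟩
      have : IsTrans _ r := ⟨fun _ _ _ h h' => le_trans h' h⟩
      exact List.pairwise_insertionSort r V

variable (br) in
omit H in
/-- The subalgebra generated by the iterated brackets of the letters. -/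
def combAlg : Subalgebra R A := Algebra.adjoin R (Set.range (lieComb br x))

omit H in
theorem combSpan_le_combAlg : combSpan br x ≤ (combAlg br x).toSubmodule :=
  Submodule.span_le.2 Algebra.subset_adjoin

theorem combAlg_le_standardSpan [LinearOrder ι] :
    (combAlg br x).toSubmodule ≤ standardSpan br x := by
  rw [combAlg, Algebra.adjoin_eq_span, Submodule.span_le]
  intro a ha
  obtain ⟨l, hl, rfl⟩ := Submonoid.exists_list_of_mem_closure ha
  have h : ∀ l : List A, (∀ y ∈ l, y ∈ Set.range (lieComb br x)) →
      l.prod ∈ prodSpan br x l.length := by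
    intro l hl
    induction l with
    | nil => exact Submodule.subset_span ⟨[], by simp, by simp, by simp⟩
    | cons y l ih =>
      rw [List.prod_cons]
      refine H.combSpan_mul_mem_prodSpan x (Submodule.subset_span (hl y (by simp)))
        (ih fun z hz => hl z (by simp [hz]))
  exact H.prodSpan_le_standardSpan x _ (h l hl)

/-- Bracketing is a derivation in each argument, so closure on the algebra generators, known from
`br_mem_combSpan`, extends to the subalgebra they generate. This subalgebra is therefore stable
under all of `η`, `m` and the bracket. -/
theorem br_mem_combAlg {a b : A} (ha : a ∈ combAlg br x) (hb : b ∈ combAlg br x) :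
    br a b ∈ combAlg br x := by
  -- The Leibniz rule for `1 * 1` reads `{1, c} = {1, c} + {1, c}`.
  have br_one : ∀ c, br 1 c = 0 := fun c => by simpa using H.leibniz 1 1 c
  have h1 : ∀ y ∈ combSpan br x, ∀ a ∈ combAlg br x, br a y ∈ combAlg br x := by
    intro y hy a ha
    induction ha using Algebra.adjoin_induction with
    | mem a ha => exact combSpan_le_combAlg x (H.br_mem_combSpan x (Submodule.subset_span ha) hy)
    | algebraMap r =>
      rw [Algebra.algebraMap_eq_smul_one, map_smul, LinearMap.smul_apply, br_one, smul_zero]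
      exact zero_mem _
    | add a b _ _ ha hb =>
      rw [map_add, LinearMap.add_apply]
      exact add_mem ha hb
    | mul a b ha' hb' ha hb =>
      rw [H.leibniz]
      exact add_mem (mul_mem ha' hb) (mul_mem ha hb')
  induction hb using Algebra.adjoin_induction with
  | mem b hb => exact h1 b (Submodule.subset_span hb) a ha
  | algebraMap r =>
    rw [Algebra.algebraMap_eq_smul_one, map_smul, H.skew, br_one, neg_zero, smul_zero]
    exact zero_mem _
  | add b c _ _ hb hc =>
    rw [map_add]
    exact add_mem hb hc
  | mul b c hb' hc' hb hc =>
    rw [H.br_mul]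
    exact add_mem (mul_mem hb' hc) (mul_mem hb hc')

end IsQuasiPoisson

end LieComb

/-! ### The free algebra over a prop of algebras -/

section FreeAlg

variable {R : Type u} [CommRing R] {P : LinProp.{u, u} R} {ι : Type}

namespace FreePow

/-- The binary operation on the free algebra given by an operation with two inputs. -/
def op (c : P.Hom 2 1) : FreePow P ι 1 →ₗ[R] FreePow P ι 1 →ₗ[R] FreePow P ι 1 :=
  (tens (n := 1) (m := 1)).compr₂ (act.flip c)

theorem op_apply (c : P.Hom 2 1) (a b : FreePow P ι 1) :
    op c a b = act (tens a b : FreePow P ι (1 + 1)) c := rfl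

variable (ι) in
/-- The element of the free algebra given by an operation without inputs. -/
def unit (e : P.Hom 0 1) : FreePow P ι 1 := act (nil P ι) e

theorem op_smul (r : R) (c : P.Hom 2 1) : (op (r • c) : FreePow P ι 1 →ₗ[R] _) = r • op c := by
  ext a b
  simp [op_apply]

theorem act_tensN_two (f : Fin 2 → FreePow P ι 1) (c : P.Hom 2 1) :
    act (tensN f) c = op c (f 0) (f 1) := by
  rw [tensN_two]
  rfl

theorem act_tensN_comp_perm {n m k : ℕ} (f : Fin n → FreePow P ι 1) (e : Fin n ≃ Fin m)
    (y : P.Hom m k) : act (tensN f) (P.comp (P.perm e) y) = act (tensN (f ∘ e.symm)) y := by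
  rw [← act_act, act_tensN_perm]

theorem act_nestLeft (c d : P.Hom 2 1) (f : Fin 3 → FreePow P ι 1) :
    act (tensN f) (P.comp (P.tens c (P.perm (Equiv.refl (Fin 1))) : P.Hom (2 + 1) (1 + 1)) d) =
      op d (op c (f 0) (f 1)) (f 2) := by
  rw [← act_act, op_apply]
  refine congrArg (fun z => act z d) ?_
  have h := act_tens (tens (f 0) (f 1) : FreePow P ι (1 + 1)) (f 2) c
    (P.perm (Equiv.refl (Fin 1)))
  rw [act_id] at h
  rw [tensN_three]
  exact h

theorem act_nestRight (c d : P.Hom 2 1) (f : Fin 3 → FreePow P ι 1) :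
    act (tensN f) (P.comp (P.tens (P.perm (Equiv.refl (Fin 1))) c : P.Hom (1 + 2) (1 + 1)) d) =
      op d (f 0) (op c (f 1) (f 2)) := by
  rw [← act_act, op_apply]
  refine congrArg (fun z => act z d) ?_
  have h := act_tens (f 0) (tens (f 1) (f 2) : FreePow P ι (1 + 1))
    (P.perm (Equiv.refl (Fin 1))) c
  rw [act_id] at h
  have h' := tensN_eq_tens (n := 1) (m := 2) f
  rw [tensN_one, tensN_two] at h'
  rw [h']
  exact h

theorem act_unitLeft (e : P.Hom 0 1) (d : P.Hom 2 1) (a : FreePow P ι 1) :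
    act a (P.comp (P.tens e (P.perm (Equiv.refl (Fin 1))) : P.Hom (0 + 1) (1 + 1)) d) =
      op d (unit ι e) a := by
  rw [← act_act, op_apply]
  refine congrArg (fun z => act z d) ?_
  have h := act_tens (nil P ι) a e (P.perm (Equiv.refl (Fin 1)))
  rw [act_id, nil_tens_one] at h
  exact h

theorem act_unitRight (e : P.Hom 0 1) (d : P.Hom 2 1) (a : FreePow P ι 1) :
    act a (P.comp (P.tens (P.perm (Equiv.refl (Fin 1))) e : P.Hom (1 + 0) (1 + 1)) d) =
      op d a (unit ι e) := by
  rw [← act_act, op_apply]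
  refine congrArg (fun z => act z d) ?_
  have h := act_tens a (nil P ι) (P.perm (Equiv.refl (Fin 1))) e
  have h' := tensN_append (fun _ : Fin 1 => a) (Fin.elim0 : Fin 0 → FreePow P ι 1)
  rw [tensN_one (fun _ : Fin 1 => a)] at h'
  have h'' : tensN (Fin.append (fun _ : Fin 1 => a) (Fin.elim0 : Fin 0 → FreePow P ι 1)) =
      (a : FreePow P ι (1 + 0)) := tensN_one _
  rw [act_id] at h
  have h3 : (a : FreePow P ι (1 + 0)) = tens a (nil P ι) := h''.symm.trans h'
  exact (congrArg (fun z => act z (P.tens (P.perm (Equiv.refl (Fin 1))) e)) h3).trans h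

/-- Both sides equal the values on the generic word, from which `ret` recovers the operations.
Relations in a prop are verified through this criterion. -/
theorem eq_of_act_var {k n : ℕ} {x y : P.Hom k n}
    (h : act (tensN (var P : Fin k → FreePow P (Fin k) 1)) x =
      act (tensN (var P : Fin k → FreePow P (Fin k) 1)) y) : x = y := by
  have h1 : tensN (var P : Fin k → FreePow P (Fin k) 1) = mk id (P.perm (Equiv.refl _)) :=
    tensN_var id
  rw [h1, act_mk, act_mk, P.id_comp, P.id_comp] at h
  rw [← ret_mk_id x, h, ret_mk_id]

/-- Products of iterated brackets, one for every output. -/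
def lieMon (e : P.Hom 0 1) (m b : P.Hom 2 1) {n : ℕ} (V : Fin n → List (ι × List ι)) :
    FreePow P ι n :=
  tensN fun j => combProd (op m) (op b) (unit ι e) (var P) (V j)

theorem lieComb_mem_contentPart (b : P.Hom 2 1) (v : ι × List ι) :
    lieComb (op b) (var P) v ∈ contentPart P (v.1 :: v.2 : List ι) 1 := by
  obtain ⟨i, l⟩ := v
  induction l using List.reverseRecOn with
  | nil => exact var_mem_contentPart i
  | append_singleton l j ih =>
    rw [lieComb_concat, op_apply]
    have h := act_mem_contentPart (tens_mem_contentPart ih (var_mem_contentPart j)) b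
    have h' : ((i :: l : List ι) : Multiset ι) + {j} = (i :: (l ++ [j]) : List ι) := by
      rw [← Multiset.coe_singleton, Multiset.coe_add]
      rfl
    rw [h'] at h
    exact h

theorem combProd_mem_contentPart (e : P.Hom 0 1) (m b : P.Hom 2 1) (V : List (ι × List ι)) :
    combProd (op m) (op b) (unit ι e) (var P) V ∈ contentPart P (blockWord V) 1 := by
  induction V with
  | nil => exact act_mem_contentPart nil_mem_contentPart e
  | cons v V ih =>
    have h := act_mem_contentPart (tens_mem_contentPart (lieComb_mem_contentPart b v) ih) m
    rw [Multiset.coe_add] at h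
    exact h

theorem lieMon_mem_contentPart (e : P.Hom 0 1) (m b : P.Hom 2 1) {n : ℕ}
    (V : Fin n → List (ι × List ι)) :
    lieMon e m b V ∈ contentPart P (∑ j, (blockWord (V j) : Multiset ι)) n :=
  tensN_mem_contentPart fun j => combProd_mem_contentPart e m b (V j)

theorem lieMon_smul (r : R) (e : P.Hom 0 1) (m b : P.Hom 2 1) {n : ℕ}
    (V : Fin n → List (ι × List ι)) :
    lieMon e m (r • b) V = r ^ (∑ j, bracketCount (V j)) • lieMon e m b V := by
  simp only [lieMon, op_smul, combProd_smul]
  rw [← Finset.prod_pow_eq_pow_sum]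
  exact (tensNHom P ι n).map_smul_univ (fun j => r ^ bracketCount (V j)) _

section Map

variable {S : Type u} [CommRing S] {σ : R →+* S} {Q : LinProp.{u, u} S}

theorem map_op (θ : PropHom σ P Q) (c : P.Hom 2 1) (a b : FreePow P ι 1) :
    map θ 1 (op c a b) = op (θ.app 2 1 c) (map θ 1 a) (map θ 1 b) := by
  rw [op_apply, op_apply, map_act]
  exact congrArg (fun z => act z (θ.app 2 1 c)) (map_tens θ a b)

theorem map_lieComb (θ : PropHom σ P Q) (b : P.Hom 2 1) (v : ι × List ι) :
    map θ 1 (lieComb (op b) (var P) v) = lieComb (op (θ.app 2 1 b)) (var Q) v := by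
  obtain ⟨i, l⟩ := v
  induction l using List.reverseRecOn with
  | nil => exact map_var θ i
  | append_singleton l j ih => rw [lieComb_concat, lieComb_concat, map_op, ih, map_var]

theorem map_combProd (θ : PropHom σ P Q) (e : P.Hom 0 1) (m b : P.Hom 2 1)
    (V : List (ι × List ι)) :
    map θ 1 (combProd (op m) (op b) (unit ι e) (var P) V) =
      combProd (op (θ.app 2 1 m)) (op (θ.app 2 1 b)) (unit ι (θ.app 0 1 e)) (var Q) V := by
  induction V with
  | nil =>
    change map θ 1 (act (nil P ι) e) = act (nil Q ι) (θ.app 0 1 e)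
    rw [map_act, map_nil]
  | cons v V ih =>
    change map θ 1 (op m (lieComb (op b) (var P) v) _) = op (θ.app 2 1 m) _ _
    rw [map_op, map_lieComb]
    exact congrArg _ ih

theorem map_lieMon (θ : PropHom σ P Q) (e : P.Hom 0 1) (m b : P.Hom 2 1) {n : ℕ}
    (V : Fin n → List (ι × List ι)) :
    map θ n (lieMon e m b V) =
      lieMon (θ.app 0 1 e) (θ.app 2 1 m) (θ.app 2 1 b) V := by
  simp only [lieMon, map_tensN, map_combProd]

end Map

end FreePow

/-- The axioms of a unital associative algebra, for operations of a prop. -/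
structure LinProp.IsAlg (P : LinProp.{u, u} R) (e : P.Hom 0 1) (m : P.Hom 2 1) : Prop where
  assoc : P.comp (P.tens m (P.perm (Equiv.refl (Fin 1))) : P.Hom (2 + 1) (1 + 1)) m =
    P.comp (P.tens (P.perm (Equiv.refl (Fin 1))) m : P.Hom (1 + 2) (1 + 1)) m
  one_mul : P.comp (P.tens e (P.perm (Equiv.refl (Fin 1))) : P.Hom (0 + 1) (1 + 1)) m =
    P.perm (Equiv.refl (Fin 1))
  mul_one : P.comp (P.tens (P.perm (Equiv.refl (Fin 1))) e : P.Hom (1 + 0) (1 + 1)) m =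
    P.perm (Equiv.refl (Fin 1))

namespace LinProp.IsAlg

open FreePow

variable {e : P.Hom 0 1} {m : P.Hom 2 1} (h : P.IsAlg e m)
include h

theorem op_assoc (a b c : FreePow P ι 1) : op m (op m a b) c = op m a (op m b c) := by
  have h1 := act_nestLeft m m ![a, b, c]
  have h2 := act_nestRight m m ![a, b, c]
  rw [h.assoc] at h1
  exact h1.symm.trans h2

theorem unit_op (a : FreePow P ι 1) : op m (unit ι e) a = a := by
  have h1 := act_unitLeft e m a
  rw [h.one_mul, act_id] at h1
  exact h1.symm

theorem op_unit (a : FreePow P ι 1) : op m a (unit ι e) = a := by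
  have h1 := act_unitRight e m a
  rw [h.mul_one] at h1
  exact h1.symm.trans (act_id a)

end LinProp.IsAlg

/-- The free algebra on `ι` over a prop with an algebra structure. -/
@[nolint unusedArguments]
def FreeAlg {e : P.Hom 0 1} {m : P.Hom 2 1} (_ : P.IsAlg e m) (ι : Type) : Type u := FreePow P ι 1

namespace FreeAlg

open FreePow

variable {e : P.Hom 0 1} {m : P.Hom 2 1} (h : P.IsAlg e m)

instance : AddCommGroup (FreeAlg h ι) := inferInstanceAs (AddCommGroup (FreePow P ι 1))

instance : Module R (FreeAlg h ι) := inferInstanceAs (Module R (FreePow P ι 1))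

instance : Ring (FreeAlg h ι) where
  __ := (inferInstance : AddCommGroup (FreeAlg h ι))
  mul a b := op m a b
  one := unit ι e
  left_distrib a b c := map_add (op m a) b c
  right_distrib a b c := LinearMap.map_add₂ (op m) a b c
  zero_mul a := LinearMap.map_zero₂ (op m) a
  mul_zero a := map_zero (op m a)
  mul_assoc := h.op_assoc
  one_mul := h.unit_op
  mul_one := h.op_unit

instance : Algebra R (FreeAlg h ι) :=
  Algebra.ofModule (fun r a b => LinearMap.map_smul₂ (op m) r a b)
    (fun r a b => map_smul (op m a) r b)

/-- A binary operation on the free algebra. -/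
def bin (c : P.Hom 2 1) : FreeAlg h ι →ₗ[R] FreeAlg h ι →ₗ[R] FreeAlg h ι := op c

end FreeAlg

/-- The axioms of a Poisson algebra deformed by the factor `h`: the commutator is `h` times the
bracket. -/
structure LinProp.IsQuasiPoisson (P : LinProp.{u, u} R) (h : R) (e : P.Hom 0 1)
    (m b : P.Hom 2 1) : Prop extends P.IsAlg e m where
  comm : m + (-1 : R) • P.comp (P.perm (Equiv.swap (0 : Fin 2) 1)) m = h • b
  skew : b + P.comp (P.perm (Equiv.swap (0 : Fin 2) 1)) b = 0
  jacobi : P.comp (P.tens b (P.perm (Equiv.refl (Fin 1))) : P.Hom (2 + 1) (1 + 1)) b +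
    (P.comp (P.perm (finRotate 3))
        (P.comp (P.tens b (P.perm (Equiv.refl (Fin 1))) : P.Hom (2 + 1) (1 + 1)) b) +
      P.comp (P.perm ((finRotate 3).trans (finRotate 3)))
        (P.comp (P.tens b (P.perm (Equiv.refl (Fin 1))) : P.Hom (2 + 1) (1 + 1)) b)) = 0
  leibniz : P.comp (P.tens m (P.perm (Equiv.refl (Fin 1))) : P.Hom (2 + 1) (1 + 1)) b =
    P.comp (P.tens (P.perm (Equiv.refl (Fin 1))) b : P.Hom (1 + 2) (1 + 1)) m +
      P.comp (P.perm (Equiv.swap (1 : Fin 3) 2))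
        (P.comp (P.tens b (P.perm (Equiv.refl (Fin 1))) : P.Hom (2 + 1) (1 + 1)) m)

/-! ### The Poisson axioms read on elements of the free algebra. -/

namespace FreePow

theorem act_swap (c : P.Hom 2 1) (f : Fin 2 → FreePow P ι 1) :
    act (tensN f) (P.comp (P.perm (Equiv.swap (0 : Fin 2) 1)) c) = op c (f 1) (f 0) := by
  rw [act_tensN_comp_perm, act_tensN_two]
  rfl

theorem op_commutator {h : R} {m b : P.Hom 2 1}
    (H : m + (-1 : R) • P.comp (P.perm (Equiv.swap (0 : Fin 2) 1)) m = h • b)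
    (x y : FreePow P ι 1) : op m x y - op m y x = h • op b x y := by
  have h1 := congrArg (act (tensN ![x, y])) H
  rw [map_add, map_smul, map_smul, act_swap, act_tensN_two, act_tensN_two, neg_one_smul,
    ← sub_eq_add_neg] at h1
  exact h1

theorem act_jacobi (b : P.Hom 2 1) (f : Fin 3 → FreePow P ι 1) :
    act (tensN f) (P.comp (P.tens b (P.perm (Equiv.refl (Fin 1))) : P.Hom (2 + 1) (1 + 1)) b +
    (P.comp (P.perm (finRotate 3))
        (P.comp (P.tens b (P.perm (Equiv.refl (Fin 1))) : P.Hom (2 + 1) (1 + 1)) b) +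
      P.comp (P.perm ((finRotate 3).trans (finRotate 3)))
        (P.comp (P.tens b (P.perm (Equiv.refl (Fin 1))) : P.Hom (2 + 1) (1 + 1)) b))) =
    op b (op b (f 0) (f 1)) (f 2) + op b (op b (f 1) (f 2)) (f 0) +
      op b (op b (f 2) (f 0)) (f 1) := by
  rw [map_add, map_add, act_nestLeft]
  have h1 := act_tensN_comp_perm f (finRotate 3)
    (P.comp (P.tens b (P.perm (Equiv.refl (Fin 1))) : P.Hom (2 + 1) (1 + 1)) b)
  have h2 := act_tensN_comp_perm f ((finRotate 3).trans (finRotate 3))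
    (P.comp (P.tens b (P.perm (Equiv.refl (Fin 1))) : P.Hom (2 + 1) (1 + 1)) b)
  rw [act_nestLeft] at h1 h2
  -- Permuting inputs by `e` puts the argument numbered `e.symm i` in place `i`; one rotation turns
  -- `(0, 1, 2)` into `(2, 0, 1)` and two turn it into `(1, 2, 0)`.
  have e0 : (finRotate 3).symm 0 = 2 := by decide
  have e1 : (finRotate 3).symm 1 = 0 := by decide
  have e2 : (finRotate 3).symm 2 = 1 := by decide
  simp only [Function.comp_apply, Equiv.symm_trans_apply, e0, e1, e2] at h1 h2
  erw [h1, h2]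
  abel

theorem act_leibniz (m b : P.Hom 2 1) (f : Fin 3 → FreePow P ι 1) :
    act (tensN f) (P.comp (P.tens (P.perm (Equiv.refl (Fin 1))) b : P.Hom (1 + 2) (1 + 1)) m +
      P.comp (P.perm (Equiv.swap (1 : Fin 3) 2))
        (P.comp (P.tens b (P.perm (Equiv.refl (Fin 1))) : P.Hom (2 + 1) (1 + 1)) m)) =
    op m (f 0) (op b (f 1) (f 2)) + op m (op b (f 0) (f 2)) (f 1) := by
  rw [map_add]
  have h1 := act_tensN_comp_perm f (Equiv.swap (1 : Fin 3) 2)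
    (P.comp (P.tens b (P.perm (Equiv.refl (Fin 1))) : P.Hom (2 + 1) (1 + 1)) m)
  rw [act_nestLeft] at h1
  erw [h1, act_nestRight]
  rfl

end FreePow

namespace LinProp.IsQuasiPoisson

open FreePow

variable {h : R} {e : P.Hom 0 1} {m b : P.Hom 2 1} (H : P.IsQuasiPoisson h e m b)
include H

theorem op_skew (x y : FreePow P ι 1) : op b x y = -op b y x := by
  have h1 := congrArg (act (tensN ![x, y])) H.skew
  rw [map_add, act_swap, act_tensN_two, map_zero] at h1
  exact eq_neg_of_add_eq_zero_left h1

theorem op_jacobi (x y z : FreePow P ι 1) :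
    op b (op b x y) z + op b (op b y z) x + op b (op b z x) y = 0 := by
  have h1 := act_jacobi b ![x, y, z]
  rw [H.jacobi, map_zero] at h1
  exact h1.symm

theorem op_leibniz (x y z : FreePow P ι 1) :
    op b (op m x y) z = op m x (op b y z) + op m (op b x z) y := by
  have h1 := act_nestLeft m b ![x, y, z]
  have h2 := act_leibniz m b ![x, y, z]
  rw [H.leibniz] at h1
  exact h1.symm.trans h2

theorem op_comm (x y : FreePow P ι 1) : op m x y - op m y x = h • op b x y :=
  op_commutator H.comm x y

theorem freeAlg : _root_.IsQuasiPoisson h (FreeAlg.bin (ι := ι) H.toIsAlg b) where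
  skew := H.op_skew
  jacobi := H.op_jacobi
  leibniz := H.op_leibniz
  comm := H.op_comm

end LinProp.IsQuasiPoisson

/-- The values of the generators `η`, `m` and of a bracket. -/
def bracketVal (e : P.Hom 0 1) (m b : P.Hom 2 1) : ∀ {n k : ℕ}, BracketGen n k → P.Hom n k
  | _, _, .unit => e
  | _, _, .mul => m
  | _, _, .bracket => b

/-- The standard families of products of iterated brackets in which every letter occurs once. -/
def StandardIdx (N n : ℕ) : Type :=
  {V : Fin n → List (Fin N × List (Fin N)) // (∀ j, IsStandard (V j)) ∧
    ∑ j, (blockWord (V j) : Multiset (Fin N)) = Finset.univ.val}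

/-- The operation given by a product of iterated brackets. -/
def lieOp (e : P.Hom 0 1) (m b : P.Hom 2 1) {N n : ℕ} (V : Fin n → List (Fin N × List (Fin N))) :
    P.Hom N n := FreePow.ret (FreePow.lieMon e m b V)

theorem lieOp_eq_zero (e : P.Hom 0 1) (m b : P.Hom 2 1) {N n : ℕ}
    {V : Fin n → List (Fin N × List (Fin N))}
    (hV : ∑ j, (blockWord (V j) : Multiset (Fin N)) ≠ Finset.univ.val) : lieOp e m b V = 0 :=
  FreePow.ret_eq_zero hV (FreePow.lieMon_mem_contentPart e m b V)

theorem lieOp_smul (r : R) (e : P.Hom 0 1) (m b : P.Hom 2 1) {N n : ℕ}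
    (V : Fin n → List (Fin N × List (Fin N))) :
    lieOp e m (r • b) V = r ^ (∑ j, bracketCount (V j)) • lieOp e m b V := by
  rw [lieOp, FreePow.lieMon_smul, map_smul, lieOp]

/-- `lieOp` is assembled from prop operations only, hence natural. This allows the same family to be
compared in all the props involved. -/
theorem map_lieOp {S : Type u} [CommRing S] {σ : R →+* S} {Q : LinProp.{u, u} S}
    (θ : PropHom σ P Q) (e : P.Hom 0 1) (m b : P.Hom 2 1) {N n : ℕ}
    (V : Fin n → List (Fin N × List (Fin N))) :
    θ.app N n (lieOp e m b V) = lieOp (θ.app 0 1 e) (θ.app 2 1 m) (θ.app 2 1 b) V := by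
  rw [lieOp, lieOp, ← FreePow.map_lieMon, FreePow.ret_map]

open FreePow in
/-- In a prop generated by `η`, `m` and a bracket that satisfy the axioms of a deformed Poisson
algebra, all operations are linear combinations of standard products of iterated brackets. -/
theorem LinProp.IsQuasiPoisson.span_lieOp {h : R} {e : P.Hom 0 1} {m b : P.Hom 2 1}
    (H : P.IsQuasiPoisson h e m b)
    (hgen : ∀ {n k : ℕ} (x : P.Hom n k), ∃ t, PTerm.eval P (bracketVal e m b) t = x) (N n : ℕ) :
    Submodule.span R (Set.range fun V : StandardIdx N n => lieOp e m b V.1) = ⊤ := by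
  rw [eq_top_iff]
  rintro x -
  obtain ⟨t, rfl⟩ := hgen x
  let A := FreeAlg H.toIsAlg (Fin N)
  let br : A →ₗ[R] A →ₗ[R] A := FreeAlg.bin H.toIsAlg b
  let vv : Fin N → A := var P
  -- `O` contains the letters and is stable under the three generators, so `x`, applied to the
  -- generic word, gives a combination of tensor products of elements of `O`, each a combination of
  -- standard products.
  let O : Submodule R A := (_root_.IsQuasiPoisson.combAlg br vv).toSubmodule
  have hvar : ∀ i, vv i ∈ O := fun i => Algebra.subset_adjoin ⟨(i, []), rfl⟩
  have hO : ∀ {n k : ℕ} (a : BracketGen n k) (f : Fin n → FreePow P (Fin N) 1),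
      (∀ i, f i ∈ O) → act (tensN f) (bracketVal e m b a) ∈ tensSpan O k := by
    intro n k a f hf
    cases a with
    | unit => exact mem_tensSpan_one (one_mem (_root_.IsQuasiPoisson.combAlg br vv))
    | mul =>
      rw [bracketVal, act_tensN_two]
      exact mem_tensSpan_one
        (mul_mem (S := Subalgebra R A) (s := _root_.IsQuasiPoisson.combAlg br vv) (hf 0) (hf 1))
    | bracket =>
      rw [bracketVal, act_tensN_two]
      exact mem_tensSpan_one (H.freeAlg.br_mem_combAlg vv (hf 0) (hf 1))
  have h1 := act_eval_mem_tensSpan (bracketVal e m b) hO t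
    (tensN_mem_tensSpan (f := var P) hvar)
  have h2 : O ≤ Submodule.span R {a | ∃ V : List (Fin N × List (Fin N)), IsStandard V ∧
      a = (V.map (lieComb br vv)).prod} := H.freeAlg.combAlg_le_standardSpan vv
  have h3 : tensSpan O n ≤ tensSpan (Submodule.span R {a : A | ∃ V : List (Fin N × List (Fin N)),
      IsStandard V ∧ a = (V.map (lieComb br vv)).prod}) n := by
    apply Submodule.span_mono
    rintro _ ⟨f, hf, rfl⟩
    exact ⟨f, fun i => h2 (hf i), rfl⟩
  have h4 := h3 h1
  rw [tensSpan_span] at h4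
  have h5 : tensN (var P : Fin N → FreePow P (Fin N) 1) = FreePow.mk id (P.perm (Equiv.refl _)) :=
    tensN_var id
  rw [h5, act_mk, P.id_comp] at h4
  have h6 := Submodule.mem_map_of_mem (f := ret) h4
  rw [ret_mk_id, Submodule.map_span] at h6
  refine Submodule.span_le.2 ?_ h6
  rintro _ ⟨_, ⟨f, hf, rfl⟩, rfl⟩
  choose V hV hfV using hf
  have h7 : ret (tensN f) = lieOp e m b V := by
    rw [lieOp, lieMon]
    congr 2
    funext j
    rw [hfV j, ← combProd_mul]
    rfl
  rw [h7]
  -- Families in which a letter is missing or repeated may occur in the free algebra, but `ret`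
  -- kills them.
  by_cases hc : ∑ j, (blockWord (V j) : Multiset (Fin N)) = Finset.univ.val
  · exact Submodule.subset_span ⟨⟨V, hV, hc⟩, rfl⟩
  · rw [lieOp_eq_zero e m b hc]
    exact zero_mem _

end FreeAlg

/-! ### Leading words of products of iterated commutators -/

section Standard

variable {ι : Type*} [LinearOrder ι]

theorem IsStandard.of_cons {v : ι × List ι} {V : List (ι × List ι)} (h : IsStandard (v :: V)) :
    IsStandard V :=
  ⟨fun w hw => h.1 w (List.mem_cons_of_mem _ hw), (List.pairwise_cons.1 h.2).2⟩

theorem IsStandard.head_lt {v : ι × List ι} {V : List (ι × List ι)} (h : IsStandard V)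
    (hn : (blockWord V).Nodup) (hv : v ∈ V) : ∀ j ∈ v.2, v.1 < j := by
  intro j hj
  refine lt_of_le_of_ne (h.1 v hv j hj) ?_
  have hn' := (List.nodup_flatMap.1 hn).1 v hv
  rintro rfl
  exact (List.nodup_cons.1 hn').1 hj

theorem IsStandard.head_blockWord_le {v : ι × List ι} {V : List (ι × List ι)}
    (h : IsStandard (v :: V)) : ∀ j ∈ (blockWord V).head?, j ≤ v.1 := by
  intro j hj
  rcases V with _ | ⟨w, V⟩
  · simp [blockWord] at hj
  · simp only [blockWord, List.flatMap_cons, List.cons_append, List.head?_cons, Option.mem_def,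
      Option.some.injEq] at hj
    rw [← hj]
    exact (List.pairwise_cons.1 h.2).1 w (by simp)

omit [LinearOrder ι] in
-- Both `l` and `l'` are the longest prefix whose letters satisfy `p`.
theorem append_inj_of_pred {p : ι → Prop} {l l' a a' : List ι} (h : l ++ a = l' ++ a')
    (hl : ∀ j ∈ l, p j) (hl' : ∀ j ∈ l', p j) (ha : ∀ j ∈ a.head?, ¬ p j)
    (ha' : ∀ j ∈ a'.head?, ¬ p j) : l = l' ∧ a = a' := by
  rcases List.append_eq_append_iff.1 h with ⟨c, rfl, rfl⟩ | ⟨c, rfl, rfl⟩ <;>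
    rcases c with _ | ⟨j, c⟩
  · simp
  · exact absurd (hl' j (by simp)) (ha j (by simp))
  · simp
  · exact absurd (hl j (by simp)) (ha' j (by simp))

/-- When the letters are distinct, a new block starts exactly where the word reaches a new minimum:
letters inside a block exceed its first letter, and the first letters decrease. Hence the brackets
can be restored from the word. -/
theorem IsStandard.blockWord_inj {V V' : List (ι × List ι)} (h : IsStandard V)
    (h' : IsStandard V') (hn : (blockWord V).Nodup) (e : blockWord V = blockWord V') : V = V' := by
  induction V generalizing V' with
  | nil =>
    rcases V' with _ | ⟨w, V'⟩
    · rfl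
    · simp [blockWord] at e
  | cons v V ih =>
    rcases V' with _ | ⟨w, V'⟩
    · simp [blockWord] at e
    · have hn' : (blockWord (w :: V')).Nodup := e ▸ hn
      have hlt := h.head_lt hn (List.mem_cons_self)
      have hlt' := h'.head_lt hn' (List.mem_cons_self)
      have hd := h.head_blockWord_le
      have hd' := h'.head_blockWord_le
      obtain ⟨i, l⟩ := v
      obtain ⟨i', l'⟩ := w
      have e' : i :: (l ++ blockWord V) = i' :: (l' ++ blockWord V') := e
      obtain ⟨rfl, e''⟩ := List.cons_eq_cons.1 e'
      obtain ⟨rfl, e3⟩ := append_inj_of_pred (p := fun j => i < j) e'' hlt hlt'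
        (fun j hj => not_lt.2 (hd j hj)) (fun j hj => not_lt.2 (hd' j hj))
      have hn2 : (blockWord V).Nodup := by
        have : (i :: l ++ blockWord V).Nodup := hn
        exact (List.nodup_append.1 this).2.1
      rw [ih h.of_cons h'.of_cons hn2 e3]

/-- Equal lengths exclude that `u` is a proper prefix of `w`, so the comparison is decided before
`a` and `b` begin. -/
theorem append_lt_append_of_length_eq {u w : List ι} (h : u < w) (hl : u.length = w.length)
    (a b : List ι) : u ++ a < w ++ b := by
  induction u generalizing w with
  | nil =>
    obtain rfl : w = [] := by simpa using hl.symm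
    exact absurd h (lt_irrefl _)
  | cons i u ih =>
    rcases w with _ | ⟨j, w⟩
    · simp at hl
    · rcases List.cons_lt_cons_iff.1 h with hij | ⟨rfl, h'⟩
      · exact List.cons_lt_cons_iff.2 (Or.inl hij)
      · exact List.cons_lt_cons_iff.2 (Or.inr ⟨rfl, ih h' (by simpa using hl)⟩)

end Standard

section Leading

variable {K : Type*} [CommRing K] {A : Type*} [Ring A] [Algebra K A] {ι : Type*}

variable (K A) in
/-- The commutator as a bilinear map. -/
def commBr : A →ₗ[K] A →ₗ[K] A := LinearMap.mul K A - (LinearMap.mul K A).flip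

@[simp] theorem commBr_apply (a b : A) : commBr K A a b = a * b - b * a := rfl

variable (x : ι → A)

/-- The value of a word. -/
def wordProd (w : List ι) : A := (w.map x).prod

theorem wordProd_append (u w : List ι) : wordProd x (u ++ w) = wordProd x u * wordProd x w := by
  simp [wordProd]

theorem wordProd_cons (i : ι) (w : List ι) : wordProd x (i :: w) = x i * wordProd x w := by
  simp [wordProd]

variable (K) in
/-- The span of the words of length `k` whose first letter satisfies `p`. -/
def wordSpan (p : List ι → Prop) : Submodule K A := Submodule.span K (wordProd x '' {w | p w})

variable {x}

theorem wordProd_mem_wordSpan {p : List ι → Prop} {w : List ι} (hw : p w) :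
    wordProd x w ∈ wordSpan K x p := Submodule.subset_span ⟨w, hw, rfl⟩

theorem mul_mem_wordSpan {p q r : List ι → Prop} (h : ∀ u w, p u → q w → r (u ++ w)) {a b : A}
    (ha : a ∈ wordSpan K x p) (hb : b ∈ wordSpan K x q) : a * b ∈ wordSpan K x r := by
  have h1 := Submodule.mul_mem_mul ha hb
  rw [wordSpan, wordSpan, Submodule.span_mul_span] at h1
  refine Submodule.span_mono ?_ h1
  rintro _ ⟨_, ⟨u, hu, rfl⟩, _, ⟨w, hw, rfl⟩, rfl⟩
  exact ⟨u ++ w, h u w hu hw, wordProd_append x u w⟩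

theorem wordSpan_mono {p q : List ι → Prop} (h : ∀ w, p w → q w) :
    wordSpan K x p ≤ wordSpan K x q :=
  Submodule.span_mono (Set.image_mono fun w hw => h w hw)

variable (K x) in
/-- An element whose leading word is `w`: the remaining words have the same length and are
lexicographically greater. -/
def HasLead [LT ι] (w : List ι) (a : A) : Prop :=
  a - wordProd x w ∈ wordSpan K x fun u => w < u ∧ u.length = w.length

theorem HasLead.mem_length [LT ι] {w : List ι} {a : A} (h : HasLead K x w a) :
    a ∈ wordSpan K x fun u => u.length = w.length := by
  rw [← sub_add_cancel a (wordProd x w)]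
  exact add_mem (wordSpan_mono (fun _ hu => hu.2) h) (wordProd_mem_wordSpan rfl)

theorem HasLead.mul [LinearOrder ι] {u w : List ι} {a b : A} (ha : HasLead K x u a)
    (hb : HasLead K x w b) : HasLead K x (u ++ w) (a * b) := by
  have e : a * b - wordProd x (u ++ w) =
      (a - wordProd x u) * b + wordProd x u * (b - wordProd x w) := by
    rw [wordProd_append]
    noncomm_ring
  rw [HasLead, e]
  refine add_mem (mul_mem_wordSpan ?_ ha hb.mem_length)
    (mul_mem_wordSpan (p := fun v => v = u) ?_ (wordProd_mem_wordSpan rfl) hb)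
  · rintro u' w' ⟨h1, h2⟩ h3
    exact ⟨append_lt_append_of_length_eq h1 h2.symm _ _, by simp [h2, h3]⟩
  · rintro u' w' rfl ⟨h1, h2⟩
    exact ⟨List.append_left_lt h1, by simp [h2]⟩

/-- Expand the commutators. Keeping every new letter on the right gives the leading word once; any
other term has been multiplied on the left by some letter of `v.2` and so begins with a letter
larger than `v.1`. -/
theorem hasLead_lieComb [LinearOrder ι] {v : ι × List ι} (hv : ∀ j ∈ v.2, v.1 < j) :
    HasLead K x (v.1 :: v.2) (lieComb (commBr K A) x v) := by
  have key : ∀ (i : ι) (l : List ι), lieComb (commBr K A) x (i, l) - wordProd x (i :: l) ∈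
      wordSpan K x fun u => (∃ j ∈ l, ∃ u', u = j :: u') ∧ u.length = l.length + 1 := by
    intro i l
    induction l using List.reverseRecOn with
    | nil => simp [wordProd]
    | append_singleton l j ih =>
      have hj : x j = wordProd x [j] := by simp [wordProd]
      have h1 : lieComb (commBr K A) x (i, l) ∈ wordSpan K x fun u => u.length = l.length + 1 := by
        rw [← sub_add_cancel (lieComb (commBr K A) x (i, l)) (wordProd x (i :: l))]
        exact add_mem (wordSpan_mono (fun _ hu => hu.2) ih) (wordProd_mem_wordSpan rfl)
      have e : lieComb (commBr K A) x (i, l ++ [j]) - wordProd x (i :: (l ++ [j])) =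
          (lieComb (commBr K A) x (i, l) - wordProd x (i :: l)) * wordProd x [j] -
            wordProd x [j] * lieComb (commBr K A) x (i, l) := by
        rw [lieComb_concat, commBr_apply, ← List.cons_append, wordProd_append, ← hj]
        noncomm_ring
      rw [e]
      refine sub_mem (mul_mem_wordSpan (q := fun v => v = [j]) ?_ ih (wordProd_mem_wordSpan rfl))
        (mul_mem_wordSpan (p := fun v => v = [j]) ?_ (wordProd_mem_wordSpan rfl) h1)
      · rintro u w ⟨⟨k, hk, u', rfl⟩, h2⟩ rfl
        exact ⟨⟨k, by simp [hk], u' ++ [j], rfl⟩, by simpa using h2⟩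
      · rintro u w rfl h2
        exact ⟨⟨j, by simp, w, rfl⟩, by simpa using h2⟩
  obtain ⟨i, l⟩ := v
  refine wordSpan_mono ?_ (key i l)
  rintro _ ⟨⟨j, hj, u, rfl⟩, hu⟩
  exact ⟨List.cons_lt_cons_iff.2 (Or.inl (hv j hj)), hu⟩

theorem hasLead_prod [LinearOrder ι] {V : List (ι × List ι)} (hV : ∀ v ∈ V, ∀ j ∈ v.2, v.1 < j) :
    HasLead K x (blockWord V) (V.map (lieComb (commBr K A) x)).prod := by
  induction V with
  | nil => simp [HasLead, blockWord, wordProd]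
  | cons v V ih =>
    rw [List.map_cons, List.prod_cons]
    exact (hasLead_lieComb (hV v (by simp))).mul (ih fun w hw => hV w (by simp [hw]))

/-- In a relation choose `i` in the support with minimal lead. Any term seen by `φ (lead i)` has a
lead at most `lead i`, hence equal to it, hence is the term `i` itself. A partial order is enough.
-/
theorem linearIndependent_of_triangular {I J M : Type*} [PartialOrder J] [AddCommGroup M]
    [Module K M] (lead : I → J) (hlead : Function.Injective lead) (v : I → M)
    (φ : J → M →ₗ[K] K) (h1 : ∀ i, φ (lead i) (v i) = 1)
    (h2 : ∀ i j, φ j (v i) ≠ 0 → lead i ≤ j) : LinearIndependent K v := by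
  classical
  rw [linearIndependent_iff]
  intro l hl
  by_contra hne
  obtain ⟨i, hi⟩ := Finset.exists_minimalFor lead l.support (Finsupp.support_nonempty_iff.2 hne)
  have h3 := congrArg (φ (lead i)) hl
  rw [Finsupp.linearCombination_apply, Finsupp.sum, map_sum, map_zero,
    Finset.sum_eq_single i] at h3
  · rw [map_smul, h1, smul_eq_mul, mul_one] at h3
    exact Finsupp.mem_support_iff.1 hi.1 h3
  · intro j hj hji
    rw [map_smul]
    by_contra h4
    have h5 := h2 j (lead i) fun h => h4 (by rw [h, smul_zero])
    exact hji (hlead (le_antisymm h5 (hi.2 hj h5)))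
  · intro h
    exact absurd hi.1 h

end Leading

/-! ### Coefficients of words in `U(FL_N)` and independence of standard products. -/

section FreeEnv

variable (K : Type u) [Field K]

attribute [local instance 100] LieRing.ofAssociativeRing

/-- The action of `U(FL_N)` on words by concatenation. -/
def wordAction (N : ℕ) : UFree K N →ₐ[K] Module.End K (List (Fin N) →₀ K) :=
  UniversalEnvelopingAlgebra.lift K
    (FreeLieAlgebra.lift K fun i => (Finsupp.lmapDomain K K (List.cons i) : Module.End K _))

theorem wordAction_uGen (N : ℕ) (i : Fin N) :
    wordAction K N (uGen K N i) = Finsupp.lmapDomain K K (List.cons i) := by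
  rw [wordAction, uGen, UniversalEnvelopingAlgebra.lift_ι_apply, FreeLieAlgebra.lift_of_apply]

/-- The coefficient of a word. -/
def wordCoeff {N : ℕ} (w : List (Fin N)) : UFree K N →ₗ[K] K :=
  Finsupp.lapply w ∘ₗ LinearMap.applyₗ (Finsupp.single [] 1) ∘ₗ (wordAction K N).toLinearMap

/-- Applied to the empty word, a product of generators produces its own word. The words in `U(FL_N)`
are thus separated by functionals without appeal to the Poincaré–Birkhoff–Witt theorem. -/
theorem wordCoeff_wordProd {N : ℕ} (w u : List (Fin N)) :
    wordCoeff K w (wordProd (uGen K N) u) = if u = w then 1 else 0 := by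
  have h : wordAction K N (wordProd (uGen K N) u) (Finsupp.single [] 1) = Finsupp.single u 1 := by
    induction u with
    | nil => simp [wordProd]
    | cons i u ih =>
      rw [wordProd_cons, map_mul, Module.End.mul_apply, ih, wordAction_uGen]
      simp
  simp only [wordCoeff, LinearMap.comp_apply, AlgHom.toLinearMap_apply, LinearMap.applyₗ_apply_apply]
  rw [h]
  simp [Finsupp.single_apply]

theorem wordCoeff_eq_zero {N : ℕ} {p : List (Fin N) → Prop} {w : List (Fin N)} (hw : ¬ p w)
    {a : UFree K N} (ha : a ∈ wordSpan K (uGen K N) p) : wordCoeff K w a = 0 := by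
  have h : wordSpan K (uGen K N) p ≤ LinearMap.ker (wordCoeff K w) := by
    rw [wordSpan, Submodule.span_le]
    rintro _ ⟨u, hu, rfl⟩
    rw [SetLike.mem_coe, LinearMap.mem_ker, wordCoeff_wordProd, if_neg]
    rintro rfl
    exact hw hu
  exact h ha

theorem HasLead.wordCoeff_self {N : ℕ} {w : List (Fin N)} {a : UFree K N}
    (h : HasLead K (uGen K N) w a) : wordCoeff K w a = 1 := by
  rw [← sub_add_cancel a (wordProd (uGen K N) w), map_add, wordCoeff_wordProd, if_pos rfl,
    wordCoeff_eq_zero K _ h, zero_add]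
  exact fun h => lt_irrefl _ h.1

theorem HasLead.le_of_wordCoeff_ne_zero {N : ℕ} {w u : List (Fin N)} {a : UFree K N}
    (h : HasLead K (uGen K N) w a) (hu : wordCoeff K u a ≠ 0) : w ≤ u := by
  by_contra hwu
  apply hu
  rw [← sub_add_cancel a (wordProd (uGen K N) w), map_add, wordCoeff_wordProd, if_neg,
    wordCoeff_eq_zero K _ h, zero_add]
  · exact fun h => hwu h.1.le
  · rintro rfl
    exact hwu le_rfl

/-- The product of iterated commutators, one for every tensor factor. -/
def lieTensor {N n : ℕ} (V : Fin n → List (Fin N × List (Fin N))) : TPow K (UFree K N) n :=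
  PiTensorProduct.tprod K fun j => ((V j).map (lieComb (commBr K (UFree K N)) (uGen K N))).prod

theorem StandardIdx.nodup {N n : ℕ} (V : StandardIdx N n) (j : Fin n) :
    (blockWord (V.1 j)).Nodup := by
  have h1 : (∑ j, (blockWord (V.1 j) : Multiset (Fin N))).Nodup := by
    rw [V.2.2]
    exact Finset.univ.nodup
  refine Multiset.coe_nodup.1 (Multiset.nodup_of_le ?_ h1)
  exact Finset.single_le_sum (f := fun j => (blockWord (V.1 j) : Multiset (Fin N)))
    (fun _ _ => Multiset.zero_le _) (Finset.mem_univ j)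

theorem StandardIdx.word_injective {N n : ℕ} :
    Function.Injective fun (V : StandardIdx N n) j => blockWord (V.1 j) := by
  intro V V' h
  apply Subtype.ext
  funext j
  exact (V.2.1 j).blockWord_inj (V'.2.1 j) (V.nodup j) (congrFun h j)

instance (N n : ℕ) : Finite (StandardIdx N n) :=
  Finite.of_injective
    (fun V j => (⟨blockWord (V.1 j), V.nodup j⟩ : {l : List (Fin N) // l.Nodup}))
    fun V V' h => StandardIdx.word_injective (by
      funext j
      exact congrArg Subtype.val (congrFun h j))

theorem linearIndependent_lieTensor (N n : ℕ) :
    LinearIndependent K fun V : StandardIdx N n => lieTensor K V.1 := by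
  have hl : ∀ (V : StandardIdx N n) j, HasLead K (uGen K N) (blockWord (V.1 j))
      ((V.1 j).map (lieComb (commBr K (UFree K N)) (uGen K N))).prod := fun V j =>
    hasLead_prod fun v hv => (V.2.1 j).head_lt (V.nodup j) hv
  -- The leads are the families of underlying words, ordered componentwise; the functionals are
  -- products over the tensor factors of word coefficients.
  refine linearIndependent_of_triangular (fun V j => blockWord (V.1 j))
    StandardIdx.word_injective _
    (fun w : Fin n → List (Fin N) => PiTensorProduct.lift
      ((MultilinearMap.mkPiAlgebra K (Fin n) K).compLinearMap fun j => wordCoeff K (w j))) ?_ ?_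
  · intro V
    simp [lieTensor, fun j => (hl V j).wordCoeff_self]
  · intro V w hw j
    refine (hl V j).le_of_wordCoeff_ne_zero K fun h0 => hw ?_
    rw [lieTensor, PiTensorProduct.lift.tprod]
    exact Finset.prod_eq_zero (Finset.mem_univ j) h0

end FreeEnv

/-! ### The operations of the prop of algebras -/

section AlgEval

open FreePow

variable (K : Type u) [Field K]

attribute [local instance 100] LieRing.ofAssociativeRing

theorem algProp_isAlg (R : Type u) [CommRing R] :
    (algProp R).IsAlg (algGen R .unit) (algGen R .mul) where
  assoc := PresHom.sound _ (.of .assoc)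
  one_mul := PresHom.sound _ (.of .one_mul)
  mul_one := PresHom.sound _ (.of .mul_one)

/-- The morphism from `U(FL_N)` to the free algebra over the prop of algebras. -/
def uFreeHom (N : ℕ) : UFree K N →ₐ[K] FreeAlg (algProp_isAlg K) (Fin N) :=
  UniversalEnvelopingAlgebra.lift K (FreeLieAlgebra.lift K (var (algProp K)))

theorem uFreeHom_uGen (N : ℕ) (i : Fin N) : uFreeHom K N (uGen K N i) = var (algProp K) i := by
  rw [uFreeHom, uGen, UniversalEnvelopingAlgebra.lift_ι_apply]
  exact FreeLieAlgebra.lift_of_apply _ _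

/-- `uFreeHom` as a linear map. -/
def uFreeLin (N : ℕ) : UFree K N →ₗ[K] FreePow (algProp K) (Fin N) 1 :=
  (uFreeHom K N).toLinearMap

theorem uFreeLin_one (N : ℕ) : uFreeLin K N 1 = unit (Fin N) (algGen K .unit) :=
  map_one (uFreeHom K N)

theorem uFreeLin_mul (N : ℕ) (a b : UFree K N) :
    uFreeLin K N (a * b) = op (algGen K .mul) (uFreeLin K N a) (uFreeLin K N b) :=
  map_mul (uFreeHom K N) a b

theorem uFreeLin_uGen (N : ℕ) (i : Fin N) : uFreeLin K N (uGen K N i) = var (algProp K) i :=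
  uFreeHom_uGen K N i

/-- The morphism from the tensor powers of `U(FL_N)` to those of the free algebra over the prop of
algebras. -/
def tpowToFree (N n : ℕ) : TPow K (UFree K N) n →ₗ[K] FreePow (algProp K) (Fin N) n :=
  PiTensorProduct.lift ((tensNHom (algProp K) (Fin N) n).compLinearMap fun _ => uFreeLin K N)

theorem tpowToFree_tprod (N n : ℕ) (a : Fin n → UFree K N) :
    tpowToFree K N n (PiTensorProduct.tprod K a) = tensN fun j => uFreeLin K N (a j) := by
  rw [tpowToFree, PiTensorProduct.lift.tprod]
  rfl

theorem tpowToFree_join (N n m : ℕ) (y : TPow K (UFree K N) n) (z : TPow K (UFree K N) m) :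
    tpowToFree K N (n + m) (TPow.join K _ n m (y ⊗ₜ z)) =
      tens (tpowToFree K N n y) (tpowToFree K N m z) := by
  have h : tpowToFree K N (n + m) ∘ₗ (TPow.join K (UFree K N) n m).toLinearMap =
      TensorProduct.lift (tens.compl₁₂ (tpowToFree K N n) (tpowToFree K N m)) := by
    apply TPow.ext_tprod₂
    intro a b
    simp only [LinearMap.comp_apply, LinearEquiv.coe_coe, TPow.join_tprod, TensorProduct.lift.tmul,
      LinearMap.compl₁₂_apply, tpowToFree_tprod]
    rw [← tensN_append]
    congr 1
    funext i
    refine Fin.addCases (fun i => ?_) (fun i => ?_) i <;> simp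
  exact LinearMap.congr_fun h (y ⊗ₜ z)

theorem endFun_tens_join {R : Type u} [CommRing R] {A : Type u} [Ring A] [Algebra R A]
    {n m n' m' : ℕ} (f : (endProp R A).Hom n m) (g : (endProp R A).Hom n' m')
    (y : TPow R A n) (z : TPow R A n') :
    endFun ((endProp R A).tens f g) (TPow.join R A n n' (y ⊗ₜ z)) =
      TPow.join R A m m' (endFun f y ⊗ₜ endFun g z) :=
  TPow.tens_join R A f g y z

/-- The action of an operation of the prop of algebras on the tensor powers of `U(FL_N)`. -/
def algActLin (N : ℕ) {n m : ℕ} (x : (algProp K).Hom n m) :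
    TPow K (UFree K N) n →ₗ[K] TPow K (UFree K N) m := endFun ((algAct K (UFree K N)).app n m x)

variable {K}

theorem algActLin_comp {N n m p : ℕ} (x : (algProp K).Hom n m) (y : (algProp K).Hom m p)
    (z : TPow K (UFree K N) n) :
    algActLin K N ((algProp K).comp x y) z = algActLin K N y (algActLin K N x z) := by
  rw [algActLin, (algAct K (UFree K N)).map_comp]
  rfl

theorem algActLin_tens {N n m n' m' : ℕ} (x : (algProp K).Hom n m) (x' : (algProp K).Hom n' m')
    (y : TPow K (UFree K N) n) (z : TPow K (UFree K N) n') :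
    algActLin K N ((algProp K).tens x x') (TPow.join K _ n n' (y ⊗ₜ z)) =
      TPow.join K _ m m' (algActLin K N x y ⊗ₜ algActLin K N x' z) := by
  rw [algActLin, (algAct K (UFree K N)).map_tens]
  exact endFun_tens_join _ _ y z

theorem algActLin_perm {N n m : ℕ} (e : Fin n ≃ Fin m) (a : Fin n → UFree K N) :
    algActLin K N ((algProp K).perm e) (PiTensorProduct.tprod K a) =
      PiTensorProduct.tprod K (a ∘ e.symm) := by
  rw [algActLin, (algAct K (UFree K N)).map_perm]
  exact TPow.perm_tprod K _ e a

theorem algActLin_unit {N : ℕ} (a : Fin 0 → UFree K N) :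
    algActLin K N (algGen K .unit) (PiTensorProduct.tprod K a) =
      PiTensorProduct.tprod K (fun _ : Fin 1 => (1 : UFree K N)) :=
  endFun_algGenAct_unit K _ a

theorem algActLin_mul {N : ℕ} (a : Fin 2 → UFree K N) :
    algActLin K N (algGen K .mul) (PiTensorProduct.tprod K a) =
      PiTensorProduct.tprod K (fun _ : Fin 1 => a 0 * a 1) :=
  endFun_algGenAct_mul K _ a

theorem algActLin_add {N n m : ℕ} (x y : (algProp K).Hom n m) :
    algActLin K N (x + y) = algActLin K N x + algActLin K N y := by
  rw [algActLin, map_add]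
  rfl

theorem algActLin_smul {N n m : ℕ} (r : K) (x : (algProp K).Hom n m) :
    algActLin K N (r • x) = r • algActLin K N x := by
  rw [algActLin, LinearMap.map_smulₛₗ]
  rfl

theorem algActLin_zero {N n m : ℕ} : algActLin K N (0 : (algProp K).Hom n m) = 0 := by
  rw [algActLin, map_zero]
  rfl

/-- Induction on the operations of the prop of algebras. -/
theorem algProp_induction {R : Type u} [CommRing R]
    {p : ∀ {n m : ℕ}, (algProp R).Hom n m → Prop}
    (gen : ∀ {n m : ℕ} (g : AlgGen n m), p (algGen R g))
    (perm : ∀ {n m : ℕ} (e : Fin n ≃ Fin m), p ((algProp R).perm e))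
    (comp : ∀ {n m k : ℕ} (x : (algProp R).Hom n m) (y : (algProp R).Hom m k),
      p x → p y → p ((algProp R).comp x y))
    (tens : ∀ {n m n' m' : ℕ} (x : (algProp R).Hom n m) (y : (algProp R).Hom n' m'),
      p x → p y → p ((algProp R).tens x y))
    (zero : ∀ {n m : ℕ}, p (0 : (algProp R).Hom n m))
    (add : ∀ {n m : ℕ} (x y : (algProp R).Hom n m), p x → p y → p (x + y))
    (smul : ∀ {n m : ℕ} (r : R) (x : (algProp R).Hom n m), p x → p (r • x))
    {n m : ℕ} (x : (algProp R).Hom n m) : p x := by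
  obtain ⟨t, rfl⟩ := PresHom.mk_surjective (AlgRel R) x
  induction t with
  | gen g => exact gen g
  | perm e => exact perm e
  | comp x y hx hy => exact comp _ _ hx hy
  | tens x y hx hy => exact tens _ _ hx hy
  | zero => exact zero
  | add x y hx hy => exact add _ _ hx hy
  | smul r x hx => exact smul r _ hx

/-- `uFreeLin` preserves unit and product, so the induced maps on tensor powers intertwine the
actions of the generators, and therefore those of all operations. -/
theorem tpowToFree_algActLin (N : ℕ) {k n : ℕ} (x : (algProp K).Hom k n)
    (z : TPow K (UFree K N) k) :
    tpowToFree K N n (algActLin K N x z) = act (tpowToFree K N k z) x := by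
  suffices h : tpowToFree K N n ∘ₗ algActLin K N x = act.flip x ∘ₗ tpowToFree K N k from
    LinearMap.congr_fun h z
  clear z
  induction x using algProp_induction with
  | gen g =>
    apply TPow.ext_tprod
    intro a
    cases g with
    | unit =>
      rw [LinearMap.comp_apply, LinearMap.comp_apply, LinearMap.flip_apply, algActLin_unit, tpowToFree_tprod, tensN_one, uFreeLin_one, tpowToFree_tprod]
      rfl
    | mul =>
      rw [LinearMap.comp_apply, LinearMap.comp_apply, LinearMap.flip_apply, algActLin_mul, tpowToFree_tprod, tensN_one, uFreeLin_mul, tpowToFree_tprod,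
        act_tensN_two]
  | perm e =>
    apply TPow.ext_tprod
    intro a
    rw [LinearMap.comp_apply, LinearMap.comp_apply, LinearMap.flip_apply, algActLin_perm, tpowToFree_tprod, tpowToFree_tprod, act_tensN_perm]
    rfl
  | comp x y hx hy =>
    apply LinearMap.ext
    intro z
    change tpowToFree K N _ (algActLin K N ((algProp K).comp x y) z) =
      act _ ((algProp K).comp x y)
    rw [algActLin_comp]
    exact (LinearMap.congr_fun hy (algActLin K N x z)).trans
      ((congrArg (fun b => act b y) (LinearMap.congr_fun hx z)).trans (act_act _ _ _))
  | tens x y hx hy =>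
    apply TPow.ext_join
    intro u v
    change tpowToFree K N _ (algActLin K N ((algProp K).tens x y) _) =
      act (tpowToFree K N _ _) ((algProp K).tens x y)
    rw [algActLin_tens, tpowToFree_join, tpowToFree_join, act_tens]
    exact congrArg₂ (fun a b => tens a b) (LinearMap.congr_fun hx u) (LinearMap.congr_fun hy v)
  | zero =>
    rw [algActLin_zero]
    ext
    simp
  | add x y hx hy =>
    rw [algActLin_add, LinearMap.comp_add, hx, hy, map_add, LinearMap.add_comp]
  | smul r x hx =>
    rw [algActLin_smul, LinearMap.comp_smul, hx, map_smul, LinearMap.smul_comp]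

variable (K) in
/-- The left inverse of `algEval`. -/
def algRet (N n : ℕ) : TPow K (UFree K N) n →ₗ[K] (algProp K).Hom N n :=
  ret ∘ₗ tpowToFree K N n

/-- By equivariance, the value of `x` on the generators of `U(FL_N)` is sent to the value of `x` on
the letters of the free algebra over `Alg`, which determines `x`. No normal form for the operations
of `Alg` is needed. -/
theorem algRet_algEval {N n : ℕ} (x : (algProp K).Hom N n) :
    algRet K N n (algEval K N n x) = x := by
  have h1 : tensN (var (algProp K) : Fin N → _) = FreePow.mk id ((algProp K).perm (Equiv.refl _)) :=
    tensN_var id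
  have h2 : algEval K N n x = algActLin K N x (PiTensorProduct.tprod K (uGen K N)) := rfl
  rw [algRet, LinearMap.comp_apply, h2, tpowToFree_algActLin, tpowToFree_tprod]
  simp only [uFreeLin_uGen]
  rw [h1, act_mk, (algProp K).id_comp, ret_mk_id]

theorem algEval_injective (N n : ℕ) : Function.Injective (algEval K N n) :=
  Function.LeftInverse.injective algRet_algEval

/-! ### The image of the evaluation -/

theorem tprod_words_mem {N n : ℕ} (w : Fin n → List (Fin N)) :
    PiTensorProduct.tprod K (fun j => wordProd (uGen K N) (w j)) ∈
      multidegreePart K N n fun i => ∑ j, (w j).count i :=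
  Submodule.subset_span ⟨w, fun _ => rfl, rfl⟩

theorem join_mem_multidegreePart {N n m : ℕ} {d d' : Fin N → ℕ} {y : TPow K (UFree K N) n}
    {z : TPow K (UFree K N) m} (hy : y ∈ multidegreePart K N n d)
    (hz : z ∈ multidegreePart K N m d') :
    TPow.join K _ n m (y ⊗ₜ z) ∈ multidegreePart K N (n + m) (d + d') := by
  have h := Submodule.apply_mem_map₂
    ((TensorProduct.mk K _ _).compr₂ (TPow.join K (UFree K N) n m).toLinearMap) hy hz
  rw [multidegreePart, multidegreePart, Submodule.map₂_span_span] at h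
  refine Submodule.span_mono ?_ h
  rintro _ ⟨_, ⟨w, hw, rfl⟩, _, ⟨w', hw', rfl⟩, rfl⟩
  refine ⟨Fin.append w w', fun i => ?_, ?_⟩
  · rw [Fin.sum_univ_add]
    simp [hw, hw']
  · simp only [LinearMap.compr₂_apply, TensorProduct.mk_apply, LinearEquiv.coe_coe]
    rw [TPow.join_tprod]
    congr 1
    funext j
    refine Fin.addCases (fun j => ?_) (fun j => ?_) j <;> simp

/-- The generators and the permutations only concatenate or rearrange words, or insert empty ones,
so the total number of occurrences of each letter is preserved. -/
theorem algActLin_mem_multidegreePart {N k n : ℕ} (x : (algProp K).Hom k n) (d : Fin N → ℕ)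
    {z : TPow K (UFree K N) k} (hz : z ∈ multidegreePart K N k d) :
    algActLin K N x z ∈ multidegreePart K N n d := by
  induction x using algProp_induction generalizing d with
  | @gen n m g =>
    have h : multidegreePart K N n d ≤
        (multidegreePart K N m d).comap (algActLin K N (algGen K g)) := by
      conv_lhs => rw [multidegreePart]
      rw [Submodule.span_le]
      rintro _ ⟨w, hw, rfl⟩
      cases g with
      | unit =>
        rw [SetLike.mem_coe, Submodule.mem_comap, algActLin_unit]
        exact Submodule.subset_span ⟨fun _ => [], fun i => by simpa using hw i, by simp⟩
      | mul =>
        rw [SetLike.mem_coe, Submodule.mem_comap, algActLin_mul]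
        refine Submodule.subset_span ⟨fun _ => w 0 ++ w 1, fun i => ?_, by simp⟩
        rw [← hw i]
        simp
    exact h hz
  | @perm n m e =>
    have h : multidegreePart K N n d ≤
        (multidegreePart K N m d).comap (algActLin K N ((algProp K).perm e)) := by
      conv_lhs => rw [multidegreePart]
      rw [Submodule.span_le]
      rintro _ ⟨w, hw, rfl⟩
      rw [SetLike.mem_coe, Submodule.mem_comap, algActLin_perm]
      refine Submodule.subset_span ⟨w ∘ e.symm, fun i => ?_, rfl⟩
      rw [← hw i]
      exact Equiv.sum_comp e.symm fun j => (w j).count i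
    exact h hz
  | comp x y hx hy =>
    have h := hy d (hx d hz)
    rw [← algActLin_comp] at h
    exact h
  | @tens n m n' m' x y hx hy =>
    have h : multidegreePart K N (n + n') d ≤
        (multidegreePart K N (m + m') d).comap (algActLin K N ((algProp K).tens x y)) := by
      conv_lhs => rw [multidegreePart]
      rw [Submodule.span_le]
      rintro _ ⟨w, hw, rfl⟩
      rw [SetLike.mem_coe, Submodule.mem_comap, TPow.tprod_eq_join, algActLin_tens]
      have h1 := hx _ (tprod_words_mem fun i => w (Fin.castAdd n' i))
      have h2 := hy _ (tprod_words_mem fun i => w (Fin.natAdd n i))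
      have h3 := join_mem_multidegreePart h1 h2
      have h4 : ((fun i => ∑ j, (w (Fin.castAdd n' j)).count i) +
          fun i => ∑ j, (w (Fin.natAdd n j)).count i : Fin N → ℕ) = d := by
        funext i
        rw [← hw i, Fin.sum_univ_add]
        rfl
      rw [h4] at h3
      exact h3
    exact h hz
  | zero =>
    rw [algActLin_zero]
    exact zero_mem _
  | add x y hx hy =>
    rw [algActLin_add]
    exact add_mem (hx d hz) (hy d hz)
  | smul r x hx =>
    rw [algActLin_smul]
    exact Submodule.smul_mem _ _ (hx d hz)

/-- An element obtained by applying an operation to a word with given content. -/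
def IsValue {N n : ℕ} (d : Multiset (Fin N)) (z : TPow K (UFree K N) n) : Prop :=
  ∃ (k : ℕ) (c : Fin k → Fin N) (x : (algProp K).Hom k n), (List.ofFn c : Multiset (Fin N)) = d ∧
    algActLin K N x (PiTensorProduct.tprod K (uGen K N ∘ c)) = z

theorem IsValue.join {N n m : ℕ} {d d' : Multiset (Fin N)} {y : TPow K (UFree K N) n}
    {z : TPow K (UFree K N) m} (hy : IsValue d y) (hz : IsValue d' z) :
    IsValue (d + d') (TPow.join K _ n m (y ⊗ₜ z)) := by
  obtain ⟨k, c, x, rfl, rfl⟩ := hy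
  obtain ⟨k', c', x', rfl, rfl⟩ := hz
  refine ⟨k + k', Fin.append c c', (algProp K).tens x x', by simp [List.ofFn_fin_append], ?_⟩
  rw [← algActLin_tens, TPow.join_tprod]
  congr 2
  funext j
  refine Fin.addCases (fun j => ?_) (fun j => ?_) j <;> simp

theorem IsValue.act {N n m : ℕ} {d : Multiset (Fin N)} {z : TPow K (UFree K N) n}
    (hz : IsValue d z) (y : (algProp K).Hom n m) : IsValue d (algActLin K N y z) := by
  obtain ⟨k, c, x, rfl, rfl⟩ := hz
  exact ⟨k, c, (algProp K).comp x y, rfl, algActLin_comp _ _ _⟩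

theorem isValue_word {N : ℕ} (w : List (Fin N)) :
    IsValue (K := K) (w : Multiset (Fin N))
      (PiTensorProduct.tprod K fun _ : Fin 1 => wordProd (uGen K N) w) := by
  induction w with
  | nil => exact ⟨0, Fin.elim0, algGen K .unit, by simp, algActLin_unit _⟩
  | cons i w ih =>
    have h0 : IsValue (K := K) {i} (PiTensorProduct.tprod K fun _ : Fin 1 => uGen K N i) := by
      refine ⟨1, fun _ => i, (algProp K).perm (Equiv.refl _), by simp, ?_⟩
      rw [algActLin_perm]
      rfl
    have h := (h0.join ih).act (algGen K .mul)
    rw [TPow.join_tprod] at h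
    have h' := algActLin_mul (K := K) (N := N) (Fin.append (fun _ : Fin 1 => uGen K N i)
      fun _ : Fin 1 => wordProd (uGen K N) w)
    rw [h'] at h
    rw [wordProd_cons, ← Multiset.cons_coe, ← Multiset.singleton_add]
    exact h

theorem isValue_words {N n : ℕ} (w : Fin n → List (Fin N)) :
    IsValue (K := K) (∑ j, (w j : Multiset (Fin N)))
      (PiTensorProduct.tprod K fun j => wordProd (uGen K N) (w j)) := by
  induction n with
  | zero =>
    refine ⟨0, Fin.elim0, (algProp K).perm (Equiv.refl _), by simp, ?_⟩
    rw [algActLin_perm]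
    congr 1
    funext j
    exact j.elim0
  | succ n ih =>
    have h := (ih fun j => w j.castSucc).join (isValue_word (w (Fin.last n)))
    have e : (fun i : Fin 1 => wordProd (uGen K N) (w (Fin.natAdd n i))) =
        fun _ => wordProd (uGen K N) (w (Fin.last n)) := by
      funext i
      rw [Subsingleton.elim i 0]
      rfl
    rw [Fin.sum_univ_castSucc, TPow.tprod_eq_join, e]
    exact h

theorem IsValue.mem_range {N n : ℕ} {z : TPow K (UFree K N) n}
    (hz : IsValue Finset.univ.val z) : z ∈ LinearMap.range (algEval K N n) := by
  obtain ⟨k, c, x, hc, rfl⟩ := hz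
  have hb := coe_ofFn_eq_univ_iff.1 hc
  -- The content says that `c` is a bijection, so relabelling the inputs by its inverse turns a
  -- value on `uGen ∘ c` into a value on the generators in their order.
  refine ⟨(algProp K).comp ((algProp K).perm (Equiv.ofBijective c hb).symm) x, ?_⟩
  change algActLin K N _ (PiTensorProduct.tprod K (uGen K N)) = _
  rw [algActLin_comp, algActLin_perm]
  rfl

theorem sum_count_eq_one_iff {N n : ℕ} {w : Fin n → List (Fin N)} :
    (∀ i, ∑ j, (w j).count i = 1) ↔ ∑ j, (w j : Multiset (Fin N)) = Finset.univ.val := by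
  rw [Multiset.ext]
  refine forall_congr' fun i => ?_
  rw [Multiset.count_sum', Multiset.count_eq_one_of_mem Finset.univ.nodup (Finset.mem_univ i)]
  simp

theorem range_algEval (N n : ℕ) :
    LinearMap.range (algEval K N n) = multidegreePart K N n fun _ => 1 := by
  apply le_antisymm
  · rintro _ ⟨x, rfl⟩
    refine algActLin_mem_multidegreePart x _ (Submodule.subset_span ⟨fun i => [i], ?_, by simp⟩)
    intro i
    simp [List.count_singleton]
  · rw [multidegreePart, Submodule.span_le]
    rintro _ ⟨w, hw, rfl⟩
    have h := isValue_words (K := K) w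
    rw [sum_count_eq_one_iff.1 hw] at h
    exact h.mem_range

end AlgEval

/-! ### The filtration of `U(FL_N)^{⊗ n}` -/

section Filtration

open FreePow

variable (K : Type u) [Field K]

attribute [local instance 100] LieRing.ofAssociativeRing

/-- The commutator in the prop of algebras. -/
def algComm : (algProp K).Hom 2 1 :=
  algGen K .mul - (algProp K).comp ((algProp K).perm (Equiv.swap (0 : Fin 2) 1)) (algGen K .mul)

variable {K}

theorem op_algComm {ι : Type} (a b : FreePow (algProp K) ι 1) :
    op (algComm K) a b = op (algGen K .mul) a b - op (algGen K .mul) b a := by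
  have h1 := act_tensN_two ![a, b] (algComm K)
  rw [algComm, map_sub, act_swap, act_tensN_two] at h1
  exact h1.symm

theorem uFreeLin_lieComb (N : ℕ) (v : Fin N × List (Fin N)) :
    uFreeLin K N (lieComb (commBr K (UFree K N)) (uGen K N) v) =
      lieComb (op (algComm K)) (var (algProp K)) v := by
  obtain ⟨i, l⟩ := v
  induction l using List.reverseRecOn with
  | nil => exact uFreeLin_uGen K N i
  | append_singleton l j ih =>
    rw [lieComb_concat, lieComb_concat, commBr_apply, map_sub, uFreeLin_mul, uFreeLin_mul, ih,
      uFreeLin_uGen, op_algComm]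

theorem tpowToFree_lieTensor {N n : ℕ} (V : Fin n → List (Fin N × List (Fin N))) :
    tpowToFree K N n (lieTensor K V) =
      lieMon (algGen K .unit) (algGen K .mul) (algComm K) V := by
  rw [lieTensor, tpowToFree_tprod, lieMon]
  congr 1
  funext j
  induction V j with
  | nil => exact uFreeLin_one K N
  | cons v V ih =>
    rw [List.map_cons, List.prod_cons, uFreeLin_mul, uFreeLin_lieComb, ih]
    rfl

theorem algRet_lieTensor {N n : ℕ} (V : Fin n → List (Fin N × List (Fin N))) :
    algRet K N n (lieTensor K V) =
      lieOp (algGen K .unit) (algGen K .mul) (algComm K) V :=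
  congrArg ret (tpowToFree_lieTensor V)

theorem lieComb_mem_wordSpan {A : Type*} [Ring A] [Algebra K A] {ι : Type*} (x : ι → A)
    (v : ι × List ι) :
    lieComb (commBr K A) x v ∈ wordSpan K x fun u => u.Perm (v.1 :: v.2) := by
  obtain ⟨i, l⟩ := v
  induction l using List.reverseRecOn with
  | nil =>
    have h := wordProd_mem_wordSpan (K := K) (x := x) (p := fun u => u.Perm [i]) (w := [i])
      (List.Perm.refl _)
    simpa [wordProd] using h
  | append_singleton l j ih =>
    have hj : x j ∈ wordSpan K x fun u => u.Perm [j] := by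
      have h := wordProd_mem_wordSpan (K := K) (x := x) (p := fun u => u.Perm [j]) (w := [j])
        (List.Perm.refl _)
      simpa [wordProd] using h
    rw [lieComb_concat, commBr_apply]
    refine sub_mem (mul_mem_wordSpan ?_ ih hj) (mul_mem_wordSpan ?_ hj ih)
    · intro u w hu hw
      exact hu.append hw
    · intro u w hu hw
      exact (hu.append hw).trans (List.perm_append_comm (l₁ := [j]) (l₂ := i :: l))

theorem prod_lieComb_mem_wordSpan {A : Type*} [Ring A] [Algebra K A] {ι : Type*} (x : ι → A)
    (V : List (ι × List ι)) : (V.map (lieComb (commBr K A) x)).prod ∈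
      wordSpan K x fun u => u.Perm (blockWord V) := by
  induction V with
  | nil =>
    exact wordProd_mem_wordSpan (K := K) (x := x)
      (p := fun u => u.Perm (blockWord ([] : List (ι × List ι)))) (w := []) (List.Perm.refl _)
  | cons v V ih =>
    rw [List.map_cons, List.prod_cons]
    exact mul_mem_wordSpan (fun u w hu hw => hu.append hw) (lieComb_mem_wordSpan x v) ih

theorem tprod_single_mem_multidegreePart {N : ℕ} {c : List (Fin N)} {a : UFree K N}
    (ha : a ∈ wordSpan K (uGen K N) fun u => u.Perm c) :
    PiTensorProduct.tprod K (fun _ : Fin 1 => a) ∈ multidegreePart K N 1 fun i => c.count i := by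
  have h : wordSpan K (uGen K N) (fun u => u.Perm c) ≤
      (multidegreePart K N 1 fun i => c.count i).comap
        (PiTensorProduct.subsingletonEquiv (R := K) (s := fun _ : Fin 1 => UFree K N)
          0).symm.toLinearMap := by
    rw [wordSpan, Submodule.span_le]
    rintro _ ⟨u, hu, rfl⟩
    rw [SetLike.mem_coe, Submodule.mem_comap, LinearEquiv.coe_coe,
      PiTensorProduct.subsingletonEquiv_symm_apply']
    exact Submodule.subset_span ⟨fun _ => u, fun i => by simpa using hu.count_eq i, rfl⟩
  have h' := h ha
  rw [Submodule.mem_comap, LinearEquiv.coe_coe,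
    PiTensorProduct.subsingletonEquiv_symm_apply'] at h'
  exact h'

theorem tprod_mem_multidegreePart {N n : ℕ} {c : Fin n → List (Fin N)} {a : Fin n → UFree K N}
    (ha : ∀ j, a j ∈ wordSpan K (uGen K N) fun u => u.Perm (c j)) :
    PiTensorProduct.tprod K a ∈ multidegreePart K N n fun i => ∑ j, (c j).count i := by
  induction n with
  | zero =>
    refine Submodule.subset_span ⟨Fin.elim0, by simp, ?_⟩
    congr 1
    funext j
    exact j.elim0
  | succ n ih =>
    have h := join_mem_multidegreePart (ih fun j => ha j.castSucc)
      (tprod_single_mem_multidegreePart (ha (Fin.last n)))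
    have e : (fun i : Fin 1 => a (Fin.natAdd n i)) = fun _ => a (Fin.last n) := by
      funext i
      rw [Subsingleton.elim i 0]
      rfl
    rw [TPow.tprod_eq_join, e]
    have e' : (fun i => ∑ j : Fin (n + 1), (c j).count i : Fin N → ℕ) =
        (fun i => ∑ j : Fin n, (c j.castSucc).count i) + fun i => (c (Fin.last n)).count i := by
      funext i
      rw [Fin.sum_univ_castSucc]
      rfl
    rw [e']
    exact h

/-- `algRet` sends `lieTensor K V` to `lieOp`. As `algRet` is a left inverse of `algEval`, only
membership in the range remains, and that is a matter of multidegree. -/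
theorem algEval_lieOp {N n : ℕ} {V : Fin n → List (Fin N × List (Fin N))}
    (hV : ∑ j, (blockWord (V j) : Multiset (Fin N)) = Finset.univ.val) :
    algEval K N n (lieOp (algGen K .unit) (algGen K .mul) (algComm K) V) = lieTensor K V := by
  have h : lieTensor K V ∈ LinearMap.range (algEval K N n) := by
    rw [range_algEval]
    have h1 := tprod_mem_multidegreePart (K := K)
      fun j => prod_lieComb_mem_wordSpan (uGen K N) (V j)
    have h2 := sum_count_eq_one_iff.2 hV
    simp only [h2] at h1
    exact h1
  obtain ⟨x, hx⟩ := h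
  rw [← algRet_lieTensor, ← hx, algRet_algEval]

theorem linearIndependent_lieOp (N n : ℕ) : LinearIndependent K fun V : StandardIdx N n =>
    lieOp (algGen K .unit) (algGen K .mul) (algComm K) V.1 := by
  refine LinearIndependent.of_comp (algEval K N n) ?_
  have h : (algEval K N n ∘ fun V : StandardIdx N n =>
      lieOp (algGen K .unit) (algGen K .mul) (algComm K) V.1) = fun V => lieTensor K V.1 := by
    funext V
    exact algEval_lieOp V.2.2
  rw [h]
  exact linearIndependent_lieTensor K N n

/-! #### Products of elements of the Lie algebra -/

theorem commBr_isQuasiPoisson (A : Type*) [Ring A] [Algebra K A] :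
    IsQuasiPoisson (1 : K) (commBr K A) where
  skew a b := by simp
  jacobi a b c := by
    simp only [commBr_apply]
    noncomm_ring
  leibniz a b c := by
    simp only [commBr_apply]
    noncomm_ring
  comm a b := by simp

/-- The left-normed brackets of the generators span a Lie subalgebra of `U(FL_N)`; by the universal
property of `FL_N` the canonical map takes its values there. -/
theorem ι_mem_combSpan {N : ℕ} (x : FreeLieAlgebra K (Fin N)) :
    UniversalEnvelopingAlgebra.ι K x ∈
      IsQuasiPoisson.combSpan (commBr K (UFree K N)) (uGen K N) := by
  let S : LieSubalgebra K (UFree K N) :=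
    { IsQuasiPoisson.combSpan (commBr K (UFree K N)) (uGen K N) with
      lie_mem' := fun ha hb => (commBr_isQuasiPoisson (UFree K N)).br_mem_combSpan _ ha hb }
  let f : FreeLieAlgebra K (Fin N) →ₗ⁅K⁆ S := FreeLieAlgebra.lift K fun i =>
    (⟨uGen K N i, Submodule.subset_span ⟨(i, []), rfl⟩⟩ : S)
  have h : S.incl.comp f = UniversalEnvelopingAlgebra.ι K := by
    apply FreeLieAlgebra.hom_ext
    intro i
    rw [LieHom.comp_apply, FreeLieAlgebra.lift_of_apply]
    rfl
  rw [← h]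
  exact (f x).2

theorem lieComb_mem_range_ι {N : ℕ} (v : Fin N × List (Fin N)) :
    ∃ x : FreeLieAlgebra K (Fin N), UniversalEnvelopingAlgebra.ι K x =
      lieComb (commBr K (UFree K N)) (uGen K N) v := by
  obtain ⟨i, l⟩ := v
  induction l using List.reverseRecOn with
  | nil => exact ⟨FreeLieAlgebra.of K i, rfl⟩
  | append_singleton l j ih =>
    obtain ⟨x, hx⟩ := ih
    refine ⟨⁅x, FreeLieAlgebra.of K j⁆, ?_⟩
    rw [lieComb_concat, ← hx, LieHom.map_lie]
    rfl

/-- The embedding of `U(FL_N)` as the `j`-th factor of `U(FL_N)^{⊗ n}`. -/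
def singleFactor (N n : ℕ) (j : Fin n) : UFree K N →ₐ[K] TPow K (UFree K N) n :=
  PiTensorProduct.singleAlgHom (R := K) (A := fun _ : Fin n => UFree K N) j

theorem singleFactor_mul_tprod {N n : ℕ} (j : Fin n) (a : UFree K N) (f : Fin n → UFree K N) :
    singleFactor N n j a * PiTensorProduct.tprod K f =
      PiTensorProduct.tprod K (Function.update f j (a * f j)) := by
  rw [singleFactor, PiTensorProduct.singleAlgHom_apply, PiTensorProduct.tprod_mul_tprod]
  congr 1
  funext i
  by_cases h : i = j
  · subst h
    simp
  · simp [h]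

theorem singleFactor_mul_lieTensor {N n : ℕ} (j : Fin n) (v : Fin N × List (Fin N))
    (V : Fin n → List (Fin N × List (Fin N))) :
    singleFactor N n j (lieComb (commBr K (UFree K N)) (uGen K N) v) * lieTensor K V =
      lieTensor K (Function.update V j (v :: V j)) := by
  rw [lieTensor, singleFactor_mul_tprod, lieTensor]
  congr 1
  funext i
  by_cases h : i = j
  · subst h
    simp
  · simp [h]

theorem lieTensor_nil {N n : ℕ} : lieTensor K (fun _ : Fin n => ([] : List (Fin N × List (Fin N))))
    = 1 := rfl

theorem sum_length_update {N n : ℕ} (j : Fin n) (v : Fin N × List (Fin N))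
    (V : Fin n → List (Fin N × List (Fin N))) :
    ∑ i, (Function.update V j (v :: V j) i).length = (∑ i, (V i).length) + 1 := by
  rw [← Finset.add_sum_erase _ _ (Finset.mem_univ j),
    ← Finset.add_sum_erase (a := j) _ (fun i => (V i).length) (Finset.mem_univ j)]
  rw [Finset.sum_congr rfl (g := fun i => (V i).length)]
  · simp
    omega
  · intro i hi
    simp [Finset.ne_of_mem_erase hi]

theorem envToTPow_ι_of {N n : ℕ} (j : Fin n) (x : FreeLieAlgebra K (Fin N)) :
    envToTPow K N n (UniversalEnvelopingAlgebra.ι K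
      (DirectSum.lof K (Fin n) (fun _ => FreeLieAlgebra K (Fin N)) j x : LieSum K N n)) =
      singleFactor N n j (UniversalEnvelopingAlgebra.ι K x) := by
  rw [envToTPow, UniversalEnvelopingAlgebra.lift_ι_apply]
  exact DirectSum.toModule_lof (M := fun _ : Fin n => FreeLieAlgebra K (Fin N)) K j x

theorem pow_le_envFilt {L : Type u} [LieRing L] [LieAlgebra K L] {i k : ℕ} (h : i ≤ k) :
    LinearMap.range (UniversalEnvelopingAlgebra.ι K : L →ₗ⁅K⁆ _).toLinearMap ^ i ≤
      envFilt K L k :=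
  le_iSup₂_of_le i h le_rfl

/-- Peel the first bracket off a nonempty list: it is the image of a Lie element placed in a single
summand, and it multiplies the rest from the left. -/
theorem lieTensor_mem_map_pow {N n k : ℕ} (V : Fin n → List (Fin N × List (Fin N)))
    (hk : ∑ j, (V j).length = k) : lieTensor K V ∈
      (LinearMap.range (UniversalEnvelopingAlgebra.ι K : LieSum K N n →ₗ⁅K⁆ _).toLinearMap ^ k).map
        (envToTPow K N n).toLinearMap := by
  induction k generalizing V with
  | zero =>
    have h : V = fun _ => [] := by
      funext j
      have h1 := Finset.sum_eq_zero_iff.1 hk j (Finset.mem_univ j)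
      simpa using h1
    rw [h, lieTensor_nil]
    exact ⟨1, by rw [pow_zero]; exact Submodule.one_le.1 le_rfl, map_one (envToTPow K N n)⟩
  | succ k ih =>
    obtain ⟨j, hj⟩ : ∃ j, V j ≠ [] := by
      by_contra! h
      simp [h] at hk
    obtain ⟨v, V', hV'⟩ := List.exists_cons_of_ne_nil hj
    have e : V = Function.update (Function.update V j V') j
        (v :: (Function.update V j V' j)) := by
      simp [← hV']
    have hs := sum_length_update j v (Function.update V j V')
    rw [← e] at hs
    obtain ⟨y, hy, hy'⟩ := ih (Function.update V j V') (by omega)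
    obtain ⟨x, hx⟩ := lieComb_mem_range_ι (K := K) v
    rw [e, ← singleFactor_mul_lieTensor, ← hy', ← hx, ← envToTPow_ι_of, pow_succ']
    exact ⟨_, Submodule.mul_mem_mul ⟨_, rfl⟩ hy, map_mul (envToTPow K N n) _ _⟩

theorem lieTensor_mem_tpowFilt {N n : ℕ} (V : Fin n → List (Fin N × List (Fin N))) :
    lieTensor K V ∈ tpowFilt K N n (∑ j, (V j).length) :=
  Submodule.map_mono (pow_le_envFilt le_rfl) (lieTensor_mem_map_pow V rfl)

/-- An element of the `j`-th summand is a combination of left-normed brackets in position `j`, and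
multiplying by one of them on the left extends the list `V j` by one entry. Neither standardness nor
multilinearity is asked of `V`. -/
theorem tpowFilt_le_span {N n k : ℕ} : tpowFilt K N n k ≤
    Submodule.span K {z | ∃ V : Fin n → List (Fin N × List (Fin N)), ∑ j, (V j).length ≤ k ∧
      z = lieTensor K V} := by
  rw [tpowFilt, Submodule.map_le_iff_le_comap, envFilt]
  refine iSup₂_le fun i hi => ?_
  -- For induction on the power, the count of factors is kept exact instead of bounded.
  suffices h : LinearMap.range (UniversalEnvelopingAlgebra.ι K :
      LieSum K N n →ₗ⁅K⁆ _).toLinearMap ^ i ≤ (Submodule.span K {z |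
        ∃ V : Fin n → List (Fin N × List (Fin N)), ∑ j, (V j).length = i ∧
          z = lieTensor K V}).comap (envToTPow K N n).toLinearMap by
    refine h.trans (Submodule.comap_mono (Submodule.span_mono ?_))
    rintro _ ⟨V, hV, rfl⟩
    exact ⟨V, hV.trans_le hi, rfl⟩
  clear hi
  induction i with
  | zero =>
    rw [pow_zero, Submodule.one_le, Submodule.mem_comap]
    refine Submodule.subset_span ⟨fun _ => [], by simp, ?_⟩
    rw [lieTensor_nil]
    exact map_one (envToTPow K N n)
  | succ i ih =>
    rw [pow_succ', Submodule.mul_le]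
    rintro _ ⟨x, rfl⟩ y hy
    have hy' := ih hy
    rw [Submodule.mem_comap] at hy' ⊢
    change envToTPow K N n (UniversalEnvelopingAlgebra.ι K x * y) ∈ _
    rw [map_mul]
    induction x using DirectSum.induction_on with
    | zero => simp
    | add a b ha hb =>
      rw [map_add, map_add, add_mul]
      exact add_mem ha hb
    | of j x =>
      have e := envToTPow_ι_of (K := K) j x
      rw [DirectSum.lof_eq_of] at e
      rw [e]
      have h1 := ι_mem_combSpan x
      have h2 := Submodule.apply_mem_map₂
        ((Algebra.lmul K (TPow K (UFree K N) n)).toLinearMap.comp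
          (singleFactor N n j).toLinearMap) h1 hy'
      rw [IsQuasiPoisson.combSpan, Submodule.map₂_span_span] at h2
      refine Submodule.span_mono ?_ h2
      rintro _ ⟨_, ⟨v, rfl⟩, _, ⟨V, hV, rfl⟩, rfl⟩
      exact ⟨_, by rw [sum_length_update, hV], singleFactor_mul_lieTensor j v V⟩

end Filtration

/-! ### Morphisms of props -/

section PropHoms

variable {R S T : Type u} [CommRing R] [CommRing S] [CommRing T]

theorem PropHom.ext_app {σ : R →+* S} {P : LinProp.{u, u} R} {Q : LinProp.{u, u} S}
    {F G : PropHom σ P Q} (h : ∀ n m x, F.app n m x = G.app n m x) : F = G := by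
  obtain ⟨f, _, _, _⟩ := F
  obtain ⟨g, _, _, _⟩ := G
  have h' : f = g := by
    funext n m
    exact LinearMap.ext (h n m)
  subst h'
  rfl

/-- The composition of morphisms of props. -/
def PropHom.trans {σ : R →+* S} {τ : S →+* T} {P : LinProp.{u, u} R} {Q : LinProp.{u, u} S}
    {O : LinProp.{u, u} T} (F : PropHom σ P Q) (G : PropHom τ Q O) : PropHom (τ.comp σ) P O where
  app n m :=
    { toFun := fun x => G.app n m (F.app n m x)
      map_add' := fun x y => by rw [map_add, map_add]
      map_smul' := fun r x => by
        rw [LinearMap.map_smulₛₗ, LinearMap.map_smulₛₗ]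
        rfl }
  map_comp x y := by
    change G.app _ _ (F.app _ _ _) = _
    rw [F.map_comp, G.map_comp]
    rfl
  map_tens x y := by
    change G.app _ _ (F.app _ _ _) = _
    rw [F.map_tens, G.map_tens]
    rfl
  map_perm e := by
    change G.app _ _ (F.app _ _ _) = _
    rw [F.map_perm, G.map_perm]

/-- The inverse of a bijective morphism of props. -/
def PropHom.inv {P Q : LinProp.{u, u} R} (F : PropHom (RingHom.id R) P Q)
    (hF : ∀ n m, Function.Bijective (F.app n m)) : PropHom (RingHom.id R) Q P where
  app n m := (LinearEquiv.ofBijective (F.app n m) (hF n m)).symm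
  map_comp x y := by
    apply (hF _ _).1
    rw [F.map_comp]
    simp
  map_tens x y := by
    apply (hF _ _).1
    rw [F.map_tens]
    simp
  map_perm e := by
    apply (hF _ _).1
    rw [F.map_perm]
    exact (LinearEquiv.ofBijective (F.app _ _) (hF _ _)).apply_symm_apply _

theorem PropHom.inv_app {P Q : LinProp.{u, u} R} (F : PropHom (RingHom.id R) P Q)
    (hF : ∀ n m, Function.Bijective (F.app n m)) {n m : ℕ} (x : P.Hom n m) :
    (F.inv hF).app n m (F.app n m x) = x :=
  (LinearEquiv.ofBijective (F.app n m) (hF n m)).symm_apply_apply x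

/-- The projection to the quotient by an ideal. -/
def PropIdeal.proj {P : LinProp.{u, u} R} (I : PropIdeal P) :
    PropHom (RingHom.id R) P (P.quot I) where
  app n m := (I.carrier n m).mkQ
  map_comp _ _ := rfl
  map_tens _ _ := rfl
  map_perm _ := rfl

theorem PropIdeal.proj_surjective {P : LinProp.{u, u} R} (I : PropIdeal P) (n m : ℕ) :
    Function.Surjective (I.proj.app n m) := Submodule.mkQ_surjective _

theorem PropIdeal.proj_eq_zero_iff {P : LinProp.{u, u} R} (I : PropIdeal P) {n m : ℕ}
    {x : P.Hom n m} : I.proj.app n m x = 0 ↔ x ∈ I.carrier n m :=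
  Submodule.Quotient.mk_eq_zero _

/-- The morphism on the quotient by an ideal induced by a morphism that vanishes on the ideal. -/
def PropIdeal.lift {P : LinProp.{u, u} R} (I : PropIdeal P) {σ : R →+* S} {Q : LinProp.{u, u} S}
    (F : PropHom σ P Q) (hF : ∀ n m, ∀ x ∈ I.carrier n m, F.app n m x = 0) :
    PropHom σ (P.quot I) Q where
  app n m := (I.carrier n m).liftQ (F.app n m) (hF n m)
  map_comp {n m p} x y := by
    obtain ⟨x, rfl⟩ := I.proj_surjective n m x
    obtain ⟨y, rfl⟩ := I.proj_surjective m p y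
    exact F.map_comp x y
  map_tens {n m n' m'} x y := by
    obtain ⟨x, rfl⟩ := I.proj_surjective n m x
    obtain ⟨y, rfl⟩ := I.proj_surjective n' m' y
    exact F.map_tens x y
  map_perm e := F.map_perm e

/-- The morphism from a prop to its completion. -/
def LinProp.toCompletion (P : LinProp.{u, u} R) (J : Ideal R) :
    PropHom (RingHom.id R) P (P.completion J) where
  app n m := AdicCompletion.of J (P.Hom n m)
  map_comp _ _ := rfl
  map_tens _ _ := rfl
  map_perm _ := rfl

/-- The restriction of scalars of a module along a ring homomorphism. -/
@[nolint unusedArguments]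
def RestrictMod (_ : R →+* S) (M : Type u) : Type u := M

instance (σ : R →+* S) (M : Type u) [AddCommGroup M] : AddCommGroup (RestrictMod σ M) :=
  inferInstanceAs (AddCommGroup M)

instance (σ : R →+* S) (M : Type u) [AddCommGroup M] [Module S M] : Module R (RestrictMod σ M) :=
  Module.compHom M σ

/-- The restriction of scalars of a prop along a ring homomorphism. -/
def LinProp.restrict (Q : LinProp.{u, u} S) (σ : R →+* S) : LinProp.{u, u} R where
  Hom n m := RestrictMod σ (Q.Hom n m)
  comp {n m p} := LinearMap.mk₂ R (fun x y => (Q.comp (n := n) (m := m) (p := p) x y : Q.Hom n p))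
    (fun x x' y => LinearMap.map_add₂ Q.comp x x' y)
    (fun r x y => LinearMap.map_smul₂ Q.comp (σ r) x y)
    (fun x y y' => map_add (Q.comp x) y y')
    (fun r x y => (Q.comp x).map_smul (σ r) y)
  tens {n m n' m'} := LinearMap.mk₂ R
    (fun x y => (Q.tens (n := n) (m := m) (n' := n') (m' := m') x y : Q.Hom (n + n') (m + m')))
    (fun x x' y => LinearMap.map_add₂ Q.tens x x' y)
    (fun r x y => LinearMap.map_smul₂ Q.tens (σ r) x y)
    (fun x y y' => map_add (Q.tens x) y y')
    (fun r x y => (Q.tens x).map_smul (σ r) y)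
  perm e := Q.perm e
  comp_assoc := Q.comp_assoc
  id_comp := Q.id_comp
  comp_id := Q.comp_id
  perm_trans := Q.perm_trans
  tens_comp := Q.tens_comp
  tens_assoc := Q.tens_assoc
  id_tens := Q.id_tens
  perm_tens := Q.perm_tens
  tens_symm := Q.tens_symm

/-- A morphism to a restriction of scalars as a semilinear morphism. -/
def PropHom.ofRestrict {P : LinProp.{u, u} R} {Q : LinProp.{u, u} S} {σ : R →+* S}
    (F : PropHom (RingHom.id R) P (Q.restrict σ)) : PropHom σ P Q where
  app n m :=
    { toFun := fun x => F.app n m x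
      map_add' := map_add (F.app n m)
      map_smul' := fun r x => map_smul (F.app n m) r x }
  map_comp := F.map_comp
  map_tens := F.map_tens
  map_perm := F.map_perm

/-! ### Morphisms out of presented props. -/

section Presented

variable {G : ℕ → ℕ → Type} {E : ∀ {n m : ℕ}, PTerm R G n m → PTerm R G n m → Prop}

variable (E) in
@[elab_as_elim]
theorem presentedProp_induction {C : ∀ {n m : ℕ}, (presentedProp E).Hom n m → Prop}
    (gen : ∀ {n m : ℕ} (g : G n m), C (n := n) (m := m) (PresHom.mk E (.gen g)))
    (perm : ∀ {n m : ℕ} (e : Fin n ≃ Fin m), C ((presentedProp E).perm e))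
    (comp : ∀ {n m p : ℕ} (x : (presentedProp E).Hom n m) (y : (presentedProp E).Hom m p),
      C x → C y → C ((presentedProp E).comp x y))
    (tens : ∀ {n m n' m' : ℕ} (x : (presentedProp E).Hom n m) (y : (presentedProp E).Hom n' m'),
      C x → C y → C ((presentedProp E).tens x y))
    (zero : ∀ {n m : ℕ}, C (0 : (presentedProp E).Hom n m))
    (add : ∀ {n m : ℕ} (x y : (presentedProp E).Hom n m), C x → C y → C (x + y))
    (smul : ∀ {n m : ℕ} (r : R) (x : (presentedProp E).Hom n m), C x → C (r • x))
    {n m : ℕ} (x : (presentedProp E).Hom n m) : C x := by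
  obtain ⟨t, rfl⟩ := PresHom.mk_surjective E x
  induction t with
  | gen g => exact gen g
  | perm e => exact perm e
  | comp x y hx hy => exact comp _ _ hx hy
  | tens x y hx hy => exact tens _ _ hx hy
  | zero => exact zero
  | add x y hx hy => exact add _ _ hx hy
  | smul r x hx => exact smul r _ hx

theorem presentedProp_hom_ext {σ : R →+* S} {Q : LinProp.{u, u} S}
    {F F' : PropHom σ (presentedProp E) Q}
    (h : ∀ {n m : ℕ} (g : G n m),
      F.app n m (PresHom.mk E (.gen g)) = F'.app n m (PresHom.mk E (.gen g))) : F = F' := by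
  apply PropHom.ext_app
  intro n m x
  induction x using presentedProp_induction E with
  | gen g => exact h g
  | perm e => rw [F.map_perm, F'.map_perm]
  | comp x y hx hy => rw [F.map_comp, F'.map_comp, hx, hy]
  | tens x y hx hy => rw [F.map_tens, F'.map_tens, hx, hy]
  | zero => rw [map_zero, map_zero]
  | add x y hx hy => rw [map_add, map_add, hx, hy]
  | smul r x hx => rw [LinearMap.map_smulₛₗ, LinearMap.map_smulₛₗ, hx]

theorem eval_presentedProp {n m : ℕ} (t : PTerm R G n m) :
    PTerm.eval (presentedProp E) (fun g => PresHom.mk E (.gen g)) t = PresHom.mk E t := by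
  induction t with
  | gen g => rfl
  | perm e => rfl
  | comp x y hx hy => exact congrArg₂ (fun a b => PresHom.comp E a b) hx hy
  | tens x y hx hy => exact congrArg₂ (fun a b => PresHom.tens E a b) hx hy
  | zero => rfl
  | add x y hx hy => exact congrArg₂ (· + ·) hx hy
  | smul r x hx => exact congrArg (r • ·) hx

end Presented

theorem PropHom.map_eval {G : ℕ → ℕ → Type} {P Q : LinProp.{u, u} R}
    (F : PropHom (RingHom.id R) P Q) (g : ∀ {n m : ℕ}, G n m → P.Hom n m) {n m : ℕ}
    (t : PTerm R G n m) :
    F.app n m (PTerm.eval P g t) = PTerm.eval Q (fun a => F.app _ _ (g a)) t := by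
  induction t with
  | gen g => rfl
  | perm e => exact F.map_perm e
  | comp x y hx hy => rw [PTerm.eval, F.map_comp, hx, hy, PTerm.eval]
  | tens x y hx hy => rw [PTerm.eval, F.map_tens, hx, hy, PTerm.eval]
  | zero => exact map_zero _
  | add x y hx hy => rw [PTerm.eval, map_add, hx, hy, PTerm.eval]
  | smul r x hx =>
    rw [PTerm.eval, map_smul, hx]
    rfl

/-! ### Transport of the algebra and Poisson axioms along morphisms. -/

section MapNest

variable {σ : R →+* S} {P : LinProp.{u, u} R} {Q : LinProp.{u, u} S} (F : PropHom σ P Q)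

theorem PropHom.map_comp_perm {n m k : ℕ} (e : Fin n ≃ Fin m) (c : P.Hom m k) :
    F.app n k (P.comp (P.perm e) c) = Q.comp (Q.perm e) (F.app m k c) := by
  rw [F.map_comp, F.map_perm]

theorem PropHom.map_tens_one {n m k : ℕ} (c : P.Hom n m) (d : P.Hom (m + 1) k) :
    F.app (n + 1) k (P.comp (P.tens c (P.perm (Equiv.refl (Fin 1)))) d) =
      Q.comp (Q.tens (F.app n m c) (Q.perm (Equiv.refl (Fin 1)))) (F.app (m + 1) k d) := by
  rw [F.map_comp, F.map_tens, F.map_perm]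

theorem PropHom.map_one_tens {n m k : ℕ} (c : P.Hom n m) (d : P.Hom (1 + m) k) :
    F.app (1 + n) k (P.comp (P.tens (P.perm (Equiv.refl (Fin 1))) c) d) =
      Q.comp (Q.tens (Q.perm (Equiv.refl (Fin 1))) (F.app n m c)) (F.app (1 + m) k d) := by
  rw [F.map_comp, F.map_tens, F.map_perm]

end MapNest

theorem LinProp.IsAlg.map {σ : R →+* S} {P : LinProp.{u, u} R} {Q : LinProp.{u, u} S}
    {e : P.Hom 0 1} {m : P.Hom 2 1} (H : P.IsAlg e m) (F : PropHom σ P Q) :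
    Q.IsAlg (F.app 0 1 e) (F.app 2 1 m) where
  assoc := (F.map_tens_one m m).symm.trans
    ((congrArg (F.app 3 1) H.assoc).trans (F.map_one_tens m m))
  one_mul := (F.map_tens_one e m).symm.trans
    ((congrArg (F.app 1 1) H.one_mul).trans (F.map_perm _))
  mul_one := (F.map_one_tens e m).symm.trans
    ((congrArg (F.app 1 1) H.mul_one).trans (F.map_perm _))

theorem LinProp.IsQuasiPoisson.map {σ : R →+* S} {P : LinProp.{u, u} R} {Q : LinProp.{u, u} S}
    {h : R} {e : P.Hom 0 1} {m b : P.Hom 2 1} (H : P.IsQuasiPoisson h e m b)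
    (F : PropHom σ P Q) :
    Q.IsQuasiPoisson (σ h) (F.app 0 1 e) (F.app 2 1 m) (F.app 2 1 b) where
  toIsAlg := H.toIsAlg.map F
  comm := by
    have h := congrArg (F.app 2 1) H.comm
    rw [map_add, LinearMap.map_smulₛₗ, LinearMap.map_smulₛₗ, F.map_comp_perm, map_neg,
      map_one] at h
    exact h
  skew := by
    have h := congrArg (F.app 2 1) H.skew
    rw [map_add, F.map_comp_perm, map_zero] at h
    exact h
  jacobi := by
    have h := congrArg (F.app 3 1) H.jacobi
    rw [map_add, map_add, F.map_comp_perm, F.map_comp_perm, map_zero] at h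
    have h1 := F.map_tens_one b b
    erw [h1] at h
    exact h
  leibniz := by
    have h := congrArg (F.app 3 1) H.leibniz
    rw [map_add, F.map_comp_perm] at h
    have h1 := F.map_tens_one b m
    have h2 := F.map_one_tens b m
    have h3 := F.map_tens_one m b
    erw [h1, h2, h3] at h
    exact h

end PropHoms

/-! ### Completions of modules over power series -/

section Adic

theorem Module.Basis.mem_ideal_smul_top_iff {R M ι : Type*} [CommRing R] [AddCommGroup M]
    [Module R M] [Finite ι] (b : Module.Basis ι R M) (I : Ideal R) (x : M) :
    x ∈ (I • ⊤ : Submodule R M) ↔ ∀ i, b.repr x i ∈ I := by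
  have := Fintype.ofFinite ι
  constructor
  · intro hx i
    have h : b.coord i x ∈ Submodule.map (b.coord i) (I • ⊤ : Submodule R M) := ⟨x, hx, rfl⟩
    rw [Submodule.map_smul''] at h
    have h' := Submodule.smul_mono (le_refl I) le_top h
    rwa [smul_eq_mul, Ideal.mul_top] at h'
  · intro h
    rw [← b.sum_repr x]
    exact Submodule.sum_mem _ fun i _ => Submodule.smul_mem_smul (h i) Submodule.mem_top

/-- Membership in `I ^ n • ⊤` is tested on the finitely many coordinates, so both separation and
existence of limits come from `R`. -/
theorem Module.Basis.isAdicComplete {R M ι : Type*} [CommRing R] [AddCommGroup M]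
    [Module R M] [Finite ι] (b : Module.Basis ι R M) (I : Ideal R) [IsAdicComplete I R] :
    IsAdicComplete I M where
  haus' x hx := by
    apply b.repr.injective
    ext i
    rw [map_zero, Finsupp.zero_apply]
    refine IsHausdorff.haus (I := I) inferInstance _ fun n => ?_
    have h := (b.mem_ideal_smul_top_iff _ _).1 (SModEq.zero.1 (hx n)) i
    rw [SModEq.zero]
    rwa [smul_eq_mul, Ideal.mul_top]
  prec' f hf := by
    have := Fintype.ofFinite ι
    have h : ∀ i, ∃ L : R, ∀ n, b.repr (f n) i ≡ L [SMOD (I ^ n • ⊤ : Submodule R R)] := by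
      intro i
      refine IsPrecomplete.prec (I := I) inferInstance fun {m n} hmn => ?_
      have h1 := (b.mem_ideal_smul_top_iff _ _).1 (SModEq.sub_mem.1 (hf hmn)) i
      rw [map_sub, Finsupp.sub_apply] at h1
      rw [SModEq.sub_mem, smul_eq_mul, Ideal.mul_top]
      exact h1
    choose L hL using h
    refine ⟨∑ i, L i • b i, fun n => ?_⟩
    rw [SModEq.sub_mem, b.mem_ideal_smul_top_iff]
    intro i
    have h1 := hL i n
    rw [SModEq.sub_mem, smul_eq_mul, Ideal.mul_top] at h1
    rwa [map_sub, Finsupp.sub_apply, b.repr_sum_self]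

variable {K : Type u} [Field K]

instance : IsAdicComplete (hIdeal K) K⟦X⟧ :=
  inferInstanceAs (IsAdicComplete (Ideal.span {PowerSeries.X}) K⟦X⟧)

theorem X_pow_mem_nonZeroDivisors (k : ℕ) :
    (PowerSeries.X ^ k : K⟦X⟧) ∈ nonZeroDivisors K⟦X⟧ :=
  mem_nonZeroDivisors_of_ne_zero (pow_ne_zero k PowerSeries.X_ne_zero)

variable {M : Type u} [AddCommGroup M] [Module K⟦X⟧ M] {T : Submodule K⟦X⟧ M} {j : ℕ}
  {ι : Type*} [Finite ι]

/-- `M ⧸ T` is already complete, so the image of `x` in its completion comes from some `p` in `M`.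
The difference of `x` and `p` is then represented at every level by an element of `T` modulo `(ħ) ^
k`, and is killed by `ħ ^ j`. -/
theorem exists_sub_of_mem_torsion (hT : ∀ x ∈ T, (PowerSeries.X : K⟦X⟧) ^ j • x = 0)
    (b : Module.Basis ι K⟦X⟧ (M ⧸ T)) (x : AdicCompletion (hIdeal K) M) :
    ∃ p : M, x - AdicCompletion.of (hIdeal K) M p ∈
      Submodule.torsion K⟦X⟧ (AdicCompletion (hIdeal K) M) := by
  have := b.isAdicComplete (hIdeal K)
  obtain ⟨y, hy⟩ := (AdicCompletion.of_bijective (hIdeal K) (M ⧸ T)).2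
    (AdicCompletion.map (hIdeal K) T.mkQ x)
  obtain ⟨p, rfl⟩ := T.mkQ_surjective y
  refine ⟨p, ?_⟩
  set z := x - AdicCompletion.of (hIdeal K) M p with hz
  have hz0 : AdicCompletion.map (hIdeal K) T.mkQ z = 0 := by
    rw [hz, map_sub, AdicCompletion.map_of, hy, sub_self]
  rw [Submodule.mem_torsion_iff]
  refine ⟨⟨_, X_pow_mem_nonZeroDivisors j⟩, ?_⟩
  apply adicCompletion_ext
  intro k
  obtain ⟨q, hq⟩ := Submodule.Quotient.mk_surjective _ (z.1 k)
  have h1 : (AdicCompletion.map (hIdeal K) T.mkQ z).1 k = 0 := by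
    rw [hz0]
    rfl
  rw [AdicCompletion.map_val_apply, ← hq] at h1
  have h2 : T.mkQ q ∈ (hIdeal K ^ k • ⊤ : Submodule K⟦X⟧ (M ⧸ T)) :=
    (Submodule.Quotient.mk_eq_zero _).1 h1
  have h3 : (hIdeal K ^ k • ⊤ : Submodule K⟦X⟧ (M ⧸ T)) =
      (hIdeal K ^ k • ⊤ : Submodule K⟦X⟧ M).map T.mkQ := by
    rw [Submodule.map_smul'', Submodule.map_top, Submodule.range_mkQ]
  rw [h3] at h2
  obtain ⟨r, hr, hrq⟩ := h2
  have h4 : q - r ∈ T := by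
    rw [← Submodule.Quotient.mk_eq_zero, Submodule.Quotient.mk_sub, sub_eq_zero]
    exact hrq.symm
  have h5 := hT _ h4
  rw [smul_sub, sub_eq_zero] at h5
  change (PowerSeries.X : K⟦X⟧) ^ j • z.1 k = 0
  rw [← hq, ← Submodule.Quotient.mk_smul, h5, Submodule.Quotient.mk_eq_zero]
  exact Submodule.smul_mem _ _ hr

/-- The completion of `M` maps to that of `M ⧸ T`, which is the torsion-free module `M ⧸ T` itself,
so a torsion class has image zero there. With the preceding lemma, completing `M` and dividing by
torsion yields `M ⧸ T`. -/
theorem mem_of_of_mem_torsion (b : Module.Basis ι K⟦X⟧ (M ⧸ T)) {p : M}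
    (hp : AdicCompletion.of (hIdeal K) M p ∈
      Submodule.torsion K⟦X⟧ (AdicCompletion (hIdeal K) M)) : p ∈ T := by
  have := b.isAdicComplete (hIdeal K)
  rw [Submodule.mem_torsion_iff] at hp
  obtain ⟨⟨r, hr⟩, hrp⟩ := hp
  have h : AdicCompletion.of (hIdeal K) M (r • p) = 0 := by
    rw [map_smul]
    exact hrp
  have h1 := congrArg (AdicCompletion.map (hIdeal K) T.mkQ) h
  rw [AdicCompletion.map_of, map_zero] at h1
  have h2 : T.mkQ (r • p) = 0 :=
    (AdicCompletion.of_bijective (hIdeal K) (M ⧸ T)).1 (h1.trans (map_zero _).symm)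
  rw [map_smul] at h2
  have h3 : T.mkQ p = 0 := by
    apply b.repr.injective
    ext1 i
    have h4 := congrArg (fun z => b.repr z i) h2
    simp only [map_smul, Finsupp.smul_apply, map_zero, Finsupp.zero_apply, smul_eq_mul] at h4 ⊢
    exact (mul_eq_zero.1 h4).resolve_left (nonZeroDivisors.ne_zero hr)
  exact (Submodule.Quotient.mk_eq_zero _).1 h3

theorem topFree_of_basis {ι : Type} [Finite ι] (b : Module.Basis ι K⟦X⟧ M) : TopFree K M := by
  let V := ULift.{u} ι →₀ K
  let c : Module.Basis (ULift.{u} ι) K⟦X⟧ (K⟦X⟧ ⊗[K] V) :=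
    (Finsupp.basisSingleOne (R := K) (ι := ULift.{u} ι)).baseChange K⟦X⟧
  have := c.isAdicComplete (hIdeal K)
  exact ⟨V, inferInstance, inferInstance,
    ⟨(b.equiv c Equiv.ulift.symm).trans (AdicCompletion.ofLinearEquiv (hIdeal K) _)⟩⟩

end Adic

/-! ### The prop of quasi-commutative algebras without completion -/

section Torsion

variable {R : Type u} [CommRing R]

/-- The ideal of the operations annihilated by a scalar. -/
def LinProp.torsionByIdeal (P : LinProp.{u, u} R) (a : R) : PropIdeal P where
  carrier n m := Submodule.torsionBy R (P.Hom n m) a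
  comp_left {n m p x} y hx := by
    rw [Submodule.mem_torsionBy_iff] at hx ⊢
    rw [← LinearMap.map_smul₂, hx, LinearMap.map_zero₂]
  comp_right {n m p} x y hy := by
    rw [Submodule.mem_torsionBy_iff] at hy ⊢
    rw [← map_smul, hy, map_zero]
  tens_left {n m n' m' x} y hx := by
    rw [Submodule.mem_torsionBy_iff] at hx ⊢
    rw [← LinearMap.map_smul₂, hx, LinearMap.map_zero₂]
  tens_right {n m n' m'} x y hy := by
    rw [Submodule.mem_torsionBy_iff] at hy ⊢
    rw [← map_smul, hy, map_zero]

theorem LinProp.mem_torsionByIdeal (P : LinProp.{u, u} R) (a : R) {n m : ℕ} (x : P.Hom n m) :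
    x ∈ (P.torsionByIdeal a).carrier n m ↔ a • x = 0 := Submodule.mem_torsionBy_iff a x

/-! ### The powers of `h` after which the Poisson axioms follow from the commutator relation. -/

section Commutator

variable {A : Type*} [Ring A] [Algebra R A] {h : R} {br : A →ₗ[R] A →ₗ[R] A}
  (H : ∀ a b, a * b - b * a = h • br a b)
include H

theorem smul_skew_of_commutator (a b : A) : h • (br a b + br b a) = 0 := by
  rw [smul_add, ← H, ← H]
  abel

/-- `h` times the bracket with `c` is the commutator with `c`, a derivation. -/
theorem smul_leibniz_of_commutator (a b c : A) :
    h • (br (a * b) c) = h • (a * br b c + br a c * b) := by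
  rw [smul_add, ← mul_smul_comm, ← smul_mul_assoc, ← H, ← H, ← H]
  noncomm_ring

theorem smul_nest_of_commutator (a b c : A) :
    h ^ 2 • br (br a b) c = (a * b - b * a) * c - c * (a * b - b * a) := by
  rw [pow_two, mul_smul, ← H, smul_sub, ← smul_mul_assoc, ← mul_smul_comm, ← H]

/-- `h ^ 2` times an iterated bracket is a double commutator, and commutators satisfy Jacobi in an
associative algebra. -/
theorem smul_jacobi_of_commutator (a b c : A) :
    h ^ 2 • (br (br a b) c + br (br b c) a + br (br c a) b) = 0 := by
  rw [smul_add, smul_add, smul_nest_of_commutator H, smul_nest_of_commutator H,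
    smul_nest_of_commutator H]
  noncomm_ring

end Commutator

open FreePow in
/-- In the quotient by the ideal of the operations annihilated by `h ^ 2`, a multiple by `h ^ (-1)`
of the commutator is a deformed Poisson bracket. -/
theorem LinProp.IsAlg.isQuasiPoisson_quot {P : LinProp.{u, u} R} {e : P.Hom 0 1} {m b : P.Hom 2 1}
    (HA : P.IsAlg e m) {h : R}
    (hc : m + (-1 : R) • P.comp (P.perm (Equiv.swap (0 : Fin 2) 1)) m = h • b) :
    (P.quot (P.torsionByIdeal (h ^ 2))).IsQuasiPoisson h
      ((P.torsionByIdeal (h ^ 2)).proj.app 0 1 e) ((P.torsionByIdeal (h ^ 2)).proj.app 2 1 m)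
      ((P.torsionByIdeal (h ^ 2)).proj.app 2 1 b) where
  toIsAlg := HA.map _
  comm := congrArg ((P.torsionByIdeal (h ^ 2)).proj.app 2 1) hc
  skew := by
    refine (Submodule.Quotient.mk_eq_zero _).2 ((P.mem_torsionByIdeal _ _).2 ?_)
    have H : ∀ x y : FreeAlg HA (Fin 2), x * y - y * x = h • FreeAlg.bin HA b x y :=
      op_commutator hc
    -- The identity is tested on letters of the free algebra. One factor `h` already suffices for
    -- skew symmetry; the second serves to put all the axioms in one ideal.
    apply eq_of_act_var
    rw [map_smul, map_add, act_swap, act_tensN_two, map_zero, pow_two, mul_smul]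
    exact (congrArg (h • ·) (smul_skew_of_commutator H (var P 0) (var P 1))).trans
      (smul_zero (A := FreeAlg HA (Fin 2)) h)
  jacobi := by
    refine (Submodule.Quotient.mk_eq_zero _).2 ((P.mem_torsionByIdeal _ _).2 ?_)
    have H : ∀ x y : FreeAlg HA (Fin 3), x * y - y * x = h • FreeAlg.bin HA b x y :=
      op_commutator hc
    apply eq_of_act_var
    rw [map_smul, act_jacobi, map_zero]
    exact smul_jacobi_of_commutator H (var P 0) (var P 1) (var P 2)
  leibniz := by
    refine (Submodule.Quotient.eq _).2 ((P.mem_torsionByIdeal _ _).2 ?_)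
    have H : ∀ x y : FreeAlg HA (Fin 3), x * y - y * x = h • FreeAlg.bin HA b x y :=
      op_commutator hc
    apply eq_of_act_var
    rw [map_smul, map_sub, act_nestLeft, act_leibniz, map_zero, pow_two, mul_smul, smul_sub]
    exact (congrArg (h • ·) (sub_eq_zero.2
      (smul_leibniz_of_commutator H (var P 0) (var P 1) (var P 2)))).trans
        (smul_zero (A := FreeAlg HA (Fin 3)) h)

/-- The extension of scalars as a morphism of props. -/
def LinProp.toBaseChange (P : LinProp.{u, u} R) (S : Type u) [CommRing S] [Algebra R S] :
    PropHom (algebraMap R S) P (P.baseChange S) where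
  app n m :=
    { toFun := fun x => ((1 : S) ⊗ₜ[R] x : S ⊗[R] P.Hom n m)
      map_add' := fun x y => TensorProduct.tmul_add _ _ _
      map_smul' := fun r x => by
        rw [TensorProduct.tmul_smul, ← algebraMap_smul S r]
        rfl }
  map_comp x y := by
    change _ = (((1 : S) * 1) ⊗ₜ[R] _ : S ⊗[R] P.Hom _ _)
    rw [mul_one]
    rfl
  map_tens x y := by
    change _ = (((1 : S) * 1) ⊗ₜ[R] _ : S ⊗[R] P.Hom _ _)
    rw [mul_one]
    rfl
  map_perm e := rfl

end Torsion

/-! ### The presented prop before completion and its quotient by `ħ²`-torsion. -/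

section QComm

variable (K : Type u) [Field K]

/-- The prop `Alg[[ħ]]⟨P⟩ / (m - m ∘ (21) = ħ P)` without completion. -/
abbrev qcommPres : LinProp.{u, u} K⟦X⟧ := presentedProp (QCommRel K)

/-- A generator of `qcommPres`. -/
def qcommPresGen {n m : ℕ} (g : BracketGen n m) : (qcommPres K).Hom n m :=
  PresHom.mk (QCommRel K) (.gen g)

theorem qcommPres_isAlg : (qcommPres K).IsAlg (qcommPresGen K .unit) (qcommPresGen K .mul) where
  assoc := PresHom.sound _ (.of .assoc)
  one_mul := PresHom.sound _ (.of .one_mul)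
  mul_one := PresHom.sound _ (.of .mul_one)

theorem qcommPres_comm : qcommPresGen K .mul + (-1 : K⟦X⟧) •
    (qcommPres K).comp ((qcommPres K).perm (Equiv.swap (0 : Fin 2) 1)) (qcommPresGen K .mul) =
      (PowerSeries.X : K⟦X⟧) • qcommPresGen K .bracket :=
  PresHom.sound _ (.of .quasi_comm)

/-- The ideal of the operations of `qcommPres` annihilated by `ħ ^ 2`. -/
abbrev qcommIdeal : PropIdeal (qcommPres K) := (qcommPres K).torsionByIdeal (PowerSeries.X ^ 2)

/-- The quotient of `qcommPres` by the ideal of the operations annihilated by `ħ ^ 2`. -/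
abbrev qcommFree : LinProp.{u, u} K⟦X⟧ := (qcommPres K).quot (qcommIdeal K)

/-- A generator of `qcommFree`. -/
def qcommFreeGen {n m : ℕ} (g : BracketGen n m) : (qcommFree K).Hom n m :=
  (qcommIdeal K).proj.app n m (qcommPresGen K g)

theorem qcommFree_isQuasiPoisson : (qcommFree K).IsQuasiPoisson PowerSeries.X
    (qcommFreeGen K .unit) (qcommFreeGen K .mul) (qcommFreeGen K .bracket) :=
  (qcommPres_isAlg K).isQuasiPoisson_quot (qcommPres_comm K)

theorem bracketVal_gen {R : Type u} [CommRing R] {P : LinProp.{u, u} R}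
    (g : ∀ {n m : ℕ}, BracketGen n m → P.Hom n m) {n m : ℕ} (a : BracketGen n m) :
    bracketVal (g .unit) (g .mul) (g .bracket) a = g a := by
  cases a <;> rfl

variable {K} in
theorem qcommFree_eval {n m : ℕ} (x : (qcommFree K).Hom n m) : ∃ t, PTerm.eval (qcommFree K)
    (bracketVal (qcommFreeGen K .unit) (qcommFreeGen K .mul) (qcommFreeGen K .bracket)) t = x := by
  obtain ⟨x, rfl⟩ := (qcommIdeal K).proj_surjective n m x
  obtain ⟨t, rfl⟩ := PresHom.mk_surjective _ x
  refine ⟨t, Eq.trans ?_ (((qcommIdeal K).proj.map_eval (qcommPresGen K) t).symm.trans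
    (congrArg _ (eval_presentedProp t)))⟩
  congr 1
  funext n m g
  exact bracketVal_gen (qcommFreeGen K) g

/-- The standard products of iterated brackets in `qcommFree`. -/
def qcommOp {N n : ℕ} (V : Fin n → List (Fin N × List (Fin N))) : (qcommFree K).Hom N n :=
  lieOp (qcommFreeGen K .unit) (qcommFreeGen K .mul) (qcommFreeGen K .bracket) V

theorem span_qcommOp (N n : ℕ) :
    Submodule.span K⟦X⟧ (Set.range fun V : StandardIdx N n => qcommOp K V.1) = ⊤ :=
  (qcommFree_isQuasiPoisson K).span_lieOp qcommFree_eval N n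

variable {K} in
/-- The morphism from `qcommPres` given by a product and a bracket. -/
def qcommLift {S : Type u} [CommRing S] (σ : K⟦X⟧ →+* S) {Q : LinProp.{u, u} S} {e : Q.Hom 0 1}
    {m b : Q.Hom 2 1} (HA : Q.IsAlg e m)
    (hc : m + (-1 : S) • Q.comp (Q.perm (Equiv.swap (0 : Fin 2) 1)) m = σ PowerSeries.X • b) :
    PropHom σ (qcommPres K) Q :=
  PropHom.ofRestrict (presentedLift (QCommRel K) (Q.restrict σ) (bracketVal (P := Q) e m b) (by
    intro n k x y h
    cases h with
    | assoc => exact HA.assoc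
    | one_mul => exact HA.one_mul
    | mul_one => exact HA.mul_one
    | quasi_comm =>
      change m + σ (-1) • Q.comp (Q.perm (Equiv.swap (0 : Fin 2) 1)) m = σ PowerSeries.X • b
      rw [map_neg, map_one]
      exact hc))

end QComm

/-! ### The embedding in Laurent series -/

section Embedding

variable (K : Type u) [Field K]

attribute [local instance 2000] HahnSeries.instAlgebra

attribute [local instance] laurentSMulComm

/-- The embedding of the prop of algebras in its extension of scalars to Laurent series. -/
def algToLaurent : PropHom (algebraMap K K⸨X⸩) (algProp K) (algLaurent K) :=
  (algProp K).toBaseChange K⸨X⸩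

theorem algToLaurent_apply {N n : ℕ} (x : (algProp K).Hom N n) :
    (algToLaurent K).app N n x = algLaurentMk K 1 x := rfl

theorem smul_algLaurentMk {N n : ℕ} (f g : K⸨X⸩) (x : (algProp K).Hom N n) :
    f • algLaurentMk K g x = algLaurentMk K (f * g) x := rfl

theorem algebraMap_X : algebraMap K⟦X⟧ K⸨X⸩ PowerSeries.X = HahnSeries.single (1 : ℤ) (1 : K) :=
  HahnSeries.ofPowerSeries_X

theorem X_smul_laurentBracket : algebraMap K⟦X⟧ K⸨X⸩ PowerSeries.X •
    algLaurentMk K (HahnSeries.single (-1 : ℤ) (1 : K)) (algComm K) =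
      (algToLaurent K).app 2 1 (algComm K) := by
  rw [smul_algLaurentMk, algebraMap_X, HahnSeries.single_mul_single, mul_one, algToLaurent_apply]
  rfl

theorem laurent_comm : (algToLaurent K).app 2 1 (algGen K .mul) + (-1 : K⸨X⸩) •
    (algLaurent K).comp ((algLaurent K).perm (Equiv.swap (0 : Fin 2) 1))
      ((algToLaurent K).app 2 1 (algGen K .mul)) =
    algebraMap K⟦X⟧ K⸨X⸩ PowerSeries.X •
      algLaurentMk K (HahnSeries.single (-1 : ℤ) (1 : K)) (algComm K) := by
  rw [X_smul_laurentBracket, algComm, map_sub, PropHom.map_comp_perm, neg_one_smul, sub_eq_add_neg]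

/-- The morphism from `qcommPres` to `Alg((ħ))`. -/
def qcommPresToLaurent : PropHom (algebraMap K⟦X⟧ K⸨X⸩) (qcommPres K) (algLaurent K) :=
  qcommLift _ ((algProp_isAlg K).map (algToLaurent K)) (laurent_comm K)

theorem algebraMap_injective : Function.Injective (algebraMap K⟦X⟧ K⸨X⸩) :=
  HahnSeries.ofPowerSeries_injective

/-- The embedding of `qcommFree` in `Alg((ħ))`. -/
def qcommFreeToLaurent : PropHom (algebraMap K⟦X⟧ K⸨X⸩) (qcommFree K) (algLaurent K) :=
  (qcommIdeal K).lift (qcommPresToLaurent K) (by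
    intro n m x hx
    rw [LinProp.mem_torsionByIdeal] at hx
    have h := congrArg ((qcommPresToLaurent K).app n m) hx
    rw [LinearMap.map_smulₛₗ, map_zero, map_pow] at h
    -- The target is a vector space over Laurent series, in which `ħ²` is invertible, so
    -- `ħ²`-torsion maps to zero.
    refine (smul_eq_zero.1 h).resolve_left (pow_ne_zero 2 ?_)
    rw [algebraMap_X]
    exact HahnSeries.single_ne_zero one_ne_zero)

theorem qcommFreeToLaurent_bracket : (qcommFreeToLaurent K).app 2 1 (qcommFreeGen K .bracket) =
    algLaurentMk K (HahnSeries.single (-1 : ℤ) (1 : K)) (algComm K) := rfl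

variable {K}

/-- The standard products of iterated commutators in the prop of algebras. -/
def algOp {N n : ℕ} (V : Fin n → List (Fin N × List (Fin N))) : (algProp K).Hom N n :=
  lieOp (algGen K .unit) (algGen K .mul) (algComm K) V

/-- The bracket goes to `ħ⁻¹` times the commutator, so every bracket in the product contributes a
factor `ħ⁻¹`. -/
theorem qcommFreeToLaurent_qcommOp {N n : ℕ} (V : Fin n → List (Fin N × List (Fin N))) :
    (qcommFreeToLaurent K).app N n (qcommOp K V) =
      HahnSeries.single (-1 : ℤ) (1 : K) ^ (∑ j, bracketCount (V j)) •
        (algToLaurent K).app N n (algOp V) := by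
  have h : algLaurentMk K (HahnSeries.single (-1 : ℤ) (1 : K)) (algComm K) =
      HahnSeries.single (-1 : ℤ) (1 : K) • (algToLaurent K).app 2 1 (algComm K) := by
    rw [algToLaurent_apply, smul_algLaurentMk, mul_one]
  rw [qcommOp, map_lieOp, qcommFreeToLaurent_bracket, h, lieOp_smul, algOp, map_lieOp]
  rfl

/-- Independence over `K` in `Alg(N, n)` survives extension of scalars to Laurent series and
rescaling by the invertible powers of `ħ`. -/
theorem linearIndependent_qcommFreeToLaurent (N n : ℕ) :
    LinearIndependent K⸨X⸩ fun V : StandardIdx N n =>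
      (qcommFreeToLaurent K).app N n (qcommOp K V.1) := by
  have h : LinearIndependent K⸨X⸩ fun V : StandardIdx N n =>
      (algToLaurent K).app N n (algOp V.1) :=
    Module.Flat.linearIndependent_one_tmul (linearIndependent_lieOp (K := K) N n)
  have h0 : (HahnSeries.single (-1 : ℤ) (1 : K) : K⸨X⸩) ≠ 0 :=
    HahnSeries.single_ne_zero one_ne_zero
  have h1 := h.units_smul fun V => Units.mk0 _ h0 ^ (∑ j, bracketCount (V.1 j))
  convert h1 using 1
  funext V
  exact qcommFreeToLaurent_qcommOp V.1

theorem eq_zero_of_qcommFreeToLaurent_sum {N n : ℕ} [Fintype (StandardIdx N n)]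
    {g : StandardIdx N n → K⟦X⟧}
    (h : (qcommFreeToLaurent K).app N n (∑ V, g V • qcommOp K V.1) = 0) (V : StandardIdx N n) :
    g V = 0 := by
  rw [map_sum] at h
  simp only [LinearMap.map_smulₛₗ] at h
  have h1 := Fintype.linearIndependent_iff.1 (linearIndependent_qcommFreeToLaurent N n)
    (fun V => algebraMap K⟦X⟧ K⸨X⸩ (g V)) h V
  exact algebraMap_injective K (h1.trans (map_zero _).symm)

variable (K) in
/-- The standard products of iterated brackets form a basis of the operations of `qcommFree`. -/
def qcommBasis (N n : ℕ) : Module.Basis (StandardIdx N n) K⟦X⟧ ((qcommFree K).Hom N n) :=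
  Module.Basis.mk (v := fun V => qcommOp K V.1)
    (by
      have := Fintype.ofFinite (StandardIdx N n)
      refine Fintype.linearIndependent_iff.2 fun g hg => eq_zero_of_qcommFreeToLaurent_sum ?_
      rw [hg, map_zero])
    (span_qcommOp K N n).ge

theorem qcommBasis_apply {N n : ℕ} (V : StandardIdx N n) :
    qcommBasis K N n V = qcommOp K V.1 := Module.Basis.mk_apply _ _ V

/-- The embedding carries a basis to a family that is independent over the larger ring of Laurent
series. -/
theorem qcommFreeToLaurent_injective (N n : ℕ) :
    Function.Injective ((qcommFreeToLaurent K).app N n) := by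
  have := Fintype.ofFinite (StandardIdx N n)
  rw [injective_iff_map_eq_zero]
  intro x hx
  apply (qcommBasis K N n).repr.injective
  ext1 V
  rw [map_zero]
  rw [← (qcommBasis K N n).sum_repr x] at hx
  simp only [qcommBasis_apply] at hx
  exact eq_zero_of_qcommFreeToLaurent_sum hx V

/-! ### Comparison with the completed prop -/

variable (K) in
/-- The morphism from `qcommPres` to `qcommProp`. -/
def qcommPresToProp : PropHom (RingHom.id K⟦X⟧) (qcommPres K) (qcommProp K) :=
  ((qcommPres K).toCompletion (hIdeal K)).trans (qcommFull K).torsionIdeal.proj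

variable (K) in
/-- The morphism from `qcommFree` to `qcommProp`. -/
def qcommFreeToProp : PropHom (RingHom.id K⟦X⟧) (qcommFree K) (qcommProp K) :=
  (qcommIdeal K).lift (qcommPresToProp K) (by
    intro n m x hx
    rw [LinProp.mem_torsionByIdeal] at hx
    refine (Submodule.Quotient.mk_eq_zero _).2 (Submodule.mem_torsion_iff _ |>.2
      ⟨⟨_, X_pow_mem_nonZeroDivisors 2⟩, ?_⟩)
    have h := congrArg (((qcommPres K).toCompletion (hIdeal K)).app n m) hx
    rw [map_smul, map_zero] at h
    exact h)

/-- Modulo torsion, every operation of the completed prop comes from an uncompleted one. Morphisms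
out of `qcommProp` are therefore determined on generators, with no continuity assumption. -/
theorem qcommPresToProp_surjective (N n : ℕ) :
    Function.Surjective ((qcommPresToProp K).app N n) := by
  intro y
  obtain ⟨x, rfl⟩ := (qcommFull K).torsionIdeal.proj_surjective N n y
  obtain ⟨p, hp⟩ := exists_sub_of_mem_torsion (T := (qcommIdeal K).carrier N n) (j := 2)
    (fun x hx => (LinProp.mem_torsionByIdeal _ _ _).1 hx) (qcommBasis K N n) x
  exact ⟨p, ((Submodule.Quotient.eq _).2 hp).symm⟩

/-- Since `qcommFree` has a finite basis in each bidegree, it is complete and torsion-free, so the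
`ħ²`-torsion was all the torsion and completion adds nothing. -/
theorem qcommFreeToProp_bijective (N n : ℕ) :
    Function.Bijective ((qcommFreeToProp K).app N n) := by
  constructor
  · rw [injective_iff_map_eq_zero]
    intro x hx
    obtain ⟨p, rfl⟩ := (qcommIdeal K).proj_surjective N n x
    refine ((qcommIdeal K).proj_eq_zero_iff).2 (mem_of_of_mem_torsion (qcommBasis K N n) ?_)
    exact (Submodule.Quotient.mk_eq_zero _).1 hx
  · intro y
    obtain ⟨p, rfl⟩ := qcommPresToProp_surjective N n y
    exact ⟨(qcommIdeal K).proj.app N n p, rfl⟩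

end Embedding

/-! ### The prop of quasi-commutative algebras -/

section Main

variable (K : Type u) [Field K]

attribute [local instance 2000] HahnSeries.instAlgebra

attribute [local instance] laurentSMulComm

/-- The embedding of the prop of quasi-commutative algebras in `Alg((ħ))`. -/
def qcommToLaurent : PropHom (algebraMap K⟦X⟧ K⸨X⸩) (qcommProp K) (algLaurent K) :=
  ((qcommFreeToProp K).inv qcommFreeToProp_bijective).trans (qcommFreeToLaurent K)

variable {K}

theorem qcommToLaurent_app {N n : ℕ} (x : (qcommFree K).Hom N n) :
    (qcommToLaurent K).app N n ((qcommFreeToProp K).app N n x) =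
      (qcommFreeToLaurent K).app N n x :=
  congrArg ((qcommFreeToLaurent K).app N n) (PropHom.inv_app _ _ x)

theorem qcommToLaurent_unit : (qcommToLaurent K).app 0 1 (qcommGen K .unit) =
    algLaurentMk K 1 (algGen K .unit) := qcommToLaurent_app (qcommFreeGen K .unit)

theorem qcommToLaurent_mul : (qcommToLaurent K).app 2 1 (qcommGen K .mul) =
    algLaurentMk K 1 (algGen K .mul) := qcommToLaurent_app (qcommFreeGen K .mul)

theorem qcommToLaurent_bracket : (qcommToLaurent K).app 2 1 (qcommGen K .bracket) =
    algLaurentMk K (HahnSeries.single (-1 : ℤ) (1 : K)) (algComm K) :=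
  qcommToLaurent_app (qcommFreeGen K .bracket)

theorem qcommToLaurent_injective (N n : ℕ) : Function.Injective ((qcommToLaurent K).app N n) := by
  intro x y hxy
  obtain ⟨x, rfl⟩ := (qcommFreeToProp_bijective N n).2 x
  obtain ⟨y, rfl⟩ := (qcommFreeToProp_bijective N n).2 y
  rw [qcommToLaurent_app, qcommToLaurent_app] at hxy
  rw [qcommFreeToLaurent_injective N n hxy]

theorem qcommProp_isQuasiPoisson : (qcommProp K).IsQuasiPoisson PowerSeries.X
    (qcommGen K .unit) (qcommGen K .mul) (qcommGen K .bracket) :=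
  (qcommFree_isQuasiPoisson K).map (qcommFreeToProp K)

theorem qcommToLaurent_unique
    (F : PropHom (algebraMap K⟦X⟧ K⸨X⸩) (qcommProp K) (algLaurent K))
    (h0 : F.app 0 1 (qcommGen K .unit) = algLaurentMk K 1 (algGen K .unit))
    (h1 : F.app 2 1 (qcommGen K .mul) = algLaurentMk K 1 (algGen K .mul)) :
    F = qcommToLaurent K := by
  -- `ħ` times the image of the bracket is the commutator of the image of `m`, and `ħ` is invertible
  -- in Laurent series.
  have h2 : F.app 2 1 (qcommGen K .bracket) =
      (qcommToLaurent K).app 2 1 (qcommGen K .bracket) := by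
    have e1 := (qcommProp_isQuasiPoisson.map F).comm
    have e2 := (qcommProp_isQuasiPoisson.map (qcommToLaurent K)).comm
    rw [h1, ← qcommToLaurent_mul, e2] at e1
    refine (smul_right_injective _ ?_ e1).symm
    rw [algebraMap_X]
    exact HahnSeries.single_ne_zero one_ne_zero
  have h3 : (qcommPresToProp K).trans F = (qcommPresToProp K).trans (qcommToLaurent K) := by
    apply presentedProp_hom_ext
    intro n m g
    cases g with
    | unit => exact h0.trans qcommToLaurent_unit.symm
    | mul => exact h1.trans qcommToLaurent_mul.symm
    | bracket => exact h2
  apply PropHom.ext_app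
  intro n m y
  obtain ⟨x, rfl⟩ := qcommPresToProp_surjective n m y
  exact congrArg (fun G => G.app n m x) h3

/-! ### The image in Laurent series -/

/-- Power series act on the tensor product through the Laurent series scalars and directly on the
left factor. The two structures are different instances and have to be matched. -/
theorem laurent_smul_eq (r : K⟦X⟧) {M : Type u} [AddCommGroup M] [Module K M] (z : K⸨X⸩ ⊗[K] M) :
    algebraMap K⟦X⟧ K⸨X⸩ r • z = r • z := by
  induction z with
  | zero => exact (smul_zero _).trans (TensorProduct.smul_zero _).symm
  | add x y hx hy =>
    exact (smul_add _ _ _).trans ((congrArg₂ (· + ·) hx hy).trans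
      (TensorProduct.smul_add _ _ _).symm)
  | tmul f x =>
    rw [TensorProduct.smul_tmul', TensorProduct.smul_tmul', algebraMap_smul]

theorem C_smul_tmul (r : K) {M : Type u} [AddCommGroup M] [Module K M] (f : K⸨X⸩) (x : M) :
    f ⊗ₜ[K] (r • x) = (PowerSeries.C r : K⟦X⟧) • (f ⊗ₜ[K] x) := by
  have h : (PowerSeries.C r : K⟦X⟧) • f = r • f := by
    rw [Algebra.smul_def, Algebra.smul_def]
    congr 1
    exact HahnSeries.ofPowerSeries_C r
  rw [TensorProduct.smul_tmul', h, TensorProduct.smul_tmul]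

variable (K) in
/-- The embedding of `qcommFree` in `U(FL_N)^{⊗ n}((ħ))`. -/
def qcommFreeEval (N n : ℕ) : (qcommFree K).Hom N n →ₗ[K⟦X⟧] LaurentTPow K N n where
  toFun x := algLaurentEval K N n ((qcommFreeToLaurent K).app N n x)
  map_add' x y := by rw [map_add, map_add]
  map_smul' r x := by
    rw [LinearMap.map_smulₛₗ, map_smul]
    exact laurent_smul_eq r _

theorem qcommFreeEval_qcommOp {N n : ℕ} (V : Fin n → List (Fin N × List (Fin N))) :
    qcommFreeEval K N n (qcommOp K V) =
      HahnSeries.single (-(∑ j, bracketCount (V j) : ℕ) : ℤ) (1 : K) ⊗ₜ[K]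
        algEval K N n (algOp V) := by
  change algLaurentEval K N n ((qcommFreeToLaurent K).app N n (qcommOp K V)) = _
  rw [qcommFreeToLaurent_qcommOp, algToLaurent_apply, smul_algLaurentMk, mul_one,
    HahnSeries.single_pow, one_pow, nsmul_eq_mul, mul_neg_one]
  rfl

theorem sum_length_add_bracketCount {N n : ℕ} {V : Fin n → List (Fin N × List (Fin N))}
    (hV : ∑ j, (blockWord (V j) : Multiset (Fin N)) = Finset.univ.val) :
    ∑ j, (V j).length + ∑ j, bracketCount (V j) = N := by
  have h := congrArg Multiset.card hV
  rw [Multiset.card_sum, Finset.card_val, Finset.card_univ, Fintype.card_fin] at h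
  simp only [Multiset.coe_card, length_blockWord] at h
  rwa [Finset.sum_add_distrib] at h

/-- A standard product of `k` brackets has `N - k` nested brackets, hence the factor `ħ ^ (k - N)`
and filtration degree `k`. Conversely the filtration is spanned by products of at most `k` brackets,
whose multilinear ones are in the range up to nonnegative powers of `ħ`. -/
theorem range_qcommFreeEval (N n : ℕ) :
    LinearMap.range (qcommFreeEval K N n) = qcommLattice K N n := by
  apply le_antisymm
  · rw [LinearMap.range_eq_map, ← span_qcommOp, Submodule.map_span, Submodule.span_le]
    rintro _ ⟨_, ⟨V, rfl⟩, rfl⟩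
    have hV := V.2.2
    have hw : algEval K N n (algOp V.1) ∈ tpowFilt K N n (∑ j, (V.1 j).length) ⊓
        multidegreePart K N n (fun _ => 1) := by
      refine ⟨?_, ?_⟩
      · rw [algOp, algEval_lieOp hV]
        exact lieTensor_mem_tpowFilt V.1
      · rw [← range_algEval]
        exact ⟨_, rfl⟩
    refine Submodule.mem_iSup_of_mem (∑ j, (V.1 j).length)
      (Submodule.subset_span ⟨_, hw, ?_⟩)
    have e := sum_length_add_bracketCount hV
    have e' : (-(∑ j, bracketCount (V.1 j) : ℕ) : ℤ) =
        ((∑ j, (V.1 j).length : ℕ) : ℤ) - (N : ℤ) := by omega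
    rw [qcommFreeEval_qcommOp, e']
  · refine iSup_le fun k => Submodule.span_le.2 ?_
    rintro _ ⟨w, ⟨hw, hw'⟩, rfl⟩
    -- The spanning products of the filtration step need not be multilinear even if `w` is. `algEval
    -- ∘ algRet` fixes the multilinear part and kills the products of other content, so the claim is
    -- proved for projected elements.
    have hpr : ∀ w ∈ tpowFilt K N n k, HahnSeries.single ((k : ℤ) - (N : ℤ)) (1 : K) ⊗ₜ[K]
        algEval K N n (algRet K N n w) ∈ LinearMap.range (qcommFreeEval K N n) := by
      intro w hw
      have hw' := tpowFilt_le_span hw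
      clear hw
      induction hw' using Submodule.span_induction with
      | mem w hw =>
        obtain ⟨V, hk, rfl⟩ := hw
        rw [algRet_lieTensor]
        by_cases hV : ∑ j, (blockWord (V j) : Multiset (Fin N)) = Finset.univ.val
        · have e := sum_length_add_bracketCount hV
          -- The surplus of `k` over the actual number of factors is made up by multiplying with a
          -- power of `ħ`.
          refine ⟨(PowerSeries.X : K⟦X⟧) ^ (k - ∑ j, (V j).length) • qcommOp K V, ?_⟩
          rw [map_smul, qcommFreeEval_qcommOp, TensorProduct.smul_tmul', algOp]
          congr 1
          rw [← algebraMap_smul K⸨X⸩, smul_eq_mul, map_pow, algebraMap_X, HahnSeries.single_pow,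
            HahnSeries.single_mul_single, one_pow, mul_one, nsmul_eq_mul]
          congr 2
          rw [Nat.cast_sub hk]
          omega
        · rw [lieOp_eq_zero _ _ _ hV, map_zero, TensorProduct.tmul_zero]
          exact zero_mem _
      | zero =>
        rw [map_zero, map_zero, TensorProduct.tmul_zero]
        exact zero_mem _
      | add x y _ _ hx hy =>
        rw [map_add, map_add, TensorProduct.tmul_add]
        exact add_mem hx hy
      | smul r x _ hx =>
        rw [map_smul, map_smul, C_smul_tmul]
        exact Submodule.smul_mem _ _ hx
    rw [SetLike.mem_coe, ← range_algEval] at hw'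
    obtain ⟨x, rfl⟩ := hw'
    have h := hpr _ hw
    rwa [algRet_algEval] at h

theorem image_range_qcommToLaurent (N n : ℕ) :
    algLaurentEval K N n '' Set.range ((qcommToLaurent K).app N n) =
      (qcommLattice K N n : Set (LaurentTPow K N n)) := by
  rw [← range_qcommFreeEval]
  ext z
  constructor
  · rintro ⟨_, ⟨y, rfl⟩, rfl⟩
    obtain ⟨x, rfl⟩ := (qcommFreeToProp_bijective N n).2 y
    rw [qcommToLaurent_app]
    exact ⟨x, rfl⟩
  · rintro ⟨x, rfl⟩
    exact ⟨_, ⟨_, rfl⟩, congrArg _ (qcommToLaurent_app x)⟩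

/-! ### The reduction modulo `ħ` -/

/-- The morphism from the prop of Poisson algebras given by a deformed Poisson algebra whose
product is commutative. -/
def poissonLift {R S : Type u} [CommRing R] [CommRing S] (σ : R →+* S) {Q : LinProp.{u, u} S}
    {h : S} {e : Q.Hom 0 1} {m b : Q.Hom 2 1} (H : Q.IsQuasiPoisson h e m b) (hb : h • b = 0) :
    PropHom σ (poissonProp R) Q :=
  PropHom.ofRestrict (presentedLift (PoissonRel R) (Q.restrict σ) (bracketVal (P := Q) e m b) (by
    intro n k x y h
    cases h with
    | assoc => exact H.assoc
    | one_mul => exact H.one_mul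
    | mul_one => exact H.mul_one
    | mul_comm =>
      -- As `h • b` vanishes, the commutator relation says that the product is commutative.
      have h1 := H.comm
      rw [hb, neg_one_smul] at h1
      exact add_neg_eq_zero.1 h1
    | skew => exact H.skew
    | jacobi => exact H.jacobi
    | leibniz => exact H.leibniz))

theorem poissonProp_isQuasiPoisson (R : Type u) [CommRing R] :
    (poissonProp R).IsQuasiPoisson (0 : R) (poissonGen R .unit) (poissonGen R .mul)
      (poissonGen R .bracket) where
  assoc := PresHom.sound _ (.of .assoc)
  one_mul := PresHom.sound _ (.of .one_mul)
  mul_one := PresHom.sound _ (.of .mul_one)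
  comm := by
    have h : poissonGen R .mul = (poissonProp R).comp ((poissonProp R).perm (Equiv.swap 0 1))
      (poissonGen R .mul) := PresHom.sound _ (.of .mul_comm)
    rw [← h, neg_one_smul, zero_smul, add_neg_cancel]
  skew := PresHom.sound _ (.of .skew)
  jacobi := PresHom.sound _ (.of .jacobi)
  leibniz := PresHom.sound _ (.of .leibniz)

theorem span_poissonOp (R : Type u) [CommRing R] (N n : ℕ) :
    Submodule.span R (Set.range fun V : StandardIdx N n => lieOp (poissonGen R .unit)
      (poissonGen R .mul) (poissonGen R .bracket) V.1) = ⊤ := by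
  refine (poissonProp_isQuasiPoisson R).span_lieOp (fun x => ?_) N n
  obtain ⟨t, rfl⟩ := PresHom.mk_surjective _ x
  refine ⟨t, Eq.trans ?_ (eval_presentedProp t)⟩
  congr 1
  funext n m g
  exact bracketVal_gen (poissonGen R) g

variable (K) in
/-- The projection of the prop of quasi-commutative algebras to its reduction. -/
def qcommToModH : PropHom (RingHom.id K⟦X⟧) (qcommProp K) (qcommProp K).modH :=
  ((qcommProp K).smulIdeal (hIdeal K)).proj

theorem X_smul_modH {n m : ℕ} (x : (qcommProp K).modH.Hom n m) :
    (PowerSeries.X : K⟦X⟧) • x = 0 := by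
  obtain ⟨x, rfl⟩ := ((qcommProp K).smulIdeal (hIdeal K)).proj_surjective n m x
  change (PowerSeries.X : K⟦X⟧) • (qcommToModH K).app n m x = 0
  rw [← map_smul]
  exact (PropIdeal.proj_eq_zero_iff _).2 (Submodule.smul_mem_smul
    (Ideal.mem_span_singleton_self _) Submodule.mem_top)

theorem smul_modH (r : K⟦X⟧) {n m : ℕ} (x : (qcommProp K).modH.Hom n m) :
    r • x = (PowerSeries.C (PowerSeries.constantCoeff r) : K⟦X⟧) • x := by
  obtain ⟨s, hs⟩ : PowerSeries.X ∣ r - PowerSeries.C (PowerSeries.constantCoeff r) := by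
    rw [PowerSeries.X_dvd_iff, map_sub, PowerSeries.constantCoeff_C, sub_self]
  rw [← sub_eq_zero, ← sub_smul, hs, mul_comm, mul_smul, X_smul_modH, smul_zero]

theorem modH_isQuasiPoisson : (qcommProp K).modH.IsQuasiPoisson PowerSeries.X
    ((qcommProp K).toModH (qcommGen K .unit)) ((qcommProp K).toModH (qcommGen K .mul))
      ((qcommProp K).toModH (qcommGen K .bracket)) :=
  qcommProp_isQuasiPoisson.map (qcommToModH K)

variable (K) in
/-- The isomorphism from the prop of Poisson algebras to the reduction modulo `ħ` of the prop of
quasi-commutative algebras. -/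
def poissonToModH : PropHom (PowerSeries.C (R := K)) (poissonProp K) (qcommProp K).modH :=
  poissonLift _ modH_isQuasiPoisson (X_smul_modH _)

theorem poissonToModH_gen {n m : ℕ} (g : BracketGen n m) :
    (poissonToModH K).app n m (poissonGen K g) = (qcommProp K).toModH (qcommGen K g) := by
  cases g <;> rfl

/-- The image contains the generators and is closed under the prop operations. It is also closed
under power series scalars, because modulo `ħ` these act through their constant coefficients. -/
theorem poissonToModH_surjective (N n : ℕ) :
    Function.Surjective ((poissonToModH K).app N n) := by
  intro z
  obtain ⟨y, rfl⟩ := ((qcommProp K).smulIdeal (hIdeal K)).proj_surjective N n z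
  obtain ⟨x, rfl⟩ := qcommPresToProp_surjective N n y
  let F := (qcommPresToProp K).trans (qcommToModH K)
  change ∃ a, (poissonToModH K).app N n a = F.app N n x
  induction x using presentedProp_induction (QCommRel K) with
  | gen g => exact ⟨poissonGen K g, poissonToModH_gen g⟩
  | perm e => exact ⟨(poissonProp K).perm e, by rw [PropHom.map_perm, PropHom.map_perm]⟩
  | comp x y hx hy =>
    obtain ⟨a, ha⟩ := hx
    obtain ⟨b, hb⟩ := hy
    exact ⟨(poissonProp K).comp a b, by rw [PropHom.map_comp, PropHom.map_comp, ha, hb]⟩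
  | tens x y hx hy =>
    obtain ⟨a, ha⟩ := hx
    obtain ⟨b, hb⟩ := hy
    exact ⟨(poissonProp K).tens a b, by rw [PropHom.map_tens, PropHom.map_tens, ha, hb]⟩
  | zero => exact ⟨0, by rw [map_zero, map_zero]⟩
  | add x y hx hy =>
    obtain ⟨a, ha⟩ := hx
    obtain ⟨b, hb⟩ := hy
    exact ⟨a + b, by rw [map_add, map_add, ha, hb]⟩
  | smul r x hx =>
    obtain ⟨a, ha⟩ := hx
    refine ⟨PowerSeries.constantCoeff r • a, ?_⟩
    rw [LinearMap.map_smulₛₗ, LinearMap.map_smulₛₗ, ha]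
    exact (smul_modH r _).symm

variable (K) in
/-- The standard products of iterated brackets form a basis of the operations of `qcommProp`. -/
def qcommPropBasis (N n : ℕ) : Module.Basis (StandardIdx N n) K⟦X⟧ ((qcommProp K).Hom N n) :=
  (qcommBasis K N n).map (LinearEquiv.ofBijective _ (qcommFreeToProp_bijective N n))

theorem qcommPropBasis_apply {N n : ℕ} (V : StandardIdx N n) : qcommPropBasis K N n V =
    lieOp (qcommGen K .unit) (qcommGen K .mul) (qcommGen K .bracket) V.1 := by
  rw [qcommPropBasis, Module.Basis.map_apply, qcommBasis_apply]
  exact map_lieOp (qcommFreeToProp K) _ _ _ _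

/-- The standard products span `Poisson(N, n)` and go to the classes of a basis over `K[[ħ]]`. If a
combination with constant coefficients vanishes modulo `ħ`, each coefficient is divisible by `ħ`,
hence zero. No prior basis of `Poisson(N, n)` is required. -/
theorem poissonToModH_injective (N n : ℕ) :
    Function.Injective ((poissonToModH K).app N n) := by
  have := Fintype.ofFinite (StandardIdx N n)
  rw [injective_iff_map_eq_zero]
  intro x hx
  have hmem : x ∈ Submodule.span K (Set.range fun V : StandardIdx N n => lieOp
      (poissonGen K .unit) (poissonGen K .mul) (poissonGen K .bracket) V.1) := by
    rw [span_poissonOp]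
    exact Submodule.mem_top
  obtain ⟨c, rfl⟩ := (Submodule.mem_span_range_iff_exists_fun K).1 hmem
  have h1 : (qcommToModH K).app N n
      (∑ V, (PowerSeries.C (c V) : K⟦X⟧) • qcommPropBasis K N n V) = 0 := by
    rw [← hx, map_sum, map_sum]
    refine Finset.sum_congr rfl fun V _ => ?_
    rw [LinearMap.map_smulₛₗ, LinearMap.map_smulₛₗ, qcommPropBasis_apply, map_lieOp, map_lieOp]
    rfl
  have h2 := ((qcommPropBasis K N n).mem_ideal_smul_top_iff _ _).1
    ((Submodule.Quotient.mk_eq_zero _).1 h1)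
  refine Finset.sum_eq_zero fun V _ => ?_
  have h3 := h2 V
  rw [Module.Basis.repr_sum_self, hIdeal, Ideal.mem_span_singleton, PowerSeries.X_dvd_iff,
    PowerSeries.constantCoeff_C] at h3
  rw [h3, zero_smul]

end Main

end

theorem mainTheorem11 (K : Type u) [Field K] [CharZero K] :
    -- the identification of `Alg(N, n)` with the multilinear part of `U(FL_N)^{⊗ n}`
    (∀ N n : ℕ, Function.Injective (algEval K N n) ∧
      LinearMap.range (algEval K N n) = multidegreePart K N n (fun _ => 1)) ∧
    -- the canonical embedding in `Alg((ħ))` and its image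
    (∃ Φ : PropHom (algebraMap K⟦X⟧ K⸨X⸩) (qcommProp K) (algLaurent K),
      Φ.app 0 1 (qcommGen K .unit) = algLaurentMk K 1 (algGen K .unit) ∧
      Φ.app 2 1 (qcommGen K .mul) = algLaurentMk K 1 (algGen K .mul) ∧
      Φ.app 2 1 (qcommGen K .bracket) = algLaurentMk K (HahnSeries.single (-1 : ℤ) (1 : K))
        (algGen K .mul - (algProp K).comp ((algProp K).perm (Equiv.swap (0 : Fin 2) 1))
          (algGen K .mul)) ∧
      (∀ Φ' : PropHom (algebraMap K⟦X⟧ K⸨X⸩) (qcommProp K) (algLaurent K),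
        Φ'.app 0 1 (qcommGen K .unit) = algLaurentMk K 1 (algGen K .unit) →
        Φ'.app 2 1 (qcommGen K .mul) = algLaurentMk K 1 (algGen K .mul) → Φ' = Φ) ∧
      ∀ N n : ℕ, Function.Injective (Φ.app N n) ∧
        algLaurentEval K N n '' Set.range (Φ.app N n) =
          (qcommLattice K N n : Set (LaurentTPow K N n))) ∧
    -- the reduction modulo `ħ`
    (∃ Ψ : PropHom (PowerSeries.C (R := K)) (poissonProp K) (qcommProp K).modH,
      (∀ {n m : ℕ} (g : BracketGen n m),
        Ψ.app n m (poissonGen K g) = (qcommProp K).toModH (qcommGen K g)) ∧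
      (∀ Ψ' : PropHom (PowerSeries.C (R := K)) (poissonProp K) (qcommProp K).modH,
        (∀ {n m : ℕ} (g : BracketGen n m),
          Ψ'.app n m (poissonGen K g) = (qcommProp K).toModH (qcommGen K g)) → Ψ' = Ψ) ∧
      ∀ N n : ℕ, Function.Bijective (Ψ.app N n)) ∧
    IsFlatDeformation (qcommProp K) (poissonProp K) := by
  refine ⟨fun N n => ⟨algEval_injective N n, range_algEval N n⟩,
    ⟨qcommToLaurent K, qcommToLaurent_unit, qcommToLaurent_mul, qcommToLaurent_bracket,
      qcommToLaurent_unique,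
      fun N n => ⟨qcommToLaurent_injective N n, image_range_qcommToLaurent N n⟩⟩,
    ⟨poissonToModH K, poissonToModH_gen, fun F hF => ?_,
      fun N n => ⟨poissonToModH_injective N n, poissonToModH_surjective N n⟩⟩,
    fun N n => topFree_of_basis (qcommPropBasis K N n), poissonToModH K,
    fun N n => ⟨poissonToModH_injective N n, poissonToModH_surjective N n⟩⟩
  exact presentedProp_hom_ext fun g => (hF g).trans (poissonToModH_gen g).symm
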